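/- A polyhedron is a set $P\subset\mathbb R^3$ that is a finite union of convex hulls of finite sets, is the closure of its interior, and has connected nonempty interior; it need not be convex. A boundary point $x$ of $P$ is flat if $P$ coincides near $x$ with a closed half-space whose boundary contains $x$. The faces of $P$ are the closures of the connected components of the set of flat points; every face $G$ lies in a plane, and its half-space $S_G$ is the closed half-space bounded by that plane that coincides with $P$ near the flat points of $G$. The one-skeleton of $P$ is the set of its non-flat boundary points. A point of the one-skeleton is an edge point if the one-skeleton is a straight line near it, and a vertex otherwise; the edges are the closures of the connected components of the set of edge points, and the degree of a vertex is the number of edges that contain it. Let $e(P)$ be the total length of the edges, $v(P)$ the volume, and $m(P)=e(P)^3/v(P)$ the Melzak ratio. A face $F$ of $P$ is exposed if there is an open set $U\supseteq F$ such that $U\cap P$ is convex. Theorem. Let $P$ be a polyhedron with an exposed face $F$ that contains a vertex of $P$ of degree greater than $3$. Let $S_F=\{y:\langle n,y\rangle\le c\}$ with $n$ the outward unit normal, and let $K$ be the intersection of the half-spaces $S_G$ over all faces $G\ne F$ with $G\cap F\neq\emptyset$. Then there are an open set $U\supseteq F$ and numbers $0<\varepsilon<\delta$ such that $$U\cap P=\{y\in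 K: c-\delta<\langle n,y\rangle\le c\},\qquad K_t:=\{y\in K: c-\delta<\langle n,y\rangle\le c+t\}\subseteq U\quad(|t|\le\varepsilon),$$ and such that the sets $P_t=(P\setminus U)\cup K_t$ (so $P_0=P$), obtained from $P$ by translating the supporting plane of $F$ by $t$ in the direction $n$, satisfy at least one of the following: 1. (outward) for every $t\in(0,\varepsilon]$, $P_t$ is a polyhedron with the same number of faces as $P$, and $m(P_t)<m(P)$; 2. (inward) for every $t\in(0,\varepsilon]$, $P_{-t}$ is a polyhedron with the same number of faces as $P$, and $m(P_{-t})<m(P)$. -/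

import Mathlib

open Set Filter Topology MeasureTheory

namespace Melzak

/-- Euclidean three-space. -/
abbrev E3 : Type := EuclideanSpace ℝ (Fin 3)

/-- A (solid, not necessarily convex) polyhedron: a finite union of convex hulls of finite sets,
which is the closure of its interior, the interior being connected and nonempty. -/
structure IsPolyhedron (P : Set E3) : Prop where
  exists_finite_union : ∃ S : Set (Set E3), S.Finite ∧
    (∀ C ∈ S, ∃ s : Set E3, s.Finite ∧ C = convexHull ℝ s) ∧ P = ⋃₀ S
  closure_interior : closure (interior P) = P
  isConnected_interior : IsConnected (interior P)

/-- `P` coincides near its boundary point `x` with the closed half-space `⟪n, y⟫ ≤ c`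
with outward unit normal `n`. -/
def IsHalfspaceAt (P : Set E3) (x n : E3) (c : ℝ) : Prop :=
  ‖n‖ = 1 ∧ inner ℝ n x = c ∧ ∀ᶠ y in 𝓝 x, (y ∈ P ↔ inner ℝ n y ≤ c)

/-- The boundary points near which the boundary of `P` is flat
(the points in the relative interiors of the faces). -/
def flatPoints (P : Set E3) : Set E3 :=
  {x | ∃ (n : E3) (c : ℝ), IsHalfspaceAt P x n c}

/-- The faces of `P`: the closures of the connected components of the set of flat boundary points.
Each of them is a planar polygonal region. -/
def faces (P : Set E3) : Set (Set E3) :=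
  {F | ∃ x ∈ flatPoints P, F = closure (connectedComponentIn (flatPoints P) x)}

/-- The one-skeleton of `P` (the union of its edges): the boundary points that are not flat. -/
def skeleton (P : Set E3) : Set E3 :=
  frontier P \ flatPoints P

/-- The points in the relative interior of an edge: near them the one-skeleton is a line. -/
def edgePoints (P : Set E3) : Set E3 :=
  {x | x ∈ skeleton P ∧
    ∃ d : E3, d ≠ 0 ∧ ∀ᶠ y in 𝓝 x, (y ∈ skeleton P ↔ ∃ r : ℝ, y = x + r • d)}

/-- The edges of `P`: the closures of the connected components of the set of edge points. -/
def edges (P : Set E3) : Set (Set E3) :=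
  {e | ∃ x ∈ edgePoints P, e = closure (connectedComponentIn (edgePoints P) x)}

/-- The vertices of `P`: the points of the one-skeleton that are not interior to an edge. -/
def vertices (P : Set E3) : Set E3 :=
  skeleton P \ edgePoints P

/-- The degree of a vertex: the number of edges ending there. -/
noncomputable def degree (P : Set E3) (H : E3) : ℕ :=
  {e | e ∈ edges P ∧ H ∈ e}.ncard

/-- The edge length `e(P)`: the total length (one-dimensional Hausdorff measure) of the edges. -/
noncomputable def edgeLength (P : Set E3) : ℝ :=
  (Measure.hausdorffMeasure 1 (skeleton P)).toReal

/-- The Melzak ratio `e(P)³ / v(P)`. -/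
noncomputable def melzakRatio (P : Set E3) : ℝ :=
  edgeLength P ^ 3 / (volume P).toReal

/-- A face is exposed if it has an open neighbourhood in which `P` is convex. -/
def IsExposed (P F : Set E3) : Prop :=
  ∃ U : Set E3, IsOpen U ∧ F ⊆ U ∧ Convex ℝ (U ∩ P)

/-- The half-space `⟪n, y⟫ ≤ c` is the one that corresponds to the face `F` of `P`: its boundary
is the supporting plane of `F`, and `n` is the outward unit normal of `P` along `F`. -/
def IsFaceHalfspace (P F : Set E3) (n : E3) (c : ℝ) : Prop :=
  F ⊆ {y | inner ℝ n y = c} ∧ ∃ x ∈ F, IsHalfspaceAt P x n c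

/-- The intersection of the closed half-spaces that correspond to the other faces meeting `F`. -/
def neighborCone (P F : Set E3) : Set E3 :=
  {y | ∀ G ∈ faces P, G ≠ F → (G ∩ F).Nonempty →
    ∀ (n : E3) (c : ℝ), IsFaceHalfspace P G n c → inner ℝ n y ≤ c}

/-- The intersection of the closed half-spaces of the faces meeting `F`, where the half-space
`⟪n, y⟫ ≤ c` of `F` itself is translated by `t` in the direction `n`, and of the open half-space
`c - δ < ⟪n, y⟫`. -/
def collar (P F : Set E3) (n : E3) (c δ t : ℝ) : Set E3 :=
  {y | y ∈ neighborCone P F ∧ c - δ < inner ℝ n y ∧ inner ℝ n y ≤ c + t}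

/-- Sliding the face `F` by `t` in its normal direction (outward for `t > 0`, inward for `t < 0`):
the part of `P` in `U` is replaced by the collar with the translated half-space. -/
def slideFace (P F U : Set E3) (n : E3) (c δ t : ℝ) : Set E3 :=
  (P \ U) ∪ collar P F n c δ t

/-- In the open neighbourhood `U` of the face `F`, the polyhedron `P` is the intersection of the
closed half-spaces of `F` and of the faces meeting `F` with one open half-space. -/
structure IsCollarNhd (P F U : Set E3) (n : E3) (c δ : ℝ) : Prop where
  isFaceHalfspace : IsFaceHalfspace P F n c
  pos : 0 < δ
  isOpen : IsOpen U
  subset : F ⊆ U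
  inter_eq : U ∩ P = collar P F n c δ 0

/-- `Q` is a polyhedron with as many faces as `P` and with smaller Melzak ratio. -/
structure Improves (Q P : Set E3) : Prop where
  isPolyhedron : IsPolyhedron Q
  ncard_faces : (faces Q).ncard = (faces P).ncard
  ratio_lt : melzakRatio Q < melzakRatio P

end Melzak

/-!
# Sliding an exposed face decreases the Melzak ratio

The half-spaces of an exposed face `F` and of its neighbours describe `P` near `F`
(`exists_isFaceSystem`): a point close to `F` that satisfies their inequalities without being in `P`
could be joined to an interior point of `P` by a segment that leaves `P` at a flat point of one of
these faces. Sliding `F` by a small `t` therefore changes `P` inside a convex polyhedral collar only.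

Let `E t` and `V t` be the edge length and the volume of the slid set. The volume is differentiable at
`t = 0` with derivative the area of `F` up to a constant (`exists_hasDerivAt_volume_slab`). The edge
length need not be, but it has one-sided bounds `E t ≤ E 0 + α₂ * t` and `E (-t) ≤ E 0 - α₁ * t` for
small `t > 0`, with `α₂ ≤ α₁` (`IsFaceSystem.exists_edge_estimates`). When `α₂ < α₁`, the ratio
`E t ^ 3 / V t` must decrease for one sign of `t` (`eventually_ratio_lt_or`).

The inequality `α₂ ≤ α₁` says that `E` behaves like a concave function at `0`. Consider the section of
the collar at height `s` over the plane of `F`, and on each neighbouring face the segment in which the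
section meets it. An end point of this segment moves on the face with velocity `w + h • τ` per unit of
height, where `τ` is the direction of the segment. The path it traces is an edge of `P`, and
`‖w + h • τ‖ ± h` is monotone in `h`; by convexity of the face the segments lengthen more slowly above
the plane than below it, and this yields the inequality for the lengths of the two traced edges
together with the length of the segment (`IsFaceSystem.exists_facet_estimates`). In the sum over all
neighbours every traced edge is counted twice, but every side of the section only once. The missing
half of the perimeter is a concave function of the height, since by Cauchy's formula the perimeter is
the mean width, and widths of sections of a convex set are concave (`IsFaceSystem.sum_slope_le`).

The inequality is strict as soon as some neighbour meets the plane of `F` in a single point, because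
then the segment on it shrinks to a point and two edges end there. If every neighbour met `F` in a
segment, then no point of `F` would lie on three of their planes (`IsFaceSystem.not_three_active`),
so that near a vertex on `F` the polyhedron would be the intersection of three half-spaces, and the
degree of the vertex would be at most three (`IsCollar.exists_facetSlice_subsingleton`).

That the slid sets are polyhedra with equally many faces is proved by means of semilinear sets, which
are described by the signs of finitely many affine functions. Polytopes are semilinear, compact
semilinear sets are finite unions of polytopes (`IsSemilinear.exists_finite_union`), and the faces of a
semilinear set are finite in number. Each face other than `F` has flat points in the region that the
sliding does not affect, and the components of the flat points seen there are the same before and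
after (`IsCollar.ncard_faces_slid`).
-/

namespace Melzak

/-! ### Half-spaces near a facet -/

/-- Three functions each of which vanishes at a point where the two others are negative are
linearly independent. Here `a`, `b`, `c` are the functions, the indices are those of the points,
and `α`, `β`, `γ` are the coefficients of a vanishing combination. -/
theorem eq_zero_of_sign_pattern {α β γ a₂ a₃ b₁ b₃ c₁ c₂ : ℝ}
    (ha₂ : a₂ < 0) (ha₃ : a₃ < 0) (hb₁ : b₁ < 0) (hb₃ : b₃ < 0) (hc₁ : c₁ < 0) (hc₂ : c₂ < 0)
    (h₁ : β * b₁ + γ * c₁ = 0) (h₂ : α * a₂ + γ * c₂ = 0) (h₃ : α * a₃ + β * b₃ = 0) :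
    α = 0 ∧ β = 0 ∧ γ = 0 := by
  have key : ∀ {p q x y : ℝ}, x < 0 → y < 0 → p * x + q * y = 0 → 0 < p → q < 0 := by
    intro p q x y hx hy h hp
    by_contra! hq
    nlinarith [mul_neg_of_pos_of_neg hp hx, mul_nonpos_of_nonneg_of_nonpos hq hy.le]
  have key' : ∀ {p q x y : ℝ}, x < 0 → y < 0 → p * x + q * y = 0 → p < 0 → 0 < q := by
    intro p q x y hx hy h hp
    by_contra! hq
    nlinarith [mul_pos_of_neg_of_neg hp hx, mul_nonneg_of_nonpos_of_nonpos hq hy.le]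
  have hα : α = 0 := by
    rcases lt_trichotomy α 0 with h | h | h
    · have hβ := key' ha₃ hb₃ h₃ h
      have hγ := key' ha₂ hc₂ h₂ h
      have := key hb₁ hc₁ h₁ hβ
      linarith
    · exact h
    · have hβ := key ha₃ hb₃ h₃ h
      have hγ := key ha₂ hc₂ h₂ h
      have := key' hb₁ hc₁ h₁ hβ
      linarith
  subst hα
  simp only [zero_mul, zero_add, mul_eq_zero] at h₂ h₃
  exact ⟨rfl, h₃.resolve_right hb₃.ne, h₂.resolve_right hc₂.ne⟩

/-- The orthogonal complement of two linearly independent vectors of `E3` is a line; `τ` is a unit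
vector on it. -/
theorem exists_unit_spanning_orthogonal {u v : E3} (h : LinearIndependent ℝ ![u, v]) :
    ∃ τ : E3, ‖τ‖ = 1 ∧ inner ℝ u τ = 0 ∧ inner ℝ v τ = 0 ∧
      ∀ y : E3, inner ℝ u y = 0 → inner ℝ v y = 0 → y = inner ℝ τ y • τ := by
  set S : Submodule ℝ E3 := Submodule.span ℝ (Set.range ![u, v]) with hS
  have h2 : Module.finrank ℝ S = 2 := by
    simpa using finrank_span_eq_card h
  have h3 : Module.finrank ℝ S + Module.finrank ℝ Sᗮ = 3 := by
    simpa using S.finrank_add_finrank_orthogonal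
  have h1 : Module.finrank ℝ Sᗮ = 1 := by omega
  obtain ⟨⟨t, htS⟩, ht0, ht⟩ := finrank_eq_one_iff'.mp h1
  have ht0' : t ≠ 0 := fun h => ht0 (by simpa using h)
  have hnt : ‖t‖ ≠ 0 := by simpa using ht0'
  have hu : u ∈ S := Submodule.subset_span ⟨0, rfl⟩
  have hv : v ∈ S := Submodule.subset_span ⟨1, rfl⟩
  have hut := (Submodule.mem_orthogonal S t).mp htS u hu
  have hvt := (Submodule.mem_orthogonal S t).mp htS v hv
  refine ⟨(‖t‖⁻¹) • t, ?_, ?_, ?_, ?_⟩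
  · rw [norm_smul, norm_inv, norm_norm, inv_mul_cancel₀ hnt]
  · rw [inner_smul_right, hut, mul_zero]
  · rw [inner_smul_right, hvt, mul_zero]
  · intro y hy hy'
    have hyS : y ∈ Sᗮ := by
      rw [Submodule.mem_orthogonal]
      intro z hz
      refine Submodule.span_induction ?_ ?_ ?_ ?_ hz
      · rintro x ⟨i, rfl⟩
        fin_cases i
        · exact hy
        · exact hy'
      · simp
      · intro a b _ _ ha hb
        rw [inner_add_left, ha, hb, add_zero]
      · intro a b _ hb
        rw [inner_smul_left, hb, mul_zero]
    obtain ⟨r, hr⟩ := ht ⟨y, hyS⟩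
    have hr' : r • t = y := congrArg Subtype.val hr
    rw [← hr', inner_smul_left, inner_smul_right, real_inner_self_eq_norm_sq, smul_smul]
    congr 1
    simp only [conj_trivial]
    field_simp

/-- Three affine functions on `E3` with linearly independent linear parts separate points. -/
theorem eq_of_inner_eq_of_linearIndependent {u v w y z : E3}
    (h : LinearIndependent ℝ ![u, v, w]) (hu : inner ℝ u y = inner ℝ u z)
    (hv : inner ℝ v y = inner ℝ v z) (hw : inner ℝ w y = inner ℝ w z) : y = z := by
  have hspan : Submodule.span ℝ (Set.range ![u, v, w]) = ⊤ :=
    h.span_eq_top_of_card_eq_finrank' (by simp)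
  have : ∀ x ∈ Submodule.span ℝ (Set.range ![u, v, w]), inner ℝ x (y - z) = 0 := by
    intro x hx
    refine Submodule.span_induction ?_ ?_ ?_ ?_ hx
    · rintro x ⟨i, rfl⟩
      fin_cases i <;> simp [inner_sub_right, hu, hv, hw]
    · simp
    · intro a b _ _ ha hb
      rw [inner_add_left, ha, hb, add_zero]
    · intro a b _ hb
      rw [inner_smul_left, hb, mul_zero]
  have h0 := this (y - z) (by rw [hspan]; trivial)
  exact sub_eq_zero.mp (inner_self_eq_zero.mp h0)

/-- The combinatorial data of a convex polyhedron near one of its facets. The facet lies in the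
plane `⟪n, y⟫ = c`, and the half-spaces `⟪N i, y⟫ ≤ b i` are those of the other facets that meet
it: each of them touches the facet, and each carries a facet of its own, which has a relative
interior point below the plane. The intersection of the half-spaces is bounded in a slab around
the plane. -/
structure IsFaceSystem {ι : Type*} (n : E3) (c : ℝ) (N : ι → E3) (b : ι → ℝ) : Prop where
  norm_eq : ‖n‖ = 1
  exists_top : ∃ x, inner ℝ n x = c ∧ ∀ i, inner ℝ (N i) x < b i
  exists_facet : ∀ i, ∃ y, inner ℝ n y < c ∧ inner ℝ (N i) y = b i ∧
    ∀ k, k ≠ i → inner ℝ (N k) y < b k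
  exists_contact : ∀ i, ∃ z, inner ℝ n z = c ∧ inner ℝ (N i) z = b i ∧ ∀ k, inner ℝ (N k) z ≤ b k
  bounded : ∃ η > 0, Bornology.IsBounded
    {y : E3 | (∀ i, inner ℝ (N i) y ≤ b i) ∧ |inner ℝ n y - c| ≤ η}

/-- The intersection of the half-spaces `⟪N i, y⟫ ≤ b i`. -/
def cone {ι : Type*} (N : ι → E3) (b : ι → ℝ) : Set E3 :=
  {y | ∀ i, inner ℝ (N i) y ≤ b i}

namespace IsFaceSystem

variable {ι : Type*} {n : E3} {c : ℝ} {N : ι → E3} {b : ι → ℝ}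

/-- The affine functions that define two of the half-spaces and the plane of the facet are linearly
independent, since each of them vanishes at a point where the two others are negative. In
particular the three planes have no line in common. -/
theorem coeff_eq_zero (h : IsFaceSystem n c N b) {i j : ι} (hij : i ≠ j) {α β γ : ℝ}
    (h₁ : α • N i + β • N j + γ • n = 0) (h₂ : α * b i + β * b j + γ * c = 0) :
    α = 0 ∧ β = 0 ∧ γ = 0 := by
  obtain ⟨x, hx, hx'⟩ := h.exists_top
  obtain ⟨y, hy, hyi, hy'⟩ := h.exists_facet i
  obtain ⟨z, hz, hzj, hz'⟩ := h.exists_facet j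
  have key : ∀ p : E3, α * (inner ℝ (N i) p - b i) + β * (inner ℝ (N j) p - b j) +
      γ * (inner ℝ n p - c) = 0 := by
    intro p
    have : inner ℝ (α • N i + β • N j + γ • n) p = 0 := by rw [h₁, inner_zero_left]
    simp only [inner_add_left, inner_smul_left, conj_trivial] at this
    linarith
  refine eq_zero_of_sign_pattern (a₂ := inner ℝ (N i) z - b i) (a₃ := inner ℝ (N i) x - b i)
    (b₁ := inner ℝ (N j) y - b j) (b₃ := inner ℝ (N j) x - b j) (c₁ := inner ℝ n y - c)
    (c₂ := inner ℝ n z - c) ?_ ?_ ?_ ?_ ?_ ?_ ?_ ?_ ?_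
  · linarith [hz' i hij]
  · linarith [hx' i]
  · linarith [hy' j hij.symm]
  · linarith [hx' j]
  · linarith
  · linarith
  · have := key y
    rw [hyi] at this
    linarith
  · have := key z
    rw [hzj] at this
    linarith
  · have := key x
    rw [hx] at this
    linarith

theorem linearIndependent_pair (h : IsFaceSystem n c N b) (i : ι) :
    LinearIndependent ℝ ![n, N i] := by
  rw [LinearIndependent.pair_iff]
  intro s t hst
  obtain ⟨x, hx, hx'⟩ := h.exists_top
  obtain ⟨z, hz, hzi, -⟩ := h.exists_contact i
  have key : ∀ p : E3, s * inner ℝ n p + t * inner ℝ (N i) p = 0 := by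
    intro p
    have : inner ℝ (s • n + t • N i) p = 0 := by rw [hst, inner_zero_left]
    simpa [inner_add_left, inner_smul_left] using this
  have h1 := key x
  have h2 := key z
  rw [hx] at h1
  rw [hz, hzi] at h2
  have ht : t = 0 := by
    have : t * (inner ℝ (N i) x - b i) = 0 := by linarith
    rcases mul_eq_zero.mp this with h0 | h0
    · exact h0
    · linarith [hx' i]
  subst ht
  have hn : n ≠ 0 := by
    intro h0
    have := h.norm_eq
    simp [h0] at this
  simp only [zero_smul, add_zero, smul_eq_zero] at hst
  exact ⟨hst.resolve_right hn, rfl⟩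

/-- In a thin slab around the plane of the facet, the boundary planes of two of the half-spaces
have at most one common point on each level. -/
theorem eventually_subsingleton [Finite ι] (h : IsFaceSystem n c N b) :
    ∀ᶠ ε in 𝓝[>] (0 : ℝ), ∀ i j, i ≠ j → ∀ y z : E3, inner ℝ (N i) y = b i →
      inner ℝ (N j) y = b j → inner ℝ (N i) z = b i → inner ℝ (N j) z = b j →
      inner ℝ n y = inner ℝ n z → |inner ℝ n y - c| ≤ ε → y = z := by
  rw [eventually_all]
  intro i
  rw [eventually_all]
  intro j
  by_cases hij : i = j
  · exact Eventually.of_forall fun _ h => absurd hij h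
  by_cases hli : LinearIndependent ℝ ![N i, N j, n]
  · refine Eventually.of_forall fun ε _ y z h1 h2 h3 h4 h5 _ => ?_
    exact eq_of_inner_eq_of_linearIndependent hli (h1.trans h3.symm) (h2.trans h4.symm) h5
  · rw [Fintype.not_linearIndependent_iff] at hli
    obtain ⟨g, hg, k, hk⟩ := hli
    simp only [Fin.sum_univ_three, Matrix.cons_val_zero, Matrix.cons_val_one,
      Matrix.cons_val] at hg
    -- The linear parts are dependent, so by `coeff_eq_zero` the combination of the constant terms is
    -- a nonzero number `κ`: common points of the two planes have height `-κ / g 2`, which is not `0`.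
    set κ := g 0 * b i + g 1 * b j + g 2 * c with hκ
    have hκ0 : κ ≠ 0 := by
      intro h0
      obtain ⟨h1, h2, h3⟩ := h.coeff_eq_zero hij hg h0
      fin_cases k <;> simp_all
    have hpos : 0 < |κ| / (|g 2| + 1) := by positivity
    filter_upwards [Ioo_mem_nhdsGT hpos] with ε hε _ y z h1 h2 h3 h4 h5 h6
    exfalso
    have h0 : inner ℝ (g 0 • N i + g 1 • N j + g 2 • n) y = 0 := by rw [hg, inner_zero_left]
    simp only [inner_add_left, inner_smul_left, conj_trivial, h1, h2] at h0
    have h7 : κ = - (g 2 * (inner ℝ n y - c)) := by rw [hκ]; linarith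
    have h8 : |κ| = |g 2| * |inner ℝ n y - c| := by rw [h7, abs_neg, abs_mul]
    have h9 : ε * (|g 2| + 1) < |κ| := (lt_div_iff₀ (by positivity)).mp hε.2
    nlinarith [abs_nonneg (g 2), hε.1]

/-- Coordinates on the boundary plane of the `i`-th half-space: the height above the plane of the
facet, and the position along the direction `τ` common to both planes. -/
theorem exists_coordinates (h : IsFaceSystem n c N b) (i : ι) :
    ∃ o τ w : E3, ‖τ‖ = 1 ∧ inner ℝ n τ = 0 ∧ inner ℝ (N i) τ = 0 ∧ inner ℝ n w = 1 ∧
      inner ℝ (N i) w = 0 ∧ inner ℝ w τ = 0 ∧ inner ℝ n o = c ∧ inner ℝ (N i) o = b i ∧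
      (∀ k, inner ℝ (N k) o ≤ b k) ∧
      ∀ y, inner ℝ (N i) y = b i → ∃ r : ℝ, y = o + (inner ℝ n y - c) • w + r • τ := by
  have hli := h.linearIndependent_pair i
  obtain ⟨τ, hτ, hnτ, hNτ, hspan⟩ := exists_unit_spanning_orthogonal hli
  obtain ⟨o, ho, hoi, ho'⟩ := h.exists_contact i
  have hN0 : N i ≠ 0 := by simpa using hli.ne_zero 1
  have hNN : inner ℝ (N i) (N i) ≠ 0 := fun h0 => hN0 (inner_self_eq_zero.mp h0)
  -- `w` is the component of `n` orthogonal to `N i`, scaled so that `⟪n, w⟫ = 1`.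
  set q := inner ℝ (N i) n / inner ℝ (N i) (N i) with hq
  set w₀ := n - q • N i with hw₀
  have hw₀0 : w₀ ≠ 0 := by
    intro h0
    have := LinearIndependent.pair_iff.mp hli 1 (-q) (by rw [one_smul, neg_smul, ← sub_eq_add_neg]; exact h0)
    exact one_ne_zero this.1
  have h1 : inner ℝ (N i) w₀ = 0 := by
    rw [hw₀, inner_sub_right, inner_smul_right, hq, div_mul_cancel₀ _ hNN, sub_self]
  have h2 : inner ℝ n w₀ = inner ℝ w₀ w₀ := by
    conv_rhs => rw [hw₀, inner_sub_left, inner_smul_left, ← hw₀, h1]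
    simp
  have h3 : inner ℝ w₀ w₀ ≠ 0 := fun h0 => hw₀0 (inner_self_eq_zero.mp h0)
  have h4 : inner ℝ w₀ τ = 0 := by
    rw [hw₀, inner_sub_left, inner_smul_left, hnτ, hNτ]; simp
  refine ⟨o, τ, (inner ℝ w₀ w₀)⁻¹ • w₀, hτ, hnτ, hNτ, ?_, ?_, ?_, ho, hoi, ho', ?_⟩
  · rw [inner_smul_right, h2, inv_mul_cancel₀ h3]
  · rw [inner_smul_right, h1, mul_zero]
  · rw [inner_smul_left, h4, mul_zero]
  · intro y hy
    set w := (inner ℝ w₀ w₀)⁻¹ • w₀ with hw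
    have hnw : inner ℝ n w = 1 := by rw [hw, inner_smul_right, h2, inv_mul_cancel₀ h3]
    have hNw : inner ℝ (N i) w = 0 := by rw [hw, inner_smul_right, h1, mul_zero]
    refine ⟨inner ℝ τ (y - o - (inner ℝ n y - c) • w), ?_⟩
    have := hspan (y - o - (inner ℝ n y - c) • w) (by
      simp [inner_sub_right, inner_smul_right, hnw, ho]) (by
      simp [inner_sub_right, inner_smul_right, hNw, hy, hoi])
    rw [← this]
    abel

end IsFaceSystem

/-! ### Sections of a planar polygon -/
/-- The minimum of finitely many affine functions of one variable is affine on both sides of `0`,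
and its slope does not increase. -/
theorem exists_min_affine {κ : Type*} [Finite κ] [Nonempty κ] (p q : κ → ℝ) :
    ∃ P Q₁ Q₂ : ℝ, Q₂ ≤ Q₁ ∧ ∀ᶠ ε in 𝓝[>] (0 : ℝ),
      (∀ s, -ε ≤ s → s ≤ 0 → ∀ r, (∀ k, r ≤ p k + q k * s) ↔ r ≤ P + Q₁ * s) ∧
      (∀ s, 0 ≤ s → s ≤ ε → ∀ r, (∀ k, r ≤ p k + q k * s) ↔ r ≤ P + Q₂ * s) := by
  classical
  cases nonempty_fintype κ
  obtain ⟨k₀, -, hk₀⟩ := Finset.exists_min_image Finset.univ p Finset.univ_nonempty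
  -- Near `0` only the functions with the least value at `0` matter; of these, the one of largest
  -- slope is the minimum on the left of `0`, and the one of least slope on the right.
  set T := Finset.univ.filter fun k => p k = p k₀ with hT
  have hTne : T.Nonempty := ⟨k₀, by simp [hT]⟩
  obtain ⟨k₁, hk₁, hmax⟩ := Finset.exists_max_image T q hTne
  obtain ⟨k₂, hk₂, hmin⟩ := Finset.exists_min_image T q hTne
  simp only [hT, Finset.mem_filter, Finset.mem_univ, true_and] at hk₁ hk₂ hmax hmin
  refine ⟨p k₀, q k₁, q k₂, hmax _ hk₂, ?_⟩
  have hev : ∀ᶠ ε in 𝓝[>] (0 : ℝ), ∀ k, p k ≠ p k₀ → ∀ s, |s| ≤ ε →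
      p k₀ + q k₁ * s ≤ p k + q k * s ∧ p k₀ + q k₂ * s ≤ p k + q k * s := by
    rw [eventually_all]
    intro k
    by_cases hk : p k = p k₀
    · exact Eventually.of_forall fun _ h => absurd hk h
    have hlt : p k₀ < p k := lt_of_le_of_ne (hk₀ k (Finset.mem_univ k)) (Ne.symm hk)
    set D := |q k₁ - q k| + |q k₂ - q k| + 1 with hD
    have hDpos : 0 < D := by positivity
    filter_upwards [Ioo_mem_nhdsGT (div_pos (sub_pos.mpr hlt) hDpos)] with ε hε _ s hs
    have h1 : ε * D < p k - p k₀ := (lt_div_iff₀ hDpos).mp hε.2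
    have hb : ∀ x : ℝ, |x| ≤ D → x * s ≤ p k - p k₀ := by
      intro x hx
      calc x * s ≤ |x * s| := le_abs_self _
        _ = |x| * |s| := abs_mul _ _
        _ ≤ D * ε := mul_le_mul hx hs (abs_nonneg _) hDpos.le
        _ ≤ _ := by linarith
    have h2 := hb (q k₁ - q k) (by rw [hD]; linarith [abs_nonneg (q k₂ - q k)])
    have h3 := hb (q k₂ - q k) (by rw [hD]; linarith [abs_nonneg (q k₁ - q k)])
    constructor <;> linarith
  filter_upwards [hev] with ε hε
  refine ⟨fun s hs hs' r => ⟨fun h => ?_, fun h k => ?_⟩, fun s hs hs' r =>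
    ⟨fun h => ?_, fun h k => ?_⟩⟩
  · rw [← hk₁]; exact h k₁
  · by_cases hk : p k = p k₀
    · rw [hk]
      nlinarith [hmax k hk]
    · exact h.trans (hε k hk s (abs_le.mpr ⟨hs, by linarith⟩)).1
  · rw [← hk₂]; exact h k₂
  · by_cases hk : p k = p k₀
    · rw [hk]
      nlinarith [hmin k hk]
    · exact h.trans (hε k hk s (abs_le.mpr ⟨by linarith, hs'⟩)).2

/-- The sections `s = const` of a planar convex polygon near the line `s = 0`. Their end points
are affine functions of `s` on both sides of `0`, and the sections grow at least as fast for
`s < 0` as they do for `s > 0`. If the section at `s = 0` is a point, then the sections with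
`s > 0` are empty. -/
theorem exists_section_eq_Icc {κ : Type*} [Finite κ] (A B C : κ → ℝ) (hC : ∀ k, 0 ≤ C k)
    (hB : ∀ k, B k = 0 → 0 < C k) {s₁ r₁ : ℝ} (hs₁ : s₁ < 0)
    (hneg : ∀ k, A k * s₁ + B k * r₁ < C k)
    (hbdd : ∃ R, ∀ r, (∀ k, B k * r ≤ C k) → |r| ≤ R) :
    ∃ l₀ h₀ l₁ h₁ l₂ h₂ : ℝ, l₀ ≤ h₀ ∧ l₁ ≤ l₂ ∧ h₂ ≤ h₁ ∧ (l₀ = h₀ → h₁ < l₁) ∧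
      ∀ᶠ ε in 𝓝[>] (0 : ℝ),
        (∀ s, -ε ≤ s → s ≤ 0 → ∀ r, (∀ k, A k * s + B k * r ≤ C k) ↔
          l₀ + l₁ * s ≤ r ∧ r ≤ h₀ + h₁ * s) ∧
        (∀ s, -ε ≤ s → s < 0 → l₀ + l₁ * s < h₀ + h₁ * s) ∧
        (∀ s, 0 ≤ s → s ≤ ε → ∀ r, (∀ k, A k * s + B k * r ≤ C k) ↔
          l₀ + l₂ * s ≤ r ∧ r ≤ h₀ + h₂ * s) ∧
        (l₀ < h₀ → ∀ s, 0 ≤ s → s ≤ ε → l₀ + l₂ * s < h₀ + h₂ * s) := by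
  obtain ⟨R, hR⟩ := hbdd
  have hR0 : 0 ≤ R := by simpa using hR 0 (by simpa using hC)
  -- The constraints with `B k > 0` bound `r` from above, those with `B k < 0` from below, and those
  -- with `B k = 0` hold for all small `s`. Boundedness gives at least one of each of the first two.
  have hpos : Nonempty {k // 0 < B k} := by
    by_contra hcon
    rw [not_nonempty_iff, isEmpty_subtype] at hcon
    have := hR (R + 1) fun k => by nlinarith [hC k, not_lt.mp (hcon k)]
    rw [abs_of_pos (by linarith)] at this
    linarith
  have hnegB : Nonempty {k // B k < 0} := by
    by_contra hcon
    rw [not_nonempty_iff, isEmpty_subtype] at hcon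
    have := hR (-(R + 1)) fun k => by nlinarith [hC k, not_lt.mp (hcon k)]
    rw [abs_neg, abs_of_pos (by linarith)] at this
    linarith
  obtain ⟨h₀, h₁, h₂, hh, hhev⟩ := exists_min_affine (κ := {k // 0 < B k})
    (fun k => C k / B k) (fun k => -(A k / B k))
  obtain ⟨m₀, m₁, m₂, hm, hmev⟩ := exists_min_affine (κ := {k // B k < 0})
    (fun k => -(C k / B k)) (fun k => A k / B k)
  have hzero : ∀ᶠ ε in 𝓝[>] (0 : ℝ), ∀ k, B k = 0 → ∀ s, |s| ≤ ε → A k * s ≤ C k := by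
    rw [eventually_all]
    intro k
    by_cases hk : B k = 0
    · have hCk := hB k hk
      filter_upwards [Ioo_mem_nhdsGT (div_pos hCk (show 0 < |A k| + 1 by positivity))]
        with ε hε _ s hs
      have h1 : ε * (|A k| + 1) < C k := (lt_div_iff₀ (by positivity)).mp hε.2
      calc A k * s ≤ |A k * s| := le_abs_self _
        _ = |A k| * |s| := abs_mul _ _
        _ ≤ |A k| * ε := by gcongr
        _ ≤ C k := by nlinarith [hε.1]
    · exact Eventually.of_forall fun _ h => absurd h hk
  have hupper : ∀ k : {k // 0 < B k}, ∀ s r : ℝ,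
      r ≤ C k / B k + -(A k / B k) * s ↔ A k * s + B k * r ≤ C k := by
    intro k s r
    have hk := k.2
    have : C k / B k + -(A k / B k) * s = (C k - A k * s) / B k := by field_simp; ring
    rw [this, le_div_iff₀ hk]
    constructor <;> intro h <;> linarith
  have hlower : ∀ k : {k // B k < 0}, ∀ s r : ℝ,
      -r ≤ -(C k / B k) + A k / B k * s ↔ A k * s + B k * r ≤ C k := by
    intro k s r
    have hk := k.2
    have : -(C k / B k) + A k / B k * s = -((C k - A k * s) / B k) := by
      field_simp [hk.ne]; ring
    rw [this, neg_le_neg_iff, div_le_iff_of_neg hk]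
    constructor <;> intro h <;> linarith
  have hsplit : ∀ ε, (∀ k, B k = 0 → ∀ s, |s| ≤ ε → A k * s ≤ C k) → ∀ s, |s| ≤ ε → ∀ r,
      ((∀ k, A k * s + B k * r ≤ C k) ↔
        (∀ k : {k // B k < 0}, -r ≤ -(C k / B k) + A k / B k * s) ∧
        (∀ k : {k // 0 < B k}, r ≤ C k / B k + -(A k / B k) * s)) := by
    intro ε hε s hs r
    refine ⟨fun h => ⟨fun k => (hlower k s r).mpr (h k), fun k => (hupper k s r).mpr (h k)⟩,
      fun h k => ?_⟩
    rcases lt_trichotomy (B k) 0 with hk | hk | hk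
    · exact (hlower ⟨k, hk⟩ s r).mp (h.1 ⟨k, hk⟩)
    · rw [hk, zero_mul, add_zero]; exact hε k hk s hs
    · exact (hupper ⟨k, hk⟩ s r).mp (h.2 ⟨k, hk⟩)
  -- the sections are intervals, possibly empty ones
  have hIcc : ∀ᶠ ε in 𝓝[>] (0 : ℝ),
      (∀ s, -ε ≤ s → s ≤ 0 → ∀ r, (∀ k, A k * s + B k * r ≤ C k) ↔
          -m₀ + -m₁ * s ≤ r ∧ r ≤ h₀ + h₁ * s) ∧
      (∀ s, 0 ≤ s → s ≤ ε → ∀ r, (∀ k, A k * s + B k * r ≤ C k) ↔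
          -m₀ + -m₂ * s ≤ r ∧ r ≤ h₀ + h₂ * s) := by
    filter_upwards [hhev, hmev, hzero, self_mem_nhdsWithin] with ε h1 h2 h3 hε
    have hε : 0 < ε := hε
    refine ⟨fun s hs hs' r => ?_, fun s hs hs' r => ?_⟩
    · rw [hsplit ε h3 s (abs_le.mpr ⟨hs, by linarith⟩) r, h1.1 s hs hs' r, h2.1 s hs hs' (-r)]
      refine and_congr_left' ⟨fun h => by linarith, fun h => by linarith⟩
    · rw [hsplit ε h3 s (abs_le.mpr ⟨by linarith, hs'⟩) r, h1.2 s hs hs' r, h2.2 s hs hs' (-r)]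
      refine and_congr_left' ⟨fun h => by linarith, fun h => by linarith⟩
  have hstrict : ∀ᶠ ε in 𝓝[>] (0 : ℝ), ∀ s, -ε ≤ s → s < 0 →
      -m₀ + -m₁ * s < h₀ + h₁ * s := by
    filter_upwards [hIcc, Ioo_mem_nhdsGT (neg_pos.mpr hs₁)] with ε h1 hε s hs hs'
    -- the point on the segment from the origin to `(s₁, r₁)` is interior to the polygon
    set θ := s / s₁ with hθ
    have hθ0 : 0 < θ := div_pos_of_neg_of_neg hs' hs₁
    have hθ1 : θ ≤ 1 := by rw [hθ, div_le_one_of_neg hs₁]; linarith [hε.2]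
    have hθs : θ * s₁ = s := div_mul_cancel₀ _ hs₁.ne
    have hlt : ∀ k, A k * s + B k * (θ * r₁) < C k := by
      intro k
      have : A k * s + B k * (θ * r₁) = θ * (A k * s₁ + B k * r₁) := by rw [← hθs]; ring
      rw [this]
      nlinarith [hneg k, hC k]
    have hcont : ∀ᶠ r in 𝓝 (θ * r₁), ∀ k, A k * s + B k * r < C k := by
      rw [eventually_all]
      intro k
      exact (Continuous.tendsto (by fun_prop) _).eventually_lt_const (hlt k)
    obtain ⟨r, hr, hr'⟩ := ((hcont.filter_mono nhdsWithin_le_nhds).and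
      (self_mem_nhdsWithin : Ioi (θ * r₁) ∈ 𝓝[>] (θ * r₁))).exists
    have h2 := ((h1.1 s hs hs'.le _).mp fun k => (hlt k).le).1
    have h3 := ((h1.1 s hs hs'.le r).mp fun k => (hr k).le).2
    exact h2.trans_lt (lt_of_lt_of_le hr' h3)
  have h0 : -m₀ ≤ h₀ := by
    obtain ⟨ε, h1, hε⟩ := (hIcc.and self_mem_nhdsWithin).exists
    have := (h1.1 0 (by simpa using le_of_lt hε) le_rfl 0).mp (by simpa using hC)
    linarith [this.1, this.2]
  refine ⟨-m₀, h₀, -m₁, h₁, -m₂, h₂, h0, by linarith, hh, fun heq => ?_, ?_⟩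
  · obtain ⟨ε, h1, hε⟩ := (hstrict.and self_mem_nhdsWithin).exists
    have hε : 0 < ε := hε
    have := h1 (-ε) le_rfl (by linarith)
    nlinarith
  · have hpos : ∀ᶠ ε in 𝓝[>] (0 : ℝ), -m₀ < h₀ → ∀ s, 0 ≤ s → s ≤ ε →
        -m₀ + -m₂ * s < h₀ + h₂ * s := by
      by_cases hlt : -m₀ < h₀
      · filter_upwards [Ioo_mem_nhdsGT (div_pos (sub_pos.mpr hlt)
          (show 0 < |h₂| + |m₂| + 1 by positivity))] with ε hε _ s hs hs'
        have h1 : ε * (|h₂| + |m₂| + 1) < h₀ - -m₀ := (lt_div_iff₀ (by positivity)).mp hε.2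
        nlinarith [neg_abs_le h₂, neg_abs_le m₂, abs_nonneg h₂, abs_nonneg m₂, hε.1]
      · exact Eventually.of_forall fun _ h => absurd h hlt
    filter_upwards [hIcc, hstrict, hpos] with ε h1 h2 h3
    exact ⟨h1.1, h2, h1.2, h3⟩

/-! ### First-order behaviour of a single facet -/
theorem image_Icc_line_eq_segment (q u : E3) {a b : ℝ} (hab : a ≤ b) :
    (fun s : ℝ => q + s • u) '' Icc a b = segment ℝ (q + a • u) (q + b • u) := by
  have h1 : (fun s : ℝ => q + s • u) = AffineMap.lineMap q (q + u) := by
    ext1 s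
    simp [AffineMap.lineMap_apply, add_comm]
  rw [h1, ← segment_eq_Icc hab, image_segment]
  simp [AffineMap.lineMap_apply, add_comm]

theorem hausdorffMeasure_line_Icc (q u : E3) {a b : ℝ} (hab : a ≤ b) :
    Measure.hausdorffMeasure 1 ((fun s : ℝ => q + s • u) '' Icc a b) =
      ENNReal.ofReal ((b - a) * ‖u‖) := by
  rw [image_Icc_line_eq_segment q u hab, hausdorffMeasure_segment, edist_dist, dist_eq_norm]
  congr 1
  rw [add_sub_add_left_eq_sub, ← sub_smul, norm_smul, Real.norm_eq_abs, abs_sub_comm,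
    abs_of_nonneg (by linarith)]

theorem measurableSet_line_Ico (q u : E3) (a b : ℝ) :
    MeasurableSet ((fun s : ℝ => q + s • u) '' Ico a b) := by
  rcases eq_or_ne u 0 with rfl | hu
  · have : (fun s : ℝ => q + s • (0 : E3)) = fun _ => q := by ext1; simp
    rw [this]
    exact ((Set.finite_singleton q).subset (by rintro _ ⟨_, _, rfl⟩; rfl)).measurableSet
  · refine measurableSet_Ico.image_of_continuousOn_injOn (by fun_prop) ?_
    intro s _ s' _ hss
    exact smul_left_injective ℝ hu (add_left_cancel hss)

theorem hausdorffMeasure_line_Ico (q u : E3) {a b : ℝ} (hab : a ≤ b) :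
    Measure.hausdorffMeasure 1 ((fun s : ℝ => q + s • u) '' Ico a b) =
      ENNReal.ofReal ((b - a) * ‖u‖) := by
  rw [← hausdorffMeasure_line_Icc q u hab]
  have := Measure.nullSingletonClass_hausdorff E3 (d := 1) one_pos
  refine le_antisymm (measure_mono (image_mono Ico_subset_Icc_self)) ?_
  calc _ ≤ Measure.hausdorffMeasure 1 ((fun s : ℝ => q + s • u) '' Ico a b ∪ {q + b • u}) := by
        refine measure_mono ?_
        rintro _ ⟨s, hs, rfl⟩
        rcases hs.2.lt_or_eq with h | rfl
        · exact Or.inl ⟨s, ⟨hs.1, h⟩, rfl⟩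
        · exact Or.inr rfl
    _ ≤ _ := (measure_union_le _ _).trans (by rw [measure_singleton, add_zero])

/-- The points of the intersection of half-spaces that lie on two of the boundary planes. -/
def creases {ι : Type*} (N : ι → E3) (b : ι → ℝ) : Set E3 :=
  {y | y ∈ cone N b ∧ ∃ j k, j ≠ k ∧ inner ℝ (N j) y = b j ∧ inner ℝ (N k) y = b k}

/-- The part of the `i`-th facet at height `s` over the plane `⟪n, y⟫ = c`. -/
def facetSlice {ι : Type*} (n : E3) (c : ℝ) (N : ι → E3) (b : ι → ℝ) (i : ι) (s : ℝ) : Set E3 :=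
  {y | y ∈ cone N b ∧ inner ℝ (N i) y = b i ∧ inner ℝ n y = c + s}

/-- The length per unit of height of an edge with direction `w + h • τ` decreases by at most
`h' - h` when `h` grows to `h'`. This is the comparison between the length of an edge and the
velocity of its end point. -/
theorem norm_add_smul_add_mono (w : E3) {τ : E3} (hτ : ‖τ‖ = 1) {h h' : ℝ} (hh : h ≤ h') :
    ‖w + h • τ‖ + h ≤ ‖w + h' • τ‖ + h' := by
  have : ‖w + h • τ‖ ≤ ‖w + h' • τ‖ + ‖(h - h') • τ‖ := by
    calc _ = ‖(w + h' • τ) + (h - h') • τ‖ := by congr 1; rw [sub_smul]; abel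
      _ ≤ _ := norm_add_le _ _
  rw [norm_smul, hτ, mul_one, Real.norm_eq_abs, abs_sub_comm, abs_of_nonneg (by linarith)] at this
  linarith

/-- The counterpart of `norm_add_smul_add_mono` for the lower end of a slice, which moves in the
direction `-τ` when the slice grows. -/
theorem norm_add_smul_sub_anti (w : E3) {τ : E3} (hτ : ‖τ‖ = 1) {h h' : ℝ} (hh : h ≤ h') :
    ‖w + h' • τ‖ - h' ≤ ‖w + h • τ‖ - h := by
  have := norm_add_smul_add_mono w (τ := -τ) (by rwa [norm_neg]) (neg_le_neg hh)
  simp only [neg_smul_neg] at this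
  linarith

/-- The two legs of a facet are together longer than the rate at which its slices shrink: the
source of strictness when the slice on the plane is a point. -/
theorem abs_lt_norm_add_smul {w τ : E3} (hτ : ‖τ‖ = 1) (hw : w ≠ 0) (hwτ : inner ℝ w τ = 0)
    (h : ℝ) : |h| < ‖w + h • τ‖ := by
  have h1 : ‖w + h • τ‖ ^ 2 = ‖w‖ ^ 2 + h ^ 2 := by
    rw [norm_add_sq_real, inner_smul_right, hwτ, norm_smul, hτ]
    simp
  rw [← abs_norm (w + h • τ), ← sq_lt_sq, h1]
  have := norm_pos_iff.mpr hw
  nlinarith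

namespace IsFaceSystem

variable {ι : Type*} {n : E3} {c : ℝ} {N : ι → E3} {b : ι → ℝ}

/-- The first-order behaviour of one facet near the plane `⟪n, y⟫ = c`. Its slices are parallel
segments whose lengths are `L + p₁ * s` below the plane and `L + p₂ * s` above it, and its two
legs have total length at least `a₁ * t` in the slab of height `t` below the plane and at most
`a₂ * t` in the slab above it. The inequality `a₂ + p₂ ≤ a₁ + p₁` holds since the velocity `h` of
an end point of the slice contributes `‖w + h • τ‖ ± h`, a monotone function of `h`. -/
theorem exists_facet_estimates [Finite ι] (h : IsFaceSystem n c N b) (i : ι) :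
    ∃ (τ : E3) (L a₁ a₂ p₁ p₂ : ℝ), ‖τ‖ = 1 ∧ inner ℝ n τ = 0 ∧ 0 ≤ L ∧ 0 ≤ a₁ ∧ 0 ≤ a₂ ∧
      a₂ + p₂ ≤ a₁ + p₁ ∧ (L = 0 → a₂ + p₂ < a₁ + p₁) ∧ (∀ᶠ ε in 𝓝[>] (0 : ℝ),
        (∀ s, -ε ≤ s → s ≤ 0 → 0 ≤ L + p₁ * s ∧
          ∃ p, facetSlice n c N b i s = segment ℝ p (p + (L + p₁ * s) • τ)) ∧
        (∀ s, 0 ≤ s → s ≤ ε → 0 ≤ L + p₂ * s ∧ (facetSlice n c N b i s = ∅ ∧ L + p₂ * s = 0 ∨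
          ∃ p, facetSlice n c N b i s = segment ℝ p (p + (L + p₂ * s) • τ))) ∧
        (∀ t, 0 < t → t ≤ ε → ENNReal.ofReal (a₁ * t) ≤ Measure.hausdorffMeasure 1
          (creases N b ∩ {y | inner ℝ (N i) y = b i} ∩
            {y | c - t ≤ inner ℝ n y ∧ inner ℝ n y < c})) ∧
        (∀ t, 0 < t → t ≤ ε → Measure.hausdorffMeasure 1
          (creases N b ∩ {y | inner ℝ (N i) y = b i} ∩
            {y | c ≤ inner ℝ n y ∧ inner ℝ n y < c + t}) ≤ ENNReal.ofReal (a₂ * t))) := by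
  obtain ⟨o, τ, w, hτ, hnτ, hNτ, hnw, hNw, hwτ, hno, hNo, ho, hcoord⟩ := h.exists_coordinates i
  have hw0 : w ≠ 0 := by
    rintro rfl
    simp at hnw
  -- `φ s r` is the point of the plane of the facet at height `s` and position `r`. The remaining
  -- half-spaces cut out a planar polygon `A k * s + B k * r ≤ C k` in these coordinates.
  set φ : ℝ → ℝ → E3 := fun s r => o + s • w + r • τ with hφ
  have hφn : ∀ s r, inner ℝ n (φ s r) = c + s := by
    intro s r
    simp [hφ, inner_add_right, inner_smul_right, hno, hnw, hnτ]
  have hφN : ∀ s r, inner ℝ (N i) (φ s r) = b i := by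
    intro s r
    simp [hφ, inner_add_right, inner_smul_right, hNo, hNw, hNτ]
  set A : {k // k ≠ i} → ℝ := fun k => inner ℝ (N k) w with hA
  set B : {k // k ≠ i} → ℝ := fun k => inner ℝ (N k) τ with hB
  set C : {k // k ≠ i} → ℝ := fun k => b k - inner ℝ (N k) o with hC
  have hφk : ∀ (k : {k // k ≠ i}) s r, inner ℝ (N k) (φ s r) - b k = A k * s + B k * r - C k := by
    intro k s r
    simp only [hφ, inner_add_right, inner_smul_right, hA, hB, hC]
    ring
  have hmem : ∀ s r, φ s r ∈ cone N b ↔ ∀ k, A k * s + B k * r ≤ C k := by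
    intro s r
    refine ⟨fun hy k => by linarith [hφk k s r, hy k], fun hy k => ?_⟩
    by_cases hk : k = i
    · subst hk; exact (hφN s r).le
    · linarith [hφk ⟨k, hk⟩ s r, hy ⟨k, hk⟩]
  have hex : ∀ y, inner ℝ (N i) y = b i → ∃ r, y = φ (inner ℝ n y - c) r := fun y hy => hcoord y hy
  have hsub := h.eventually_subsingleton
  -- A constraint that is active at `o` and does not involve `r` would give two planes with a common
  -- line on level `0`.
  have hBC : ∀ k, B k = 0 → 0 < C k := by
    intro k hk
    have hCk : 0 ≤ C k := sub_nonneg.mpr (ho k)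
    refine lt_of_le_of_ne hCk fun h0 => ?_
    obtain ⟨ε, hε, hε0⟩ := (hsub.and self_mem_nhdsWithin).exists
    have hε0 : 0 < ε := hε0
    have h1 := hφk k 0 0
    have h2 := hφk k 0 1
    have := hε i k k.2.symm (φ 0 0) (φ 0 1) (hφN _ _) (by linarith) (hφN _ _)
      (by rw [hk] at h2; linarith) (by rw [hφn, hφn]) (by rw [hφn]; simpa using hε0.le)
    simp only [hφ] at this
    have hτ0 : τ = 0 := by simpa using this
    simp [hτ0] at hτ
  obtain ⟨y₁, hy₁, hy₁i, hy₁'⟩ := h.exists_facet i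
  obtain ⟨r₁, hr₁⟩ := hex y₁ hy₁i
  obtain ⟨η, hη, hbd⟩ := h.bounded
  obtain ⟨R, hR⟩ := hbd.exists_norm_le
  obtain ⟨l₀, h₀, l₁, h₁, l₂, h₂, hlh, hl, hh, hpt, hev⟩ := exists_section_eq_Icc A B C
    (fun k => sub_nonneg.mpr (ho k)) hBC (s₁ := inner ℝ n y₁ - c) (r₁ := r₁) (by linarith)
    (fun k => by
      have := hφk k (inner ℝ n y₁ - c) r₁
      rw [← hr₁] at this
      linarith [hy₁' k k.2])
    ⟨R + ‖o‖, fun r hr => by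
      have h1 := hR (φ 0 r) ⟨(hmem 0 r).mpr (by simpa using hr), by rw [hφn]; simpa using hη.le⟩
      calc |r| = ‖φ 0 r - o‖ := by simp [hφ, norm_smul, hτ]
        _ ≤ ‖φ 0 r‖ + ‖o‖ := norm_sub_le _ _
        _ ≤ _ := by linarith⟩
  -- slices and their end points
  have hseg : ∀ s l r, l ≤ r → (∀ x, (∀ k, A k * s + B k * x ≤ C k) ↔ l ≤ x ∧ x ≤ r) →
      facetSlice n c N b i s = segment ℝ (φ s l) (φ s l + (r - l) • τ) := by
    intro s l r hlr hx
    have : φ s l + (r - l) • τ = (o + s • w) + r • τ := by simp only [hφ, sub_smul]; abel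
    rw [this, ← image_Icc_line_eq_segment (o + s • w) τ hlr]
    ext y
    constructor
    · rintro ⟨hy, hyi, hyn⟩
      obtain ⟨x, hx'⟩ := hex y hyi
      have hs : inner ℝ n y - c = s := by linarith
      rw [hs] at hx'
      rw [hx'] at hy
      exact ⟨x, (hx x).mp ((hmem s x).mp hy), hx'.symm⟩
    · rintro ⟨x, hx', rfl⟩
      exact ⟨(hmem s x).mpr ((hx x).mpr hx'), hφN s x, hφn s x⟩
  -- The end points of a slice lie on a second plane: otherwise the slice could be extended.
  have hcrease : ∀ s x l r, (∀ x, (∀ k, A k * s + B k * x ≤ C k) ↔ l ≤ x ∧ x ≤ r) →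
      l ≤ r → (x = l ∨ x = r) → φ s x ∈ creases N b := by
    intro s x l r hx hlr hxlr
    have hxm : ∀ k, A k * s + B k * x ≤ C k :=
      (hx x).mpr (by rcases hxlr with rfl | rfl <;> exact ⟨by linarith, by linarith⟩)
    have hact : ∃ k, A k * s + B k * x = C k := by
      by_contra! hcon
      have hcont : ∀ᶠ z in 𝓝 x, l ≤ z ∧ z ≤ r := by
        have : ∀ᶠ z in 𝓝 x, ∀ k, A k * s + B k * z < C k := by
          rw [eventually_all]
          intro k
          exact (Continuous.tendsto (by fun_prop) _).eventually_lt_const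
            (lt_of_le_of_ne (hxm k) (hcon k))
        filter_upwards [this] with z hz
        exact (hx z).mp fun k => (hz k).le
      rcases hxlr with rfl | rfl
      · obtain ⟨z, hz, hz'⟩ := ((hcont.filter_mono nhdsWithin_le_nhds).and
          (self_mem_nhdsWithin : Iio x ∈ 𝓝[<] x)).exists
        exact absurd hz.1 (not_le.mpr hz')
      · obtain ⟨z, hz, hz'⟩ := ((hcont.filter_mono nhdsWithin_le_nhds).and
          (self_mem_nhdsWithin : Ioi x ∈ 𝓝[>] x)).exists
        exact absurd hz.2 (not_le.mpr hz')
    obtain ⟨k, hk⟩ := hact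
    exact ⟨(hmem s x).mpr hxm, i, k, k.2.symm, hφN s x, by linarith [hφk k s x]⟩
  -- Conversely, a second plane through an inner point of a slice would contain the whole slice,
  -- while two planes share at most one point of each level.
  have hcrease' : ∀ ε, (∀ i j, i ≠ j → ∀ y z : E3, inner ℝ (N i) y = b i →
      inner ℝ (N j) y = b j → inner ℝ (N i) z = b i → inner ℝ (N j) z = b j →
      inner ℝ n y = inner ℝ n z → |inner ℝ n y - c| ≤ ε → y = z) → ∀ s, |s| ≤ ε →
      ∀ x l r, (∀ x, (∀ k, A k * s + B k * x ≤ C k) ↔ l ≤ x ∧ x ≤ r) →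
      φ s x ∈ creases N b → x = l ∨ x = r := by
    intro ε hε s hs x l r hx hy
    obtain ⟨hyK, hy2⟩ := hy
    have hxlr := (hx x).mp ((hmem s x).mp hyK)
    have hk : ∃ k, k ≠ i ∧ inner ℝ (N k) (φ s x) = b k := by
      obtain ⟨j, k, hjk, hj, hk⟩ := hy2
      by_cases hji : j = i
      · exact ⟨k, fun h => hjk (hji.trans h.symm), hk⟩
      · exact ⟨j, hji, hj⟩
    obtain ⟨k, hki, hk⟩ := hk
    have hk' := hφk ⟨k, hki⟩ s x
    simp only at hk'
    by_contra! hcon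
    have h1 : l < x := lt_of_le_of_ne hxlr.1 (Ne.symm hcon.1)
    have h2 : x < r := lt_of_le_of_ne hxlr.2 hcon.2
    have h3 := (hx l).mpr ⟨le_rfl, by linarith⟩ ⟨k, hki⟩
    have h4 := (hx r).mpr ⟨by linarith, le_rfl⟩ ⟨k, hki⟩
    have h5 : B ⟨k, hki⟩ = 0 := by nlinarith
    have h6 := hφk ⟨k, hki⟩ s l
    simp only [h5] at hk' h6
    have := hε i k hki.symm (φ s x) (φ s l) (hφN _ _) hk (hφN _ _) (by linarith)
      (by rw [hφn, hφn]) (by rw [hφn]; simpa using hs)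
    simp only [hφ] at this
    have h7 : x • τ = l • τ := add_left_cancel this
    have hτ0 : τ ≠ 0 := by rintro rfl; simp at hτ
    exact hcon.1 (smul_left_injective ℝ hτ0 h7)
  have hline : ∀ s p q, φ s (p + q * s) = (o + p • τ) + s • (w + q • τ) := by
    intro s p q
    simp only [hφ, add_smul, smul_add, smul_smul, mul_comm s q]
    abel
  -- Below the plane the creases on the facet contain the two curves of end points `T₁`, `T₂`.
  have hmin : ∀ᶠ ε in 𝓝[>] (0 : ℝ),
      (∀ s, -ε ≤ s → s ≤ 0 → 0 ≤ (h₀ - l₀) + (h₁ - l₁) * s ∧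
          ∃ p, facetSlice n c N b i s = segment ℝ p (p + ((h₀ - l₀) + (h₁ - l₁) * s) • τ)) ∧
      (∀ t, 0 < t → t ≤ ε → ENNReal.ofReal ((‖w + h₁ • τ‖ + ‖w + l₁ • τ‖) * t) ≤
        Measure.hausdorffMeasure 1 (creases N b ∩ {y | inner ℝ (N i) y = b i} ∩
            {y | c - t ≤ inner ℝ n y ∧ inner ℝ n y < c})) := by
    filter_upwards [hev] with ε hε
    obtain ⟨e1, e2, -, -⟩ := hε
    have hle : ∀ s, -ε ≤ s → s ≤ 0 → l₀ + l₁ * s ≤ h₀ + h₁ * s := by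
      intro s hs hs'
      rcases hs'.lt_or_eq with h | rfl
      · exact (e2 s hs h).le
      · linarith
    refine ⟨fun s hs hs' => ?_, fun t ht ht' => ?_⟩
    · have h1 := hle s hs hs'
      refine ⟨by linarith, φ s (l₀ + l₁ * s), ?_⟩
      rw [hseg s _ _ h1 (e1 s hs hs')]
      congr 3
      ring
    · set T₁ := (fun s : ℝ => (o + h₀ • τ) + s • (w + h₁ • τ)) '' Ico (-t) 0 with hT₁
      set T₂ := (fun s : ℝ => (o + l₀ • τ) + s • (w + l₁ • τ)) '' Ico (-t) 0 with hT₂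
      have hdisj : Disjoint T₁ T₂ := by
        rw [Set.disjoint_left]
        rintro _ ⟨s, hs, rfl⟩ ⟨s', hs', heq⟩
        simp only [← hline] at heq
        have h1 : s' = s := by
          have := congrArg (inner ℝ n) heq
          rw [hφn, hφn] at this
          linarith
        subst h1
        have h2 := e2 s' (by linarith [hs.1]) hs.2
        have h3 : (l₀ + l₁ * s') • τ = (h₀ + h₁ * s') • τ := add_left_cancel heq
        have hτ0 : τ ≠ 0 := by rintro rfl; simp at hτ
        exact h2.ne (smul_left_injective ℝ hτ0 h3)
      have hm : ENNReal.ofReal ((‖w + h₁ • τ‖ + ‖w + l₁ • τ‖) * t) =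
          Measure.hausdorffMeasure 1 (T₁ ∪ T₂) := by
        rw [measure_union hdisj (measurableSet_line_Ico _ _ _ _),
          hausdorffMeasure_line_Ico _ _ (by linarith), hausdorffMeasure_line_Ico _ _ (by linarith),
          ← ENNReal.ofReal_add (mul_nonneg (by linarith) (norm_nonneg _))
            (mul_nonneg (by linarith) (norm_nonneg _))]
        congr 1
        ring
      rw [hm]
      refine measure_mono (union_subset ?_ ?_)
      · rintro _ ⟨s, hs, rfl⟩
        simp only [← hline]
        refine ⟨⟨hcrease s _ _ _ (e1 s (by linarith [hs.1]) hs.2.le)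
          (hle s (by linarith [hs.1]) hs.2.le) (Or.inr rfl), hφN _ _⟩, ?_⟩
        simp only [mem_ofPred_eq, hφn]
        constructor <;> linarith [hs.1, hs.2]
      · rintro _ ⟨s, hs, rfl⟩
        simp only [← hline]
        refine ⟨⟨hcrease s _ _ _ (e1 s (by linarith [hs.1]) hs.2.le)
          (hle s (by linarith [hs.1]) hs.2.le) (Or.inl rfl), hφN _ _⟩, ?_⟩
        simp only [mem_ofPred_eq, hφn]
        constructor <;> linarith [hs.1, hs.2]
  have ha₁h := abs_lt_norm_add_smul hτ hw0 hwτ h₁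
  have ha₁l := abs_lt_norm_add_smul hτ hw0 hwτ l₁
  have hapos : 0 < ‖w + h₁ • τ‖ + ‖w + l₁ • τ‖ + (h₁ - l₁) := by
    have h1 := neg_abs_le h₁
    have h2 := le_abs_self l₁
    linarith
  rcases hlh.eq_or_lt with heq | hlt
  · -- the slice on level `0` is a point, and there are none above it
    have hslope : h₂ < l₂ := by linarith [hpt heq]
    refine ⟨τ, h₀ - l₀, ‖w + h₁ • τ‖ + ‖w + l₁ • τ‖, 0, h₁ - l₁, 0, hτ, hnτ, by linarith,
      by positivity, le_rfl, by linarith, fun _ => by linarith, ?_⟩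
    filter_upwards [hmin, hev] with ε h1 hε
    obtain ⟨e1, -, e3, -⟩ := hε
    have hempty : ∀ s, 0 < s → s ≤ ε → ∀ x, φ s x ∉ cone N b := by
      intro s hs hs' x hx
      have := (e3 s hs.le hs' x).mp ((hmem s x).mp hx)
      nlinarith
    refine ⟨h1.1, fun s hs hs' => ⟨by linarith, ?_⟩, h1.2, fun t ht ht' => ?_⟩
    · rcases hs.eq_or_lt with rfl | hs
      · right
        obtain ⟨-, p, hp⟩ := h1.1 0 (by linarith) le_rfl
        exact ⟨p, by simpa using hp⟩
      · left
        refine ⟨?_, by linarith⟩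
        rw [eq_empty_iff_forall_notMem]
        rintro y ⟨hy, hyi, hyn⟩
        obtain ⟨x, hx⟩ := hex y hyi
        rw [hx, hyn, add_sub_cancel_left] at hy
        exact hempty s hs hs' x hy
    · have := Measure.nullSingletonClass_hausdorff E3 (d := 1) one_pos
      rw [zero_mul, ENNReal.ofReal_zero, nonpos_iff_eq_zero]
      refine measure_mono_null ?_ (measure_singleton (φ 0 l₀))
      rintro y ⟨⟨⟨hy, -⟩, hyi⟩, hyn, hyn'⟩
      obtain ⟨x, hx⟩ := hex y hyi
      rcases hyn.eq_or_lt with h0 | h0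
      · rw [← h0, sub_self] at hx
        rw [hx] at hy
        have h2 := (e3 0 le_rfl (by linarith) x).mp ((hmem 0 x).mp hy)
        have h3 : x = l₀ := by linarith [h2.1, h2.2]
        rw [hx, h3]
        rfl
      · rw [hx] at hy
        exact absurd hy (hempty _ (by linarith) (by linarith) x)
  · refine ⟨τ, h₀ - l₀, ‖w + h₁ • τ‖ + ‖w + l₁ • τ‖, ‖w + h₂ • τ‖ + ‖w + l₂ • τ‖, h₁ - l₁, h₂ - l₂,
      hτ, hnτ, by linarith, by positivity, by positivity, ?_, fun h0 => by linarith, ?_⟩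
    · have h1 := norm_add_smul_add_mono w hτ hh
      have h2 := norm_add_smul_sub_anti w hτ hl
      linarith
    · filter_upwards [hmin, hev, hsub] with ε h1 hε hεs
      obtain ⟨e1, -, e3, e4⟩ := hε
      refine ⟨h1.1, fun s hs hs' => ?_, h1.2, fun t ht ht' => ?_⟩
      · have h2 := (e4 hlt s hs hs').le
        refine ⟨by linarith, Or.inr ⟨φ s (l₀ + l₂ * s), ?_⟩⟩
        rw [hseg s _ _ h2 (e3 s hs hs')]
        congr 3
        ring
      · calc _ ≤ Measure.hausdorffMeasure 1
              ((fun s : ℝ => (o + h₀ • τ) + s • (w + h₂ • τ)) '' Icc 0 t ∪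
                (fun s : ℝ => (o + l₀ • τ) + s • (w + l₂ • τ)) '' Icc 0 t) := by
              refine measure_mono ?_
              rintro y ⟨⟨hy, hyi⟩, hyn, hyn'⟩
              obtain ⟨x, hx⟩ := hex y hyi
              set s := inner ℝ n y - c with hs
              rw [hx] at hy ⊢
              have hs0 : 0 ≤ s := by linarith
              have hst : s ≤ t := by linarith
              rcases hcrease' ε hεs s (abs_le.mpr ⟨by linarith, by linarith⟩) x _ _
                (e3 s hs0 (by linarith)) hy with rfl | rfl
              · exact Or.inr ⟨s, ⟨hs0, hst⟩, (hline _ _ _).symm⟩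
              · exact Or.inl ⟨s, ⟨hs0, hst⟩, (hline _ _ _).symm⟩
          _ ≤ _ := measure_union_le _ _
          _ = _ := by
              rw [hausdorffMeasure_line_Icc _ _ ht.le, hausdorffMeasure_line_Icc _ _ ht.le,
                ← ENNReal.ofReal_add (by positivity) (by positivity)]
              congr 1
              ring

end IsFaceSystem

/-! ### Cauchy's formula for the perimeter of a slice -/
theorem isClosed_cone {ι : Type*} (N : ι → E3) (b : ι → ℝ) : IsClosed (cone N b) := by
  have : cone N b = ⋂ i, {y | inner ℝ (N i) y ≤ b i} := by ext y; simp [cone]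
  rw [this]
  exact isClosed_iInter fun i => isClosed_le (by fun_prop) continuous_const

theorem convex_cone {ι : Type*} (N : ι → E3) (b : ι → ℝ) : Convex ℝ (cone N b) := by
  intro x hx y hy s t hs ht hst i
  rw [inner_add_right, inner_smul_right, inner_smul_right]
  calc s * inner ℝ (N i) x + t * inner ℝ (N i) y ≤ s * b i + t * b i :=
        add_le_add (mul_le_mul_of_nonneg_left (hx i) hs) (mul_le_mul_of_nonneg_left (hy i) ht)
    _ = b i := by rw [← add_mul, hst, one_mul]

/-- If the midpoints of `A` and `B` lie in the convex set `D`, then the mean length of `A` and `B`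
is at most the length of `D`. -/
theorem volume_add_le_two_mul_of_midpoint {A B D : Set ℝ} (hA : IsCompact A) (hA' : A.Nonempty)
    (hB : IsCompact B) (hB' : B.Nonempty) (hD : Convex ℝ D)
    (h : ∀ a ∈ A, ∀ b ∈ B, (a + b) / 2 ∈ D) : volume A + volume B ≤ 2 * volume D := by
  have h1 : volume A ≤ ENNReal.ofReal (sSup A - sInf A) := by
    rw [← Real.volume_Icc]
    exact measure_mono fun x hx => ⟨csInf_le hA.bddBelow hx, le_csSup hA.bddAbove hx⟩
  have h2 : volume B ≤ ENNReal.ofReal (sSup B - sInf B) := by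
    rw [← Real.volume_Icc]
    exact measure_mono fun x hx => ⟨csInf_le hB.bddBelow hx, le_csSup hB.bddAbove hx⟩
  have hA0 : sInf A ≤ sSup A := csInf_le_csSup hA' hA.bddBelow hA.bddAbove
  have hB0 : sInf B ≤ sSup B := csInf_le_csSup hB' hB.bddBelow hB.bddAbove
  have h3 : ENNReal.ofReal ((sSup A + sSup B) / 2 - (sInf A + sInf B) / 2) ≤ volume D := by
    rw [← Real.volume_Icc]
    exact measure_mono (hD.ordConnected.out (h _ (hA.sInf_mem hA') _ (hB.sInf_mem hB'))
      (h _ (hA.sSup_mem hA') _ (hB.sSup_mem hB')))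
  calc volume A + volume B ≤ ENNReal.ofReal (sSup A - sInf A) + ENNReal.ofReal (sSup B - sInf B) :=
        add_le_add h1 h2
    _ = 2 * ENNReal.ofReal ((sSup A + sSup B) / 2 - (sInf A + sInf B) / 2) := by
        rw [← ENNReal.ofReal_add (by linarith) (by linarith), ← ENNReal.ofReal_ofNat 2,
          ← ENNReal.ofReal_mul (by norm_num)]
        congr 1
        ring
    _ ≤ _ := by gcongr

/-- The mean of `|⟪g, τ⟫|` over the unit ball is the same for all unit vectors `τ`, so an
inequality between the weighted sums of these functions implies the one between the weights. -/
theorem sum_nonneg_of_forall_sum_mul_abs_inner_nonneg {ι : Type*} [Fintype ι] (κ : ι → ℝ)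
    (τ : ι → E3) (hτ : ∀ i, ‖τ i‖ = 1)
    (h : ∀ g : E3, 0 ≤ ∑ i, κ i * |inner ℝ g (τ i)|) : 0 ≤ ∑ i, κ i := by
  rcases isEmpty_or_nonempty ι with hι | ⟨⟨i₀⟩⟩
  · simp
  set μ : Measure E3 := volume.restrict (Metric.ball 0 1) with hμ
  have hint : ∀ i, Integrable (fun g => |inner ℝ g (τ i)|) μ := by
    intro i
    have : ContinuousOn (fun g : E3 => |inner ℝ g (τ i)|) (Metric.closedBall 0 1) := by fun_prop
    exact (this.integrableOn_compact (isCompact_closedBall _ _)).mono_set Metric.ball_subset_closedBall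
  have heq : ∀ i, ∫ g, |inner ℝ g (τ i)| ∂μ = ∫ g, |inner ℝ g (τ i₀)| ∂μ := by
    intro i
    -- The reflection that exchanges `τ i` and `τ i₀` preserves the ball and the volume.
    set e : E3 ≃ₗᵢ[ℝ] E3 := (ℝ ∙ (τ i - τ i₀))ᗮ.reflection with he
    have hei : e (τ i) = τ i₀ := Submodule.reflection_sub ((hτ i).trans (hτ i₀).symm)
    have hpre : e ⁻¹' Metric.ball 0 1 = Metric.ball 0 1 := by
      rw [e.preimage_ball]; simp
    have := e.measurePreserving.setIntegral_preimage_emb e.toHomeomorph.measurableEmbedding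
      (fun g => |inner ℝ g (τ i₀)|) (Metric.ball 0 1)
    rw [hpre] at this
    rw [hμ, ← this]
    refine integral_congr_ae (Eventually.of_forall fun g => ?_)
    simp only [← hei, e.inner_map_map]
  have hpos : 0 < ∫ g, |inner ℝ g (τ i₀)| ∂μ := by
    rw [integral_pos_iff_support_of_nonneg (fun g => abs_nonneg _) (hint i₀), hμ,
      Measure.restrict_apply' measurableSet_ball]
    have hopen : IsOpen ((Function.support fun g : E3 => |inner ℝ g (τ i₀)|) ∩ Metric.ball 0 1) :=
      (Continuous.isOpen_support (by fun_prop)).inter Metric.isOpen_ball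
    refine hopen.measure_pos volume ⟨(1 / 2 : ℝ) • τ i₀, ?_, ?_⟩
    · rw [Function.mem_support, inner_smul_left, real_inner_self_eq_norm_sq, hτ]
      norm_num
    · rw [mem_ball_zero_iff, norm_smul, hτ]
      norm_num
  have h1 : 0 ≤ ∫ g, ∑ i, κ i * |inner ℝ g (τ i)| ∂μ := integral_nonneg h
  rw [integral_finsetSum _ fun i _ => (hint i).const_mul _] at h1
  simp only [integral_const_mul, heq, ← Finset.sum_mul] at h1
  exact nonneg_of_mul_nonneg_left h1 hpos

/-- The section of the intersection of half-spaces at height `s` over `⟪n, y⟫ = c`. -/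
def slice {ι : Type*} (n : E3) (c : ℝ) (N : ι → E3) (b : ι → ℝ) (s : ℝ) : Set E3 :=
  {y | y ∈ cone N b ∧ inner ℝ n y = c + s}

theorem facetSlice_eq {ι : Type*} (n : E3) (c : ℝ) (N : ι → E3) (b : ι → ℝ) (i : ι) (s : ℝ) :
    facetSlice n c N b i s = slice n c N b s ∩ {y | inner ℝ (N i) y = b i} := by
  ext y
  simp only [facetSlice, slice, mem_inter_iff, mem_ofPred_eq]
  tauto

theorem convex_slice {ι : Type*} (n : E3) (c : ℝ) (N : ι → E3) (b : ι → ℝ) (s : ℝ) :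
    Convex ℝ (slice n c N b s) :=
  (convex_cone N b).inter (convex_hyperplane (innerₗ E3 n).isLinear _)

namespace IsFaceSystem

variable {ι : Type*} {n : E3} {c : ℝ} {N : ι → E3} {b : ι → ℝ}

theorem eventually_isCompact_slice (h : IsFaceSystem n c N b) :
    ∀ᶠ ε in 𝓝[>] (0 : ℝ), ∀ s, |s| ≤ ε → IsCompact (slice n c N b s) := by
  obtain ⟨η, hη, hbd⟩ := h.bounded
  filter_upwards [Ioo_mem_nhdsGT hη] with ε hε s hs
  refine Metric.isCompact_of_isClosed_isBounded
    ((isClosed_cone N b).inter (isClosed_eq (by fun_prop) continuous_const)) (hbd.subset ?_)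
  rintro y ⟨hy, hyn⟩
  exact ⟨hy, by rw [hyn, add_sub_cancel_left]; exact hs.trans hε.2.le⟩

theorem isCompact_facetSlice {i : ι} {s : ℝ} (hs : IsCompact (slice n c N b s)) :
    IsCompact (facetSlice n c N b i s) := by
  rw [facetSlice_eq]
  exact hs.inter_right (isClosed_eq (by fun_prop) continuous_const)

theorem eventually_slice_nonempty [Finite ι] (h : IsFaceSystem n c N b) :
    ∀ᶠ ε in 𝓝[>] (0 : ℝ), ∀ s, |s| ≤ ε → ∃ y, inner ℝ n y = c + s ∧ ∀ i, inner ℝ (N i) y < b i := by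
  obtain ⟨x, hx, hx'⟩ := h.exists_top
  have h1 : ∀ᶠ s in 𝓝 (0 : ℝ), ∀ i, inner ℝ (N i) (x + s • n) < b i := by
    rw [eventually_all]
    intro i
    refine (Continuous.tendsto (by fun_prop) _).eventually_lt_const ?_
    simpa using hx' i
  obtain ⟨ρ, hρ, hρ'⟩ := Metric.eventually_nhds_iff.mp h1
  filter_upwards [Ioo_mem_nhdsGT hρ] with ε hε s hs
  refine ⟨x + s • n, ?_, hρ' ?_⟩
  · rw [inner_add_right, inner_smul_right, hx, real_inner_self_eq_norm_sq, h.norm_eq]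
    ring
  · rw [dist_zero_right, Real.norm_eq_abs]
    linarith [hε.2]

/-- A generic line in the plane at height `s` meets the rim of the slice in at most two points. -/
theorem sum_volume_image_le [Fintype ι] {ε s : ℝ} (hs : |s| ≤ ε)
    (hε : ∀ i j, i ≠ j → ∀ y z : E3, inner ℝ (N i) y = b i →
      inner ℝ (N j) y = b j → inner ℝ (N i) z = b i → inner ℝ (N j) z = b j →
      inner ℝ n y = inner ℝ n z → |inner ℝ n y - c| ≤ ε → y = z)
    (hcomp : IsCompact (slice n c N b s)) {g : E3} (hg : LinearIndependent ℝ ![n, g]) :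
    ∑ i, volume (inner ℝ g '' facetSlice n c N b i s) ≤
      2 * volume (inner ℝ g '' slice n c N b s) := by
  classical
  obtain ⟨τ, hτ, hnτ, hgτ, hspan⟩ := exists_unit_spanning_orthogonal hg
  have hgc : Continuous (inner ℝ g : E3 → ℝ) := by fun_prop
  -- `X` consists of the finitely many values that `⟪g, ·⟫` takes at the points of the level where
  -- two of the planes meet.
  set X : Set ℝ := ⋃ p : ι × ι, inner ℝ g ''
    {y | p.1 ≠ p.2 ∧ inner ℝ (N p.1) y = b p.1 ∧ inner ℝ (N p.2) y = b p.2 ∧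
      inner ℝ n y = c + s} with hX
  have hXfin : X.Finite := by
    refine Set.finite_iUnion fun p => Set.Finite.image _ (Set.Subsingleton.finite ?_)
    rintro y ⟨hp, hy1, hy2, hyn⟩ z ⟨-, hz1, hz2, hzn⟩
    exact hε _ _ hp y z hy1 hy2 hz1 hz2 (hyn.trans hzn.symm) (by rwa [hyn, add_sub_cancel_left])
  have hXmem : ∀ i j y, i ≠ j → inner ℝ (N i) y = b i → inner ℝ (N j) y = b j →
      inner ℝ n y = c + s → inner ℝ g y ∈ X := by
    intro i j y hij hi hj hn
    exact mem_iUnion.mpr ⟨(i, j), y, ⟨hij, hi, hj, hn⟩, rfl⟩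
  have hm : ∀ i, MeasurableSet (inner ℝ g '' facetSlice n c N b i s) := fun i =>
    ((isCompact_facetSlice hcomp).image hgc).measurableSet
  have hm' : MeasurableSet (inner ℝ g '' slice n c N b s) := (hcomp.image hgc).measurableSet
  have hcount : ∀ r ∉ X, ∑ i, (inner ℝ g '' facetSlice n c N b i s).indicator
      (fun _ => (1 : ENNReal)) r ≤
      (inner ℝ g '' slice n c N b s).indicator (fun _ => (2 : ENNReal)) r := by
    intro r hr
    by_cases hrT : r ∈ inner ℝ g '' slice n c N b s
    · rw [indicator_of_mem hrT]
      simp only [indicator_apply, Finset.sum_boole]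
      norm_cast
      by_contra! hcon
      obtain ⟨i, j, k, hi, hj, hk, hij, hik, hjk⟩ := Finset.two_lt_card_iff.mp hcon
      simp only [Finset.mem_filter, Finset.mem_univ, true_and] at hi hj hk
      obtain ⟨x, ⟨hxK, hxi, hxn⟩, hxr⟩ := hi
      obtain ⟨y, ⟨hyK, hyj, hyn⟩, hyr⟩ := hj
      obtain ⟨z, ⟨hzK, hzk, hzn⟩, hzr⟩ := hk
      have hpar : ∀ u, inner ℝ n u = c + s → inner ℝ g u = r → ∃ q : ℝ, u = x + q • τ := by
        intro u hun hur
        refine ⟨inner ℝ τ (u - x), ?_⟩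
        rw [← hspan (u - x) (by rw [inner_sub_right, hun, hxn, sub_self])
          (by rw [inner_sub_right, hur, hxr, sub_self])]
        abel
      -- of three points on a line, the middle one lies on a plane that supports the line
      have hmid : ∀ i₁ i₂ i₃ (p₁ p₂ p₃ : ℝ), i₁ ≠ i₂ → i₂ ≠ i₃ → p₁ ≤ p₂ → p₂ ≤ p₃ →
          x + p₁ • τ ∈ cone N b → x + p₃ • τ ∈ cone N b →
          inner ℝ (N i₁) (x + p₁ • τ) = b i₁ → inner ℝ (N i₂) (x + p₂ • τ) = b i₂ →
          inner ℝ (N i₃) (x + p₃ • τ) = b i₃ → False := by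
        intro i₁ i₂ i₃ p₁ p₂ p₃ h12 h23 hp hp' hK1 hK3 h1 h2 h3
        have hval : ∀ p : ℝ, inner ℝ n (x + p • τ) = c + s ∧ inner ℝ g (x + p • τ) = r := by
          intro p
          simp [inner_add_right, inner_smul_right, hnτ, hgτ, hxn, hxr]
        have hK1' := hK1 i₂
        have hK3' := hK3 i₂
        simp only [inner_add_right, inner_smul_right] at hK1' hK3'
        have h2' := h2
        simp only [inner_add_right, inner_smul_right] at h2'
        have hor : inner ℝ (N i₂) (x + p₁ • τ) = b i₂ ∨ inner ℝ (N i₂) (x + p₃ • τ) = b i₂ := by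
          rcases hp.eq_or_lt with rfl | hlt
          · exact Or.inl h2
          rcases hp'.eq_or_lt with rfl | hlt'
          · exact Or.inr h2
          have hq : inner ℝ (N i₂) τ = 0 := by nlinarith
          left
          simp only [inner_add_right, inner_smul_right, hq] at h2' ⊢
          linarith
        rcases hor with h4 | h4
        · exact hr ((hval p₁).2 ▸ hXmem i₁ i₂ _ h12 h1 h4 (hval p₁).1)
        · exact hr ((hval p₃).2 ▸ hXmem i₂ i₃ _ h23 h4 h3 (hval p₃).1)
      obtain ⟨q, hq⟩ := hpar y hyn hyr
      obtain ⟨q', hq'⟩ := hpar z hzn hzr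
      obtain ⟨q₀, hq₀⟩ := hpar x hxn hxr
      rw [hq] at hyK hyj
      rw [hq'] at hzK hzk
      rw [hq₀] at hxK hxi
      rcases le_total q₀ q with h1 | h1 <;> rcases le_total q q' with h2 | h2 <;>
        rcases le_total q₀ q' with h3 | h3
      · exact hmid i j k q₀ q q' hij hjk h1 h2 hxK hzK hxi hyj hzk
      · exact hmid i j k q₀ q q' hij hjk h1 h2 hxK hzK hxi hyj hzk
      · exact hmid i k j q₀ q' q hik hjk.symm h3 h2 hxK hyK hxi hzk hyj
      · exact hmid k i j q' q₀ q hik.symm hij h3 h1 hzK hyK hzk hxi hyj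
      · exact hmid j i k q q₀ q' hij.symm hik h1 h3 hyK hzK hyj hxi hzk
      · exact hmid j k i q q' q₀ hjk hik.symm h2 h3 hyK hxK hyj hzk hxi
      · exact hmid k j i q' q q₀ hjk.symm hij.symm h2 h1 hzK hxK hzk hyj hxi
      · exact hmid k j i q' q q₀ hjk.symm hij.symm h2 h1 hzK hxK hzk hyj hxi
    · rw [indicator_of_notMem hrT]
      refine le_of_eq (Finset.sum_eq_zero fun i _ => indicator_of_notMem ?_ _)
      rintro ⟨y, ⟨hy, -, hyn⟩, hyr⟩
      exact hrT ⟨y, ⟨hy, hyn⟩, hyr⟩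
  calc ∑ i, volume (inner ℝ g '' facetSlice n c N b i s)
      = ∫⁻ r, ∑ i, (inner ℝ g '' facetSlice n c N b i s).indicator (fun _ => (1 : ENNReal)) r := by
        rw [lintegral_finsetSum _ fun i _ => measurable_const.indicator (hm i)]
        refine Finset.sum_congr rfl fun i _ => ?_
        rw [lintegral_indicator_const (hm i), one_mul]
    _ ≤ ∫⁻ r, (inner ℝ g '' slice n c N b s).indicator (fun _ => (2 : ENNReal)) r := by
        refine lintegral_mono_ae ?_
        filter_upwards [compl_mem_ae_iff.mpr (hXfin.measure_zero volume)] with r hr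
        exact hcount r hr
    _ = _ := lintegral_indicator_const hm' _

/-- A line in the plane `⟪n, y⟫ = c` through an interior point of the slice meets its rim at least
twice. -/
theorem two_mul_volume_image_le_sum [Fintype ι] (h : IsFaceSystem n c N b)
    (hcomp : IsCompact (slice n c N b 0)) {g : E3} (hg : LinearIndependent ℝ ![n, g]) :
    2 * volume (inner ℝ g '' slice n c N b 0) ≤
      ∑ i, volume (inner ℝ g '' facetSlice n c N b i 0) := by
  classical
  obtain ⟨τ, hτ, hnτ, hgτ, hspan⟩ := exists_unit_spanning_orthogonal hg
  obtain ⟨x, hx, hx'⟩ := h.exists_top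
  have hgc : Continuous (inner ℝ g : E3 → ℝ) := by fun_prop
  have hm : ∀ i, MeasurableSet (inner ℝ g '' facetSlice n c N b i 0) := fun i =>
    ((isCompact_facetSlice hcomp).image hgc).measurableSet
  set T := inner ℝ g '' slice n c N b 0 with hT
  have hTc : IsCompact T := hcomp.image hgc
  have hxs : x ∈ slice n c N b 0 := ⟨fun i => (hx' i).le, by simpa using hx⟩
  have hTne : T.Nonempty := ⟨_, x, hxs, rfl⟩
  -- the levels strictly between the extreme ones contain interior points
  have hinner : ∀ y ∈ slice n c N b 0, ∀ r : ℝ, (inner ℝ g x ≤ r ∧ r < inner ℝ g y ∨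
      inner ℝ g y < r ∧ r ≤ inner ℝ g x) → ∃ q, inner ℝ n q = c ∧ inner ℝ g q = r ∧
      ∀ i, inner ℝ (N i) q < b i := by
    rintro y ⟨hy, hyn⟩ r hr
    set d := inner ℝ g y - inner ℝ g x with hd
    have hd0 : d ≠ 0 := by
      rcases hr with hr | hr
      · have : 0 < d := by linarith
        exact this.ne'
      · have : d < 0 := by linarith
        exact this.ne
    set θ := (r - inner ℝ g x) / d with hθ
    have hθ01 : 0 ≤ θ ∧ θ < 1 := by
      rcases hr with hr | hr
      · have : 0 < d := by linarith
        exact ⟨div_nonneg (by linarith) this.le, (div_lt_one this).mpr (by linarith)⟩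
      · have : d < 0 := by linarith
        exact ⟨div_nonneg_of_nonpos (by linarith) this.le, by rw [hθ, div_lt_one_of_neg this]; linarith⟩
    have hθd : θ * d = r - inner ℝ g x := div_mul_cancel₀ _ hd0
    have hval : ∀ v : E3, inner ℝ v (x + θ • (y - x)) =
        inner ℝ v x + θ * (inner ℝ v y - inner ℝ v x) := by
      intro v
      rw [inner_add_right, inner_smul_right, inner_sub_right]
    refine ⟨x + θ • (y - x), ?_, ?_, fun i => ?_⟩
    · rw [hval, hyn, hx]; ring
    · rw [hval, ← hd, hθd]; ring
    · rw [hval]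
      nlinarith [hx' i, hy i, hθ01.1, hθ01.2]
  -- A ray from an inner point leaves the bounded slice, and does so on a plane `N i` with
  -- `0 < ⟪N i, v⟫`; opposite rays leave on different planes.
  have hray : ∀ q, inner ℝ n q = c → (∀ i, inner ℝ (N i) q < b i) → ∀ v : E3, v ≠ 0 →
      inner ℝ n v = 0 → inner ℝ g v = 0 → ∃ i, 0 < inner ℝ (N i) v ∧
        inner ℝ g q ∈ inner ℝ g '' facetSlice n c N b i 0 := by
    intro q hqn hq v hv0 hnv hgv
    have hne : (Finset.univ.filter fun i => 0 < inner ℝ (N i) v).Nonempty := by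
      by_contra hcon
      rw [Finset.not_nonempty_iff_eq_empty, Finset.filter_eq_empty_iff] at hcon
      obtain ⟨R, hR⟩ := hcomp.isBounded.exists_norm_le
      have hRv : 0 < ‖v‖ := norm_pos_iff.mpr hv0
      have hR0 : 0 ≤ R := (norm_nonneg x).trans (hR x hxs)
      set l := (R + ‖q‖ + 1) / ‖v‖ with hl
      have hl0 : 0 ≤ l := by positivity
      have hmem : q + l • v ∈ slice n c N b 0 := by
        refine ⟨fun i => ?_, ?_⟩
        · rw [inner_add_right, inner_smul_right]
          nlinarith [hq i, not_lt.mp (hcon (Finset.mem_univ i))]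
        · rw [inner_add_right, inner_smul_right, hqn, hnv]; ring
      have h1 := hR _ hmem
      have h2 : ‖l • v‖ ≤ ‖q + l • v‖ + ‖q‖ := by
        calc ‖l • v‖ = ‖q + l • v - q‖ := by rw [add_sub_cancel_left]
          _ ≤ _ := norm_sub_le _ _
      rw [norm_smul, Real.norm_eq_abs, abs_of_nonneg hl0, hl, div_mul_cancel₀ _ hRv.ne'] at h2
      linarith
    obtain ⟨i, hi, hmin⟩ := Finset.exists_min_image _
      (fun i => (b i - inner ℝ (N i) q) / inner ℝ (N i) v) hne
    simp only [Finset.mem_filter, Finset.mem_univ, true_and] at hi hmin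
    set l := (b i - inner ℝ (N i) q) / inner ℝ (N i) v with hl
    have hl0 : 0 < l := div_pos (by linarith [hq i]) hi
    refine ⟨i, hi, q + l • v, ⟨fun k => ?_, ?_, ?_⟩, ?_⟩
    · rw [inner_add_right, inner_smul_right]
      rcases le_or_gt (inner ℝ (N k) v) 0 with hk | hk
      · nlinarith [hq k]
      · have := (le_div_iff₀ hk).mp (hmin k hk)
        linarith
    · rw [inner_add_right, inner_smul_right, hl, div_mul_cancel₀ _ hi.ne']; ring
    · rw [inner_add_right, inner_smul_right, hqn, hnv]; ring
    · rw [inner_add_right, inner_smul_right, hgv]; ring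
  have hτ0 : τ ≠ 0 := by rintro rfl; simp at hτ
  have hcount : ∀ r ∉ ({sInf T, sSup T} : Set ℝ), T.indicator (fun _ => (2 : ENNReal)) r ≤
      ∑ i, (inner ℝ g '' facetSlice n c N b i 0).indicator (fun _ => (1 : ENNReal)) r := by
    intro r hr
    by_cases hrT : r ∈ T
    · rw [indicator_of_mem hrT]
      simp only [mem_insert_iff, mem_singleton_iff, not_or] at hr
      have h1 : sInf T < r := lt_of_le_of_ne (csInf_le hTc.bddBelow hrT) (Ne.symm hr.1)
      have h2 : r < sSup T := lt_of_le_of_ne (le_csSup hTc.bddAbove hrT) hr.2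
      obtain ⟨y, hy, hyr⟩ := hTc.sInf_mem hTne
      obtain ⟨z, hz, hzr⟩ := hTc.sSup_mem hTne
      have hq : ∃ q, inner ℝ n q = c ∧ inner ℝ g q = r ∧ ∀ i, inner ℝ (N i) q < b i := by
        rcases le_total (inner ℝ g x) r with hle | hle
        · exact hinner z hz r (Or.inl ⟨hle, by rw [hzr]; exact h2⟩)
        · exact hinner y hy r (Or.inr ⟨by rw [hyr]; exact h1, hle⟩)
      obtain ⟨q, hqn, hqg, hqN⟩ := hq
      obtain ⟨i, hi, hi'⟩ := hray q hqn hqN τ hτ0 hnτ hgτ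
      obtain ⟨k, hk, hk'⟩ := hray q hqn hqN (-τ) (neg_ne_zero.mpr hτ0)
        (by rw [inner_neg_right, hnτ, neg_zero]) (by rw [inner_neg_right, hgτ, neg_zero])
      rw [inner_neg_right] at hk
      have hik : i ≠ k := by rintro rfl; linarith
      rw [hqg] at hi' hk'
      calc (2 : ENNReal) = ∑ j ∈ {i, k}, (inner ℝ g '' facetSlice n c N b j 0).indicator
            (fun _ => (1 : ENNReal)) r := by
              rw [Finset.sum_pair hik, indicator_of_mem hi', indicator_of_mem hk']
              norm_num
        _ ≤ _ := Finset.sum_le_sum_of_subset (Finset.subset_univ _)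
    · rw [indicator_of_notMem hrT]
      exact zero_le
  calc 2 * volume T = ∫⁻ r, T.indicator (fun _ => (2 : ENNReal)) r :=
        (lintegral_indicator_const hTc.measurableSet _).symm
    _ ≤ ∫⁻ r, ∑ i, (inner ℝ g '' facetSlice n c N b i 0).indicator (fun _ => (1 : ENNReal)) r := by
        refine lintegral_mono_ae ?_
        filter_upwards [compl_mem_ae_iff.mpr ((Set.toFinite {sInf T, sSup T}).measure_zero volume)]
          with r hr
        exact hcount r hr
    _ = _ := by
        rw [lintegral_finsetSum _ fun i _ => measurable_const.indicator (hm i)]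
        refine Finset.sum_congr rfl fun i _ => ?_
        rw [lintegral_indicator_const (hm i), one_mul]

end IsFaceSystem

/-! ### The edge length near a facet -/
theorem volume_image_inner_segment (g p τ : E3) {l : ℝ} (hl : 0 ≤ l) :
    volume (inner ℝ g '' segment ℝ p (p + l • τ)) = ENNReal.ofReal (l * |inner ℝ g τ|) := by
  have : inner ℝ g '' segment ℝ p (p + l • τ) =
      segment ℝ (inner ℝ g p) (inner ℝ g p + l * inner ℝ g τ) := by
    have := image_segment ℝ (innerₗ E3 g).toAffineMap p (p + l • τ)
    simp only [LinearMap.coe_toAffineMap, innerₗ_apply_apply, inner_add_right,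
      inner_smul_right] at this
    exact this
  rw [this, segment_eq_uIcc, Real.volume_interval, add_sub_cancel_left, abs_mul, abs_of_nonneg hl]

theorem hausdorffMeasure_segment_smul (p : E3) {τ : E3} (hτ : ‖τ‖ = 1) {l : ℝ} (hl : 0 ≤ l) :
    Measure.hausdorffMeasure 1 (segment ℝ p (p + l • τ)) = ENNReal.ofReal l := by
  rw [hausdorffMeasure_segment, edist_dist, dist_self_add_right, norm_smul, hτ, mul_one,
    Real.norm_eq_abs, abs_of_nonneg hl]

/-- The part of the boundary of a slice that lies on the boundary of the intersection of
half-spaces. -/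
def rim {ι : Type*} (n : E3) (c : ℝ) (N : ι → E3) (b : ι → ℝ) (s : ℝ) : Set E3 :=
  {y | y ∈ cone N b ∧ (∃ i, inner ℝ (N i) y = b i) ∧ inner ℝ n y = c + s}

theorem rim_eq_iUnion {ι : Type*} (n : E3) (c : ℝ) (N : ι → E3) (b : ι → ℝ) (s : ℝ) :
    rim n c N b s = ⋃ i, facetSlice n c N b i s := by
  ext y
  simp only [rim, facetSlice, mem_iUnion, mem_ofPred_eq]
  tauto

theorem isClosed_creases {ι : Type*} [Finite ι] (N : ι → E3) (b : ι → ℝ) :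
    IsClosed (creases N b) := by
  have : creases N b = cone N b ∩ ⋃ p : {p : ι × ι // p.1 ≠ p.2},
      {y | inner ℝ (N p.1.1) y = b p.1.1 ∧ inner ℝ (N p.1.2) y = b p.1.2} := by
    ext y
    simp only [creases, mem_inter_iff, mem_iUnion, mem_ofPred_eq, Subtype.exists, Prod.exists,
      exists_prop]
  rw [this]
  exact (isClosed_cone N b).inter (isClosed_iUnion_of_finite fun p =>
    (isClosed_eq (by fun_prop) continuous_const).inter
      (isClosed_eq (by fun_prop) continuous_const))

namespace IsFaceSystem

variable {ι : Type*} {n : E3} {c : ℝ} {N : ι → E3} {b : ι → ℝ}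

/-- Any three of the boundary planes have at most one common point. -/
theorem subsingleton_of_three (h : IsFaceSystem n c N b) {i j k : ι} (hij : i ≠ j) (hik : i ≠ k)
    (hjk : j ≠ k) :
    {y : E3 | inner ℝ (N i) y = b i ∧ inner ℝ (N j) y = b j ∧ inner ℝ (N k) y = b k}.Subsingleton := by
  rintro y ⟨hyi, hyj, hyk⟩ z ⟨hzi, hzj, hzk⟩
  by_cases hli : LinearIndependent ℝ ![N i, N j, N k]
  · exact eq_of_inner_eq_of_linearIndependent hli (hyi.trans hzi.symm) (hyj.trans hzj.symm)
      (hyk.trans hzk.symm)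
  · exfalso
    rw [Fintype.not_linearIndependent_iff] at hli
    obtain ⟨g, hg, l, hl⟩ := hli
    simp only [Fin.sum_univ_three, Matrix.cons_val_zero, Matrix.cons_val_one,
      Matrix.cons_val] at hg
    have key : ∀ p : E3, g 0 * (inner ℝ (N i) p - b i) + g 1 * (inner ℝ (N j) p - b j) +
        g 2 * (inner ℝ (N k) p - b k) = 0 := by
      intro p
      have h0 : ∀ q : E3, inner ℝ (g 0 • N i + g 1 • N j + g 2 • N k) q = 0 := by
        intro q
        rw [hg, inner_zero_left]
      have h1 := h0 p
      have h2 := h0 y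
      simp only [inner_add_left, inner_smul_left, conj_trivial, hyi, hyj, hyk] at h1 h2
      linarith
    obtain ⟨p, -, hp, hp'⟩ := h.exists_facet i
    obtain ⟨q, -, hq, hq'⟩ := h.exists_facet j
    obtain ⟨r, -, hr, hr'⟩ := h.exists_facet k
    have h1 := key p
    have h2 := key q
    have h3 := key r
    rw [hp] at h1
    rw [hq] at h2
    rw [hr] at h3
    obtain ⟨e0, e1, e2⟩ := eq_zero_of_sign_pattern (α := g 0) (β := g 1) (γ := g 2)
      (sub_neg.mpr (hq' i hij))
      (sub_neg.mpr (hr' i hik)) (sub_neg.mpr (hp' j hij.symm)) (sub_neg.mpr (hr' j hjk))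
      (sub_neg.mpr (hp' k hik.symm)) (sub_neg.mpr (hq' k hjk.symm))
      (by linarith) (by linarith) (by linarith : g 0 * (inner ℝ (N i) r - b i) +
        g 1 * (inner ℝ (N j) r - b j) = 0)
    fin_cases l <;> simp_all

/-- The perimeter of the slices is a concave function of the height: by Cauchy's formula it is the
mean width of the slice, and the width in each direction is a concave function of the height. -/
theorem sum_slope_le [Fintype ι] (h : IsFaceSystem n c N b) {τ : ι → E3} {L p₁ p₂ : ι → ℝ}
    (hτ : ∀ i, ‖τ i‖ = 1) (hnτ : ∀ i, inner ℝ n (τ i) = 0)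
    (hlow : ∀ᶠ ε in 𝓝[>] (0 : ℝ), ∀ i, ∀ s, -ε ≤ s → s ≤ 0 → 0 ≤ L i + p₁ i * s ∧
      ∃ p, facetSlice n c N b i s = segment ℝ p (p + (L i + p₁ i * s) • τ i))
    (hupp : ∀ᶠ ε in 𝓝[>] (0 : ℝ), ∀ i, ∀ s, 0 ≤ s → s ≤ ε → 0 ≤ L i + p₂ i * s ∧
      (facetSlice n c N b i s = ∅ ∧ L i + p₂ i * s = 0 ∨
        ∃ p, facetSlice n c N b i s = segment ℝ p (p + (L i + p₂ i * s) • τ i))) :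
    ∑ i, p₂ i ≤ ∑ i, p₁ i := by
  obtain ⟨ε, ⟨⟨⟨⟨hlow, hupp⟩, hsub⟩, hcomp⟩, hne⟩, hε0⟩ := (((((hlow.and hupp).and
    h.eventually_subsingleton).and h.eventually_isCompact_slice).and
    h.eventually_slice_nonempty).and self_mem_nhdsWithin).exists
  have hε0 : 0 < ε := hε0
  have hε : |ε| ≤ ε := by rw [abs_of_pos hε0]
  have hε' : |-ε| ≤ ε := by rw [abs_neg, abs_of_pos hε0]
  have h0ε : |(0 : ℝ)| ≤ ε := by simpa using hε0.le
  have hg : ∀ g : E3, 0 ≤ ∑ i, (p₁ i - p₂ i) * |inner ℝ g (τ i)| := by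
    intro g
    by_cases hgli : LinearIndependent ℝ ![n, g]
    -- Compare the widths of the slices at heights `ε`, `0` and `-ε` in the direction `g`; each is
    -- half the sum of the widths of the edges of the slice.
    · have e1 := sum_volume_image_le hε hsub (hcomp ε hε) hgli
      have e2 := sum_volume_image_le hε' hsub (hcomp (-ε) hε') hgli
      have e3 := h.two_mul_volume_image_le_sum (hcomp 0 h0ε) hgli
      have hgc : Continuous (inner ℝ g : E3 → ℝ) := by fun_prop
      have hne' : ∀ s, |s| ≤ ε → (inner ℝ g '' slice n c N b s).Nonempty := by
        intro s hs
        obtain ⟨y, hy, hy'⟩ := hne s hs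
        exact ⟨_, y, ⟨fun i => (hy' i).le, hy⟩, rfl⟩
      have e4 : volume (inner ℝ g '' slice n c N b ε) + volume (inner ℝ g '' slice n c N b (-ε)) ≤
          2 * volume (inner ℝ g '' slice n c N b 0) := by
        refine volume_add_le_two_mul_of_midpoint ((hcomp ε hε).image hgc) (hne' ε hε)
          ((hcomp (-ε) hε').image hgc) (hne' (-ε) hε')
          ((convex_slice n c N b 0).linear_image (innerₗ E3 g)) ?_
        rintro _ ⟨y, ⟨hyK, hyn⟩, rfl⟩ _ ⟨z, ⟨hzK, hzn⟩, rfl⟩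
        refine ⟨(1 / 2 : ℝ) • y + (1 / 2 : ℝ) • z, ⟨convex_cone N b hyK hzK (by norm_num)
          (by norm_num) (by norm_num), ?_⟩, ?_⟩
        · rw [inner_add_right, inner_smul_right, inner_smul_right, hyn, hzn]; ring
        · rw [inner_add_right, inner_smul_right, inner_smul_right]; ring
      have v1 : ∀ i, volume (inner ℝ g '' facetSlice n c N b i ε) =
          ENNReal.ofReal ((L i + p₂ i * ε) * |inner ℝ g (τ i)|) := by
        intro i
        obtain ⟨hnn, h1 | ⟨p, hp⟩⟩ := hupp i ε hε0.le le_rfl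
        · rw [h1.1, h1.2]; simp
        · rw [hp, volume_image_inner_segment _ _ _ hnn]
      have v2 : ∀ i, volume (inner ℝ g '' facetSlice n c N b i (-ε)) =
          ENNReal.ofReal ((L i + p₁ i * -ε) * |inner ℝ g (τ i)|) := by
        intro i
        obtain ⟨hnn, p, hp⟩ := hlow i (-ε) le_rfl (by linarith)
        rw [hp, volume_image_inner_segment _ _ _ hnn]
      have hL : ∀ i, 0 ≤ L i := fun i => by simpa using (hlow i 0 (by linarith) le_rfl).1
      have v3 : ∀ i, volume (inner ℝ g '' facetSlice n c N b i 0) =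
          ENNReal.ofReal (L i * |inner ℝ g (τ i)|) := by
        intro i
        obtain ⟨hnn, p, hp⟩ := hlow i 0 (by linarith) le_rfl
        rw [hp, volume_image_inner_segment _ _ _ hnn]
        simp
      simp only [v1] at e1
      simp only [v2] at e2
      simp only [v3] at e3
      have n1 : ∀ i, 0 ≤ (L i + p₂ i * ε) * |inner ℝ g (τ i)| := fun i =>
        mul_nonneg (hupp i ε hε0.le le_rfl).1 (abs_nonneg _)
      have n2 : ∀ i, 0 ≤ (L i + p₁ i * -ε) * |inner ℝ g (τ i)| := fun i =>
        mul_nonneg (hlow i (-ε) le_rfl (by linarith)).1 (abs_nonneg _)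
      have n3 : ∀ i, 0 ≤ L i * |inner ℝ g (τ i)| := fun i => mul_nonneg (hL i) (abs_nonneg _)
      have e5 : ∑ i, ENNReal.ofReal ((L i + p₂ i * ε) * |inner ℝ g (τ i)|) +
          ∑ i, ENNReal.ofReal ((L i + p₁ i * -ε) * |inner ℝ g (τ i)|) ≤
          2 * ∑ i, ENNReal.ofReal (L i * |inner ℝ g (τ i)|) := by
        calc _ ≤ 2 * volume (inner ℝ g '' slice n c N b ε) +
              2 * volume (inner ℝ g '' slice n c N b (-ε)) := add_le_add e1 e2
          _ = 2 * (volume (inner ℝ g '' slice n c N b ε) +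
              volume (inner ℝ g '' slice n c N b (-ε))) := by ring
          _ ≤ 2 * (2 * volume (inner ℝ g '' slice n c N b 0)) := by gcongr
          _ ≤ _ := by gcongr
      rw [← ENNReal.ofReal_sum_of_nonneg fun i _ => n1 i,
        ← ENNReal.ofReal_sum_of_nonneg fun i _ => n2 i,
        ← ENNReal.ofReal_sum_of_nonneg fun i _ => n3 i,
        ← ENNReal.ofReal_add (Finset.sum_nonneg fun i _ => n1 i)
          (Finset.sum_nonneg fun i _ => n2 i),
        show ∀ x : ℝ, 2 * ENNReal.ofReal x = ENNReal.ofReal (2 * x) from fun x => by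
          rw [ENNReal.ofReal_mul (by norm_num), ENNReal.ofReal_ofNat], ENNReal.ofReal_le_ofReal_iff
          (mul_nonneg (by norm_num) (Finset.sum_nonneg fun i _ => n3 i)), Finset.mul_sum,
        ← Finset.sum_add_distrib, ← sub_nonneg, ← Finset.sum_sub_distrib] at e5
      have e6 : 0 ≤ ε * ∑ i, (p₁ i - p₂ i) * |inner ℝ g (τ i)| := by
        rw [Finset.mul_sum]
        refine e5.trans_eq (Finset.sum_congr rfl fun i _ => ?_)
        ring
      exact nonneg_of_mul_nonneg_right e6 hε0
    · -- a direction normal to the slices is orthogonal to all edges of the slices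
      have : ∀ i, inner ℝ g (τ i) = 0 := by
        intro i
        have hn0 : n ≠ 0 := by
          intro h0
          have := h.norm_eq
          simp [h0] at this
        rw [LinearIndependent.pair_iff' hn0] at hgli
        push Not at hgli
        obtain ⟨a, rfl⟩ := hgli
        rw [inner_smul_left, hnτ, mul_zero]
      simp [this]
  have := sum_nonneg_of_forall_sum_mul_abs_inner_nonneg _ τ hτ hg
  rw [Finset.sum_sub_distrib] at this
  linarith

/-- Apart from finitely many points, no point lies on more than two of the boundary planes, so
the lengths of the parts of `S` on the planes add up to at most twice the length of `S`. -/
theorem sum_measure_inter_facet_le [Fintype ι] (h : IsFaceSystem n c N b) {S : Set E3}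
    (hS : MeasurableSet S) :
    ∑ i, Measure.hausdorffMeasure 1 (S ∩ {y | inner ℝ (N i) y = b i}) ≤
      2 * Measure.hausdorffMeasure 1 S := by
  classical
  have := Measure.nullSingletonClass_hausdorff E3 (d := 1) one_pos
  have hm : ∀ i, MeasurableSet (S ∩ {y | inner ℝ (N i) y = b i}) := fun i =>
    hS.inter (isClosed_eq (by fun_prop) continuous_const).measurableSet
  set X : Set E3 := ⋃ p : ι × ι × ι, {y | (p.1 ≠ p.2.1 ∧ p.1 ≠ p.2.2 ∧ p.2.1 ≠ p.2.2) ∧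
    inner ℝ (N p.1) y = b p.1 ∧ inner ℝ (N p.2.1) y = b p.2.1 ∧ inner ℝ (N p.2.2) y = b p.2.2}
    with hX
  have hXfin : X.Finite := by
    refine Set.finite_iUnion fun p => Set.Subsingleton.finite ?_
    rintro y ⟨⟨h1, h2, h3⟩, hy⟩ z ⟨-, hz⟩
    exact h.subsingleton_of_three h1 h2 h3 hy hz
  calc ∑ i, Measure.hausdorffMeasure 1 (S ∩ {y | inner ℝ (N i) y = b i})
      = ∫⁻ y, ∑ i, (S ∩ {y | inner ℝ (N i) y = b i}).indicator (fun _ => (1 : ENNReal)) y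
          ∂(Measure.hausdorffMeasure 1) := by
        rw [lintegral_finsetSum _ fun i _ => measurable_const.indicator (hm i)]
        refine Finset.sum_congr rfl fun i _ => ?_
        rw [lintegral_indicator_const (hm i), one_mul]
    _ ≤ ∫⁻ y, S.indicator (fun _ => (2 : ENNReal)) y ∂(Measure.hausdorffMeasure 1) := by
        refine lintegral_mono_ae ?_
        filter_upwards [compl_mem_ae_iff.mpr (hXfin.measure_zero (Measure.hausdorffMeasure 1))]
          with y hy
        by_cases hyS : y ∈ S
        · rw [indicator_of_mem hyS]
          simp only [indicator_apply, Finset.sum_boole, mem_inter_iff, hyS, true_and,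
            mem_ofPred_eq]
          norm_cast
          by_contra! hcon
          obtain ⟨i, j, k, hi, hj, hk, hij, hik, hjk⟩ := Finset.two_lt_card_iff.mp hcon
          simp only [Finset.mem_filter, Finset.mem_univ, true_and] at hi hj hk
          exact hy (mem_iUnion.mpr ⟨(i, j, k), ⟨hij, hik, hjk⟩, hi, hj, hk⟩)
        · rw [indicator_of_notMem hyS]
          refine le_of_eq (Finset.sum_eq_zero fun i _ => indicator_of_notMem ?_ _)
          exact fun hy' => hyS hy'.1
    _ = _ := lintegral_indicator_const hS _

end IsFaceSystem

/-- A crease lies on two of the boundary planes, so it is counted at least twice when the lengths on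
the planes are added up. -/
theorem two_mul_measure_le_sum {ι : Type*} [Fintype ι] {N : ι → E3} {b : ι → ℝ} {S : Set E3}
    (hS : MeasurableSet S) (hS' : S ⊆ creases N b) :
    2 * Measure.hausdorffMeasure 1 S ≤
      ∑ i, Measure.hausdorffMeasure 1 (S ∩ {y | inner ℝ (N i) y = b i}) := by
  classical
  have hm : ∀ i, MeasurableSet (S ∩ {y | inner ℝ (N i) y = b i}) := fun i =>
    hS.inter (isClosed_eq (by fun_prop) continuous_const).measurableSet
  calc 2 * Measure.hausdorffMeasure 1 S
      = ∫⁻ y, S.indicator (fun _ => (2 : ENNReal)) y ∂(Measure.hausdorffMeasure 1) :=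
        (lintegral_indicator_const hS _).symm
    _ ≤ ∫⁻ y, ∑ i, (S ∩ {y | inner ℝ (N i) y = b i}).indicator (fun _ => (1 : ENNReal)) y
          ∂(Measure.hausdorffMeasure 1) := by
        refine lintegral_mono fun y => ?_
        by_cases hyS : y ∈ S
        · rw [indicator_of_mem hyS]
          obtain ⟨-, j, k, hjk, hj, hk⟩ := hS' hyS
          calc (2 : ENNReal) = ∑ i ∈ {j, k}, (S ∩ {y | inner ℝ (N i) y = b i}).indicator
                (fun _ => (1 : ENNReal)) y := by
                  rw [Finset.sum_pair hjk, indicator_of_mem (show y ∈ S ∩ _ from ⟨hyS, hj⟩),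
                    indicator_of_mem (show y ∈ S ∩ _ from ⟨hyS, hk⟩)]
                  norm_num
            _ ≤ _ := Finset.sum_le_sum_of_subset (Finset.subset_univ _)
        · rw [indicator_of_notMem hyS]
          exact zero_le
    _ = _ := by
        rw [lintegral_finsetSum _ fun i _ => measurable_const.indicator (hm i)]
        refine Finset.sum_congr rfl fun i _ => ?_
        rw [lintegral_indicator_const (hm i), one_mul]

namespace IsFaceSystem

variable {ι : Type*} {n : E3} {c : ℝ} {N : ι → E3} {b : ι → ℝ}

/-- The first-order change of the edge length when the plane `⟪n, y⟫ = c` is moved by `t`: the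
edges outside the plane become longer or shorter, and the perimeter of the slice changes. If one
of the half-spaces touches the facet in a single point only, then the right derivative is smaller
than the left one. -/
theorem exists_edge_estimates [Finite ι] (h : IsFaceSystem n c N b) :
    ∃ α₁ α₂ : ℝ, α₂ ≤ α₁ ∧ ((∃ i, (facetSlice n c N b i 0).Subsingleton) → α₂ < α₁) ∧
      ∀ᶠ ε in 𝓝[>] (0 : ℝ), ∀ t, 0 < t → t ≤ ε →
        (Measure.hausdorffMeasure 1 (rim n c N b t) ≠ ⊤ ∧
          Measure.hausdorffMeasure 1 (rim n c N b (-t)) ≠ ⊤ ∧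
          Measure.hausdorffMeasure 1 (rim n c N b 0) ≠ ⊤) ∧
        (Measure.hausdorffMeasure 1
            (creases N b ∩ {y | c ≤ inner ℝ n y ∧ inner ℝ n y < c + t})).toReal +
          (Measure.hausdorffMeasure 1 (rim n c N b t)).toReal ≤
          (Measure.hausdorffMeasure 1 (rim n c N b 0)).toReal + α₂ * t ∧
        (Measure.hausdorffMeasure 1
            (creases N b ∩ {y | c - t ≤ inner ℝ n y ∧ inner ℝ n y < c}) ≠ ⊤ →
          (Measure.hausdorffMeasure 1 (rim n c N b (-t))).toReal + α₁ * t ≤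
            (Measure.hausdorffMeasure 1
              (creases N b ∩ {y | c - t ≤ inner ℝ n y ∧ inner ℝ n y < c})).toReal +
            (Measure.hausdorffMeasure 1 (rim n c N b 0)).toReal) := by
  cases nonempty_fintype ι
  choose τ L a₁ a₂ p₁ p₂ hτ hnτ hL ha₁ ha₂ hap hap' hev using h.exists_facet_estimates
  have hev' := eventually_all.mpr hev
  have hsum := h.sum_slope_le hτ hnτ (hev'.mono fun ε hε i => (hε i).1)
    (hev'.mono fun ε hε i => (hε i).2.1)
  -- The legs enter with the factor `1 / 2`, since each of them is counted for two facets. As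
  -- `a₂ + p₂ ≤ a₁ + p₁` for each facet, the remaining half of the slopes `p` has to be compared by
  -- the concavity of the perimeter, `sum_slope_le`.
  have hdiff : (1 / 2 * ∑ i, a₁ i + ∑ i, p₁ i) - (1 / 2 * ∑ i, a₂ i + ∑ i, p₂ i) =
      1 / 2 * ((∑ i, (a₁ i + p₁ i)) - ∑ i, (a₂ i + p₂ i)) +
        1 / 2 * (∑ i, p₁ i - ∑ i, p₂ i) := by
    simp only [Finset.sum_add_distrib]
    ring
  refine ⟨1 / 2 * ∑ i, a₁ i + ∑ i, p₁ i, 1 / 2 * ∑ i, a₂ i + ∑ i, p₂ i, ?_, ?_, ?_⟩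
  · have := Finset.sum_le_sum fun i (_ : i ∈ Finset.univ) => hap i
    linarith
  · rintro ⟨i, hi⟩
    have hLi : L i = 0 := by
      obtain ⟨ε, h1, hε⟩ := ((hev i).and self_mem_nhdsWithin).exists
      obtain ⟨-, p, hp⟩ := h1.1 0 (by simpa using (le_of_lt hε : (0 : ℝ) ≤ ε)) le_rfl
      rw [hp] at hi
      have := hi (left_mem_segment ℝ _ _) (right_mem_segment ℝ _ _)
      have hτ0 : τ i ≠ 0 := by
        intro h0
        have := hτ i
        simp [h0] at this
      simpa [hτ0] using this
    have := Finset.sum_lt_sum (fun i (_ : i ∈ Finset.univ) => hap i) ⟨i, Finset.mem_univ i, hap' i hLi⟩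
    linarith
  · filter_upwards [hev', h.eventually_subsingleton, self_mem_nhdsWithin,
      h.eventually_isCompact_slice] with ε hε hsub hε0 hcomp t ht ht'
    have hε0 : 0 < ε := hε0
    -- the length of the rim is the sum of the lengths of the edges of the slice
    have hfs : ∀ i s, -ε ≤ s → s ≤ 0 → Measure.hausdorffMeasure 1 (facetSlice n c N b i s) =
        ENNReal.ofReal (L i + p₁ i * s) := by
      intro i s hs hs'
      obtain ⟨hnn, p, hp⟩ := (hε i).1 s hs hs'
      rw [hp, hausdorffMeasure_segment_smul p (hτ i) hnn]
    have hfs' : ∀ i s, 0 ≤ s → s ≤ ε → Measure.hausdorffMeasure 1 (facetSlice n c N b i s) =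
        ENNReal.ofReal (L i + p₂ i * s) := by
      intro i s hs hs'
      obtain ⟨hnn, h1 | ⟨p, hp⟩⟩ := (hε i).2.1 s hs hs'
      · rw [h1.1, h1.2]; simp
      · rw [hp, hausdorffMeasure_segment_smul p (hτ i) hnn]
    have hrim : ∀ s, Measure.hausdorffMeasure 1 (rim n c N b s) ≤
        ∑ i, Measure.hausdorffMeasure 1 (facetSlice n c N b i s) := by
      intro s
      rw [rim_eq_iUnion]
      exact measure_iUnion_fintype_le _ _
    have hr1 : Measure.hausdorffMeasure 1 (rim n c N b t) ≤
        ENNReal.ofReal (∑ i, (L i + p₂ i * t)) := by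
      refine (hrim t).trans_eq ?_
      rw [ENNReal.ofReal_sum_of_nonneg fun i _ => ((hε i).2.1 t ht.le ht').1]
      exact Finset.sum_congr rfl fun i _ => hfs' i t ht.le ht'
    have hr2 : Measure.hausdorffMeasure 1 (rim n c N b (-t)) ≤
        ENNReal.ofReal (∑ i, (L i + p₁ i * -t)) := by
      refine (hrim (-t)).trans_eq ?_
      rw [ENNReal.ofReal_sum_of_nonneg fun i _ => ((hε i).1 (-t) (by linarith) (by linarith)).1]
      exact Finset.sum_congr rfl fun i _ => hfs i (-t) (by linarith) (by linarith)
    have hr3 : Measure.hausdorffMeasure 1 (rim n c N b 0) = ENNReal.ofReal (∑ i, L i) := by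
      have := Measure.nullSingletonClass_hausdorff E3 (d := 1) one_pos
      rw [rim_eq_iUnion, measure_iUnion₀, tsum_fintype, ENNReal.ofReal_sum_of_nonneg fun i _ => hL i]
      · refine Finset.sum_congr rfl fun i _ => ?_
        rw [hfs i 0 (by linarith) le_rfl]
        simp
      · intro i j hij
        refine Set.Subsingleton.measure_zero ?_ _
        rintro y ⟨⟨-, hyi, hyn⟩, -, hyj, -⟩ z ⟨⟨-, hzi, hzn⟩, -, hzj, -⟩
        exact hsub i j hij y z hyi hyj hzi hzj (hyn.trans hzn.symm)
          (by rw [hyn, add_sub_cancel_left]; simpa using hε0.le)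
      · intro i
        exact (isCompact_facetSlice (hcomp 0 (by simpa using hε0.le))).measurableSet.nullMeasurableSet
    have hmc : ∀ u v : ℝ, MeasurableSet (creases N b ∩ {y | u ≤ inner ℝ n y ∧ inner ℝ n y < v}) := by
      intro u v
      refine (isClosed_creases N b).measurableSet.inter (MeasurableSet.inter
        (isClosed_le continuous_const (by fun_prop) :
          IsClosed {y : E3 | u ≤ inner ℝ n y}).measurableSet
        (isOpen_lt (by fun_prop) continuous_const :
          IsOpen {y : E3 | inner ℝ n y < v}).measurableSet)
    have hcomm : ∀ u v : ℝ, ∀ i, creases N b ∩ {y | u ≤ inner ℝ n y ∧ inner ℝ n y < v} ∩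
        {y | inner ℝ (N i) y = b i} = creases N b ∩ {y | inner ℝ (N i) y = b i} ∩
          {y | u ≤ inner ℝ n y ∧ inner ℝ n y < v} := fun u v i => inter_right_comm _ _ _
    have hL0 : 0 ≤ ∑ i, L i := Finset.sum_nonneg fun i _ => hL i
    refine ⟨⟨ne_top_of_le_ne_top ENNReal.ofReal_ne_top hr1,
      ne_top_of_le_ne_top ENNReal.ofReal_ne_top hr2, by rw [hr3]; exact ENNReal.ofReal_ne_top⟩,
      ?_, fun hfin => ?_⟩
    · have h1 : 2 * Measure.hausdorffMeasure 1
          (creases N b ∩ {y | c ≤ inner ℝ n y ∧ inner ℝ n y < c + t}) ≤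
          ENNReal.ofReal (∑ i, a₂ i * t) := by
        refine (two_mul_measure_le_sum (hmc _ _) inter_subset_left).trans ?_
        rw [ENNReal.ofReal_sum_of_nonneg fun i _ => mul_nonneg (ha₂ i) ht.le]
        refine Finset.sum_le_sum fun i _ => ?_
        rw [hcomm]
        exact (hε i).2.2.2 t ht ht'
      have h2 := ENNReal.toReal_mono ENNReal.ofReal_ne_top h1
      rw [ENNReal.toReal_mul, ENNReal.toReal_ofNat, ENNReal.toReal_ofReal
        (Finset.sum_nonneg fun i _ => mul_nonneg (ha₂ i) ht.le), ← Finset.sum_mul] at h2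
      have h3 := ENNReal.toReal_mono ENNReal.ofReal_ne_top hr1
      rw [ENNReal.toReal_ofReal (Finset.sum_nonneg fun i _ => ((hε i).2.1 t ht.le ht').1),
        Finset.sum_add_distrib, ← Finset.sum_mul] at h3
      rw [hr3, ENNReal.toReal_ofReal hL0]
      linarith
    · have h1 : ENNReal.ofReal (∑ i, a₁ i * t) ≤ 2 * Measure.hausdorffMeasure 1
          (creases N b ∩ {y | c - t ≤ inner ℝ n y ∧ inner ℝ n y < c}) := by
        refine le_trans ?_ (h.sum_measure_inter_facet_le (hmc _ _))
        rw [ENNReal.ofReal_sum_of_nonneg fun i _ => mul_nonneg (ha₁ i) ht.le]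
        refine Finset.sum_le_sum fun i _ => ?_
        rw [hcomm]
        exact (hε i).2.2.1 t ht ht'
      have h2 := ENNReal.toReal_mono (ENNReal.mul_ne_top (by simp) hfin) h1
      rw [ENNReal.toReal_mul, ENNReal.toReal_ofNat, ENNReal.toReal_ofReal
        (Finset.sum_nonneg fun i _ => mul_nonneg (ha₁ i) ht.le), ← Finset.sum_mul] at h2
      have h3 := ENNReal.toReal_mono ENNReal.ofReal_ne_top hr2
      rw [ENNReal.toReal_ofReal (Finset.sum_nonneg fun i _ =>
        ((hε i).1 (-t) (by linarith) (by linarith)).1), Finset.sum_add_distrib,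
        ← Finset.sum_mul] at h3
      rw [hr3, ENNReal.toReal_ofReal hL0]
      linarith

end IsFaceSystem

/-! ### Three neighbours at one point -/
namespace IsFaceSystem

variable {ι : Type*} {n : E3} {c : ℝ} {N : ι → E3} {b : ι → ℝ}

/-- If each of the half-spaces touches the facet along an edge, then at most two of these edges
meet at a point. -/
theorem not_three_active [Finite ι] (h : IsFaceSystem n c N b)
    (hall : ∀ i, ¬(facetSlice n c N b i 0).Subsingleton) {x : E3} (hx : x ∈ slice n c N b 0)
    {i j k : ι} (hij : i ≠ j) (hik : i ≠ k) (hjk : j ≠ k) (hi : inner ℝ (N i) x = b i)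
    (hj : inner ℝ (N j) x = b j) (hk : inner ℝ (N k) x = b k) : False := by
  obtain ⟨ε, hsub, hε⟩ := (h.eventually_subsingleton.and self_mem_nhdsWithin).exists
  have hε : 0 < ε := hε
  -- The direction of the edge on the `l`-th plane: along it the other active constraints become
  -- inactive, as two of the planes have only one common point on the level of the facet.
  have hdir : ∀ l, inner ℝ (N l) x = b l → ∃ u : E3, inner ℝ n u = 0 ∧ inner ℝ (N l) u = 0 ∧
      ∀ m, m ≠ l → inner ℝ (N m) x = b m → inner ℝ (N m) u < 0 := by
    intro l hl
    have hne : ∃ y ∈ facetSlice n c N b l 0, y ≠ x := by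
      by_contra! hcon
      exact hall l fun y hy z hz => (hcon y hy).trans (hcon z hz).symm
    obtain ⟨y, ⟨hyK, hyl, hyn⟩, hyx⟩ := hne
    refine ⟨y - x, by rw [inner_sub_right, hyn, hx.2, sub_self],
      by rw [inner_sub_right, hyl, hl, sub_self], fun m hm hmx => ?_⟩
    rw [inner_sub_right, hmx, sub_neg]
    refine lt_of_le_of_ne (hyK m) fun hym => hyx ?_
    exact hsub l m hm.symm y x hyl hym hl hmx (hyn.trans hx.2.symm)
      (by rw [hyn, add_sub_cancel_left]; simpa using hε.le)
  obtain ⟨u, hun, hui, hu⟩ := hdir i hi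
  obtain ⟨v, hvn, hvj, hv⟩ := hdir j hj
  obtain ⟨w, hwn, hwk, hw⟩ := hdir k hk
  -- In dimension three the four normals are dependent; on the plane of the facet this is a relation
  -- between the three constraints, which the signs along `u`, `v`, `w` rule out.
  have hli : ¬ LinearIndependent ℝ ![N i, N j, N k, n] := by
    intro hli
    have := hli.fintype_card_le_finrank
    simp at this
  rw [Fintype.not_linearIndependent_iff] at hli
  obtain ⟨g, hg, l, hl⟩ := hli
  simp only [Fin.sum_univ_four, Matrix.cons_val_zero, Matrix.cons_val_one,
    Matrix.cons_val] at hg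
  have key : ∀ p : E3, inner ℝ n p = 0 → g 0 * inner ℝ (N i) p + g 1 * inner ℝ (N j) p +
      g 2 * inner ℝ (N k) p = 0 := by
    intro p hp
    have : inner ℝ (g 0 • N i + g 1 • N j + g 2 • N k + g 3 • n) p = 0 := by
      rw [hg, inner_zero_left]
    simp only [inner_add_left, inner_smul_left, conj_trivial, hp] at this
    linarith
  have h1 := key u hun
  have h2 := key v hvn
  have h3 := key w hwn
  rw [hui] at h1
  rw [hvj] at h2
  rw [hwk] at h3
  obtain ⟨e0, e1, e2⟩ := eq_zero_of_sign_pattern (α := g 0) (β := g 1) (γ := g 2)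
    (hv i hij hi) (hw i hik hi) (hu j hij.symm hj) (hw j hjk hj) (hu k hik.symm hk)
    (hv k hjk.symm hk) (by linarith) (by linarith) (by linarith)
  have hn0 : n ≠ 0 := by
    intro h0
    have := h.norm_eq
    simp [h0] at this
  have e3 : g 3 = 0 := by simpa [e0, e1, e2, hn0] using hg
  fin_cases l <;> simp_all

end IsFaceSystem

/-! ### Sets described by the signs of finitely many affine functions -/

/-- Whether a point belongs to `P` depends only on the signs at this point of the affine functions
`⟪a.1, x⟫ - a.2`, where `a` runs over `A`. -/
def SignInvariant (A : Set (E3 × ℝ)) (P : Set E3) : Prop :=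
  ∀ x y : E3, (∀ a ∈ A, SignType.sign (inner ℝ a.1 x - a.2) = SignType.sign (inner ℝ a.1 y - a.2)) →
    (x ∈ P ↔ y ∈ P)

/-- `P` is a Boolean combination of finitely many half-spaces. -/
def IsSemilinear (P : Set E3) : Prop :=
  ∃ A : Set (E3 × ℝ), A.Finite ∧ (∀ a ∈ A, a.1 ≠ 0) ∧ SignInvariant A P

theorem SignInvariant.mono {A B : Set (E3 × ℝ)} {P : Set E3} (h : SignInvariant A P)
    (hAB : A ⊆ B) : SignInvariant B P :=
  fun x y hxy => h x y fun a ha => hxy a (hAB ha)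

namespace IsSemilinear

theorem compl {P : Set E3} (h : IsSemilinear P) : IsSemilinear Pᶜ := by
  obtain ⟨A, hA, hA0, h⟩ := h
  exact ⟨A, hA, hA0, fun x y hxy => not_congr (h x y hxy)⟩

theorem union {P Q : Set E3} (hP : IsSemilinear P) (hQ : IsSemilinear Q) :
    IsSemilinear (P ∪ Q) := by
  obtain ⟨A, hA, hA0, hP⟩ := hP
  obtain ⟨B, hB, hB0, hQ⟩ := hQ
  refine ⟨A ∪ B, hA.union hB, fun a ha => ha.elim (hA0 a) (hB0 a), fun x y hxy => ?_⟩
  exact or_congr (hP.mono subset_union_left x y hxy) (hQ.mono subset_union_right x y hxy)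

theorem inter {P Q : Set E3} (hP : IsSemilinear P) (hQ : IsSemilinear Q) :
    IsSemilinear (P ∩ Q) := by
  have := (hP.compl.union hQ.compl).compl
  rwa [compl_union, compl_compl, compl_compl] at this

theorem empty : IsSemilinear ∅ :=
  ⟨∅, finite_empty, by simp, fun _ _ _ => Iff.rfl⟩

theorem univ : IsSemilinear Set.univ :=
  ⟨∅, finite_empty, by simp, fun _ _ _ => Iff.rfl⟩

theorem biUnion {κ : Type*} {T : Set κ} (hT : T.Finite) {P : κ → Set E3}
    (h : ∀ k ∈ T, IsSemilinear (P k)) : IsSemilinear (⋃ k ∈ T, P k) := by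
  induction T, hT using Set.Finite.induction_on with
  | empty => simpa using empty
  | insert _ _ ih =>
    rw [biUnion_insert]
    exact (h _ (mem_insert _ _)).union (ih fun k hk => h k (mem_insert_of_mem _ hk))

theorem iInter {κ : Type*} [Finite κ] {P : κ → Set E3} (h : ∀ k, IsSemilinear (P k)) :
    IsSemilinear (⋂ k, P k) := by
  have := (biUnion (Set.finite_univ (α := κ)) fun k _ => (h k).compl).compl
  simpa using this

theorem halfspace_le (g : E3) (β : ℝ) : IsSemilinear {y | inner ℝ g y ≤ β} := by
  rcases eq_or_ne g 0 with rfl | hg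
  · by_cases hβ : 0 ≤ β
    · simpa [hβ] using univ
    · simpa [hβ] using empty
  refine ⟨{(g, β)}, finite_singleton _, by simpa using hg, fun x y hxy => ?_⟩
  have h := hxy (g, β) rfl
  simp only [mem_ofPred_eq]
  have hs : ∀ r : ℝ, r ≤ β ↔ SignType.sign (r - β) ≤ 0 := fun r => by
    rw [sign_nonpos_iff, sub_nonpos]
  rw [hs, hs]
  exact iff_of_eq (congrArg (· ≤ 0) h)

theorem halfspace_ge (g : E3) (β : ℝ) : IsSemilinear {y | β ≤ inner ℝ g y} := by
  have := halfspace_le (-g) (-β)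
  simpa [inner_neg_left] using this

end IsSemilinear

/-- The Riesz representation of an affine function on `E3`. -/
theorem exists_inner_sub_eq (φ : E3 →ᵃ[ℝ] ℝ) : ∃ (g : E3) (β : ℝ), ∀ x, φ x = inner ℝ g x - β := by
  refine ⟨(InnerProductSpace.toDual ℝ E3).symm (LinearMap.toContinuousLinearMap φ.linear),
    -φ 0, fun x => ?_⟩
  rw [InnerProductSpace.toDual_symm_apply]
  have := φ.linearMap_vsub x 0
  simp only [vsub_eq_sub, sub_zero] at this
  simp [this]

/-- A simplex, of any dimension, is described by the barycentric coordinates of an affine basis that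
contains its vertices: they are nonnegative, and those of the other basis points vanish. -/
theorem isSemilinear_simplex (t : Finset E3) (ht : AffineIndependent ℝ ((↑) : t → E3)) :
    IsSemilinear (convexHull ℝ (t : Set E3)) := by
  classical
  obtain ⟨s, hts, hs, hspan⟩ := exists_subset_affineIndependent_affineSpan_eq_top ht
  set B : AffineBasis s ℝ E3 := ⟨(↑), hs, by simpa using hspan⟩ with hB
  have hfin : Finite s := by
    have := finite_set_of_fin_dim_affineIndependent ℝ hs
    exact this
  cases nonempty_fintype s
  have heq : convexHull ℝ (t : Set E3) =
      ⋂ i : s, {x | 0 ≤ B.coord i x ∧ ((i : E3) ∉ t → B.coord i x ≤ 0)} := by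
    apply Subset.antisymm
    · refine convexHull_min ?_ ?_
      · intro x hx
        refine mem_iInter.mpr fun i => ?_
        have hx' : x = B ⟨x, hts hx⟩ := rfl
        rw [mem_ofPred_eq, hx', AffineBasis.coord_apply]
        constructor
        · split_ifs <;> norm_num
        · intro hi
          rw [if_neg]
          rintro rfl
          exact hi hx
      · refine convex_iInter fun i => ?_
        have h1 : Convex ℝ {x | 0 ≤ B.coord i x} :=
          (convex_Ici (𝕜 := ℝ) (0 : ℝ)).affine_preimage (B.coord i)
        by_cases hi : (i : E3) ∈ t
        · simpa [hi] using h1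
        · have h2 : Convex ℝ {x | B.coord i x ≤ 0} :=
            (convex_Iic (𝕜 := ℝ) (0 : ℝ)).affine_preimage (B.coord i)
          rw [show {x | 0 ≤ B.coord i x ∧ ((i : E3) ∉ t → B.coord i x ≤ 0)} =
            {x | 0 ≤ B.coord i x} ∩ {x | B.coord i x ≤ 0} by ext x; simp [hi]]
          exact h1.inter h2
    · intro x hx
      simp only [mem_iInter, mem_ofPred_eq] at hx
      have hx1 : ∑ i, B.coord i x • (i : E3) = x := B.linear_combination_coord_eq_self x
      have hsum := B.sum_coord_apply_eq_one x
      rw [← hx1]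
      have hz : ∀ i : s, (i : E3) ∉ t → B.coord i x = 0 := fun i hi =>
        le_antisymm ((hx i).2 hi) (hx i).1
      rw [← Finset.sum_filter_add_sum_filter_not Finset.univ (fun i : s => (i : E3) ∈ t)] at hsum ⊢
      rw [Finset.sum_eq_zero (s := Finset.univ.filter fun i : s => ¬ (i : E3) ∈ t)
        fun i hi => hz i (Finset.mem_filter.mp hi).2, add_zero] at hsum
      rw [Finset.sum_eq_zero (s := Finset.univ.filter fun i : s => ¬ (i : E3) ∈ t)
        fun i hi => by rw [hz i (Finset.mem_filter.mp hi).2, zero_smul], add_zero]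
      exact (convex_convexHull ℝ _).sum_mem (fun i _ => (hx i).1) hsum fun i hi =>
        subset_convexHull ℝ _ (Finset.mem_filter.mp hi).2
  rw [heq]
  refine IsSemilinear.iInter fun i => ?_
  obtain ⟨g, β, hg⟩ := exists_inner_sub_eq (B.coord i)
  have h1 : IsSemilinear {x | 0 ≤ B.coord i x} := by
    simpa [hg] using IsSemilinear.halfspace_ge g β
  by_cases hi : (i : E3) ∈ t
  · simpa [hi] using h1
  · have h2 : IsSemilinear {x | B.coord i x ≤ 0} := by
      simpa [hg] using IsSemilinear.halfspace_le g β
    rw [show {x | 0 ≤ B.coord i x ∧ ((i : E3) ∉ t → B.coord i x ≤ 0)} =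
      {x | 0 ≤ B.coord i x} ∩ {x | B.coord i x ≤ 0} by ext x; simp [hi]]
    exact h1.inter h2

/-- By Carathéodory's theorem a polytope is a finite union of simplices, and these are described by
the signs of barycentric coordinates. -/
theorem isSemilinear_convexHull {s : Set E3} (hs : s.Finite) : IsSemilinear (convexHull ℝ s) := by
  have heq : convexHull ℝ s = ⋃ t ∈ {t : Finset E3 | (t : Set E3) ⊆ s ∧
      AffineIndependent ℝ ((↑) : t → E3)}, convexHull ℝ (t : Set E3) := by
    rw [convexHull_eq_union]
    ext x
    simp only [mem_iUnion, mem_ofPred_eq, exists_prop, and_assoc]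
  rw [heq]
  refine IsSemilinear.biUnion ?_ fun t ht => isSemilinear_simplex t ht.2
  refine (hs.finite_subsets.preimage Finset.coe_injective.injOn).subset fun t ht => ht.1

theorem IsPolyhedron.isSemilinear {P : Set E3} (hP : IsPolyhedron P) : IsSemilinear P := by
  obtain ⟨S, hS, hS', rfl⟩ := hP.exists_finite_union
  rw [sUnion_eq_biUnion]
  refine IsSemilinear.biUnion hS fun C hC => ?_
  obtain ⟨s, hs, rfl⟩ := hS' C hC
  exact isSemilinear_convexHull hs

theorem IsPolyhedron.isCompact {P : Set E3} (hP : IsPolyhedron P) : IsCompact P := by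
  obtain ⟨S, hS, hS', rfl⟩ := hP.exists_finite_union
  refine hS.isCompact_sUnion fun C hC => ?_
  obtain ⟨s, hs, rfl⟩ := hS' C hC
  exact hs.isCompact_convexHull ℝ

/-! ### Flat points -/

theorem IsHalfspaceAt.eventually_add {P : Set E3} {x n : E3} {c : ℝ} (h : IsHalfspaceAt P x n c) :
    ∀ᶠ v in 𝓝 (0 : E3), (x + v ∈ P ↔ inner ℝ n v ≤ 0) := by
  have h1 : Tendsto (fun v : E3 => x + v) (𝓝 0) (𝓝 x) := by
    simpa using (continuous_const_add x).tendsto (0 : E3)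
  filter_upwards [h1.eventually h.2.2] with v hv
  rw [hv, inner_add_right, h.2.1]
  constructor <;> intro _ <;> linarith

/-- A set that agrees near `x` with a half-space has no other supporting half-space at `x`. -/
theorem IsHalfspaceAt.eq_of_eventually_imp {P : Set E3} {x n m : E3} {c d : ℝ}
    (h : IsHalfspaceAt P x n c) (hm : ‖m‖ = 1) (hd : inner ℝ m x = d)
    (hP : ∀ᶠ y in 𝓝 x, y ∈ P → inner ℝ m y ≤ d) : m = n ∧ d = c := by
  have h1 : Tendsto (fun v : E3 => x + v) (𝓝 0) (𝓝 x) := by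
    simpa using (continuous_const_add x).tendsto (0 : E3)
  have h2 : ∀ᶠ v in 𝓝 (0 : E3), inner ℝ n v ≤ 0 → inner ℝ m v ≤ 0 := by
    filter_upwards [h.eventually_add, h1.eventually hP] with v hv hv' hnv
    have := hv' (hv.mpr hnv)
    rw [inner_add_right, hd] at this
    linarith
  have h3 : Tendsto (fun t : ℝ => t • (m - n)) (𝓝[>] 0) (𝓝 0) := by
    have : Tendsto (fun t : ℝ => t • (m - n)) (𝓝 0) (𝓝 ((0 : ℝ) • (m - n))) :=
      (Continuous.tendsto (by fun_prop) _)
    rw [zero_smul] at this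
    exact this.mono_left nhdsWithin_le_nhds
  obtain ⟨t, ht, ht0⟩ := ((h3.eventually h2).and self_mem_nhdsWithin).exists
  have ht0 : 0 < t := ht0
  have hle : inner ℝ n m ≤ (1 : ℝ) := by
    have := real_inner_le_norm n m
    rwa [h.1, hm, one_mul] at this
  have h4 := ht (by
    rw [inner_smul_right, inner_sub_right, real_inner_self_eq_norm_sq, h.1]
    nlinarith)
  rw [inner_smul_right, inner_sub_right, real_inner_self_eq_norm_sq, hm,
    real_inner_comm n m] at h4
  have h5 : inner ℝ n m = (1 : ℝ) := le_antisymm hle (by nlinarith)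
  have h6 : n = m := (inner_eq_one_iff_of_norm_eq_one h.1 hm).mp h5
  exact ⟨h6.symm, by rw [← hd, ← h.2.1, h6]⟩

theorem IsHalfspaceAt.unique {P : Set E3} {x n m : E3} {c d : ℝ}
    (h : IsHalfspaceAt P x n c) (h' : IsHalfspaceAt P x m d) : m = n ∧ d = c :=
  h.eq_of_eventually_imp h'.1 h'.2.1 (h'.2.2.mono fun _ hy => hy.mp)

theorem IsHalfspaceAt.mem {P : Set E3} {x n : E3} {c : ℝ} (h : IsHalfspaceAt P x n c) : x ∈ P :=
  h.2.2.self_of_nhds.mpr h.2.1.le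

theorem IsHalfspaceAt.congr {P Q : Set E3} {x n : E3} {c : ℝ} (h : IsHalfspaceAt P x n c)
    (hPQ : ∀ᶠ y in 𝓝 x, (y ∈ P ↔ y ∈ Q)) : IsHalfspaceAt Q x n c :=
  ⟨h.1, h.2.1, by filter_upwards [h.2.2, hPQ] with y h1 h2; rw [← h2, h1]⟩

theorem IsHalfspaceAt.eventually_of_eq {P : Set E3} {x n : E3} {c : ℝ}
    (h : IsHalfspaceAt P x n c) : ∀ᶠ y in 𝓝 x, inner ℝ n y = c → IsHalfspaceAt P y n c := by
  filter_upwards [h.2.2.eventually_nhds] with y hy hyc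
  exact ⟨h.1, hyc, hy⟩

theorem flatPoints_subset_frontier (P : Set E3) : flatPoints P ⊆ frontier P := by
  rintro x ⟨n, c, h⟩
  refine ⟨subset_closure h.mem, fun hint => ?_⟩
  have hP : ∀ᶠ y in 𝓝 x, y ∈ P := mem_interior_iff_mem_nhds.mp hint
  have h1 : ∀ᶠ y in 𝓝 x, y ∈ P → inner ℝ (-n) y ≤ -c := by
    have h2 : Tendsto (fun v : E3 => x + v) (𝓝 0) (𝓝 x) := by
      simpa using (continuous_const_add x).tendsto (0 : E3)
    have h3 : Tendsto (fun t : ℝ => x + t • n) (𝓝[>] 0) (𝓝 x) := by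
      have : Tendsto (fun t : ℝ => x + t • n) (𝓝 0) (𝓝 (x + (0 : ℝ) • n)) :=
        (Continuous.tendsto (by fun_prop) _)
      rw [zero_smul, add_zero] at this
      exact this.mono_left nhdsWithin_le_nhds
    obtain ⟨t, ⟨ht, ht'⟩, ht0⟩ := ((h3.eventually (hP.and h.2.2)).and self_mem_nhdsWithin).exists
    have ht0 : 0 < t := ht0
    have := ht'.mp ht
    rw [inner_add_right, inner_smul_right, h.2.1, real_inner_self_eq_norm_sq, h.1] at this
    linarith
  have := (h.eq_of_eventually_imp (by rw [norm_neg, h.1]) (by rw [inner_neg_left, h.2.1]) h1).1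
  have h0 : n = 0 := by
    have h2 : (2 : ℝ) • n = 0 := by
      rw [two_smul]
      nth_rewrite 1 [← this]
      rw [neg_add_cancel]
    simpa using h2
  have := h.1
  simp [h0] at this

/-- Near a flat point the boundary is contained in the plane of the half-space. -/
theorem IsHalfspaceAt.eventually_eq {P : Set E3} {x n : E3} {c : ℝ}
    (h : IsHalfspaceAt P x n c) : ∀ᶠ y in 𝓝 x, y ∈ frontier P → inner ℝ n y = c := by
  filter_upwards [h.2.2.eventually_nhds] with y hy hyP
  by_contra hne
  rcases lt_or_gt_of_ne hne with hlt | hgt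
  · refine hyP.2 (mem_interior_iff_mem_nhds.mpr ?_)
    have : ∀ᶠ z in 𝓝 y, inner ℝ n z < c :=
      (Continuous.tendsto (by fun_prop) _).eventually_lt_const hlt
    filter_upwards [hy, this] with z hz hz'
    exact hz.mpr hz'.le
  · have : ∀ᶠ z in 𝓝 y, c < inner ℝ n z :=
      (Continuous.tendsto (by fun_prop) _).eventually_const_lt hgt
    obtain ⟨z, hzP, hz, hz'⟩ := ((mem_closure_iff_frequently.mp hyP.1).and_eventually
      (hy.and this)).exists
    exact absurd (hz.mp hzP) (not_le.mpr hz')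

theorem IsHalfspaceAt.eventually_flat {P : Set E3} {x n : E3} {c : ℝ}
    (h : IsHalfspaceAt P x n c) :
    ∀ᶠ y in 𝓝 x, y ∈ flatPoints P → IsHalfspaceAt P y n c := by
  filter_upwards [h.eventually_eq, h.eventually_of_eq] with y hy hy' hyf
  exact hy' (hy (flatPoints_subset_frontier P hyf))

/-- The half-space is the same at all points of a connected set of flat points. -/
theorem IsHalfspaceAt.of_isPreconnected {P C : Set E3} {x n : E3} {c : ℝ}
    (h : IsHalfspaceAt P x n c) (hC : IsPreconnected C) (hCf : C ⊆ flatPoints P) (hx : x ∈ C)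
    {y : E3} (hy : y ∈ C) : IsHalfspaceAt P y n c := by
  by_contra hcon
  set U := {y | ∀ᶠ z in 𝓝 y, z ∈ flatPoints P → IsHalfspaceAt P z n c} with hU
  set V := {y | ∀ᶠ z in 𝓝 y, z ∈ flatPoints P → ¬ IsHalfspaceAt P z n c} with hV
  have hUo : IsOpen U := isOpen_setOfPred_eventually_nhds
  have hVo : IsOpen V := isOpen_setOfPred_eventually_nhds
  have hnot : ∀ z ∈ flatPoints P, ¬ IsHalfspaceAt P z n c → z ∈ V := by
    rintro z ⟨m, d, hz⟩ hzn
    filter_upwards [hz.eventually_flat] with w hw hwf hwn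
    obtain ⟨rfl, rfl⟩ := hwn.unique (hw hwf)
    exact hzn hz
  obtain ⟨z, hzC, hzU, hzV⟩ := hC U V hUo hVo
    (fun z hz => by
      by_cases hzn : IsHalfspaceAt P z n c
      · exact Or.inl hzn.eventually_flat
      · exact Or.inr (hnot z (hCf hz) hzn))
    ⟨x, hx, h.eventually_flat⟩ ⟨y, hy, hnot y (hCf hy) hcon⟩
  exact hzV.self_of_nhds (hCf hzC) (hzU.self_of_nhds (hCf hzC))

theorem mem_connectedComponentIn_of_segment_subset {S : Set E3} {x y : E3}
    (h : segment ℝ x y ⊆ S) : y ∈ connectedComponentIn S x :=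
  (convex_segment x y).isPreconnected.subset_connectedComponentIn (left_mem_segment ℝ x y) h
    (right_mem_segment ℝ x y)

/-- The flat points form, in their planes, a relatively open set: near one of them they form a
disc, and hence a flat point in the closure of a component belongs to it. -/
theorem mem_connectedComponentIn_of_mem_closure {P : Set E3} {x y : E3} (hy : y ∈ flatPoints P)
    (h : y ∈ closure (connectedComponentIn (flatPoints P) x)) :
    y ∈ connectedComponentIn (flatPoints P) x := by
  obtain ⟨n, c, hn⟩ := hy
  obtain ⟨ρ, hρ, hball⟩ := Metric.eventually_nhds_iff_ball.mp
    (hn.eventually_eq.and hn.eventually_of_eq)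
  obtain ⟨z, hz, hzy⟩ := Metric.mem_closure_iff.mp h ρ hρ
  have hzb : z ∈ Metric.ball y ρ := by rwa [Metric.mem_ball, dist_comm]
  have hyz : y ∈ connectedComponentIn (flatPoints P) z := by
    refine mem_connectedComponentIn_of_segment_subset fun w hw => ?_
    have hwb : w ∈ Metric.ball y ρ :=
      (convex_ball y ρ).segment_subset hzb (Metric.mem_ball_self hρ) hw
    have hzc : inner ℝ n z = c := (hball z hzb).1 (flatPoints_subset_frontier P
      (connectedComponentIn_subset _ _ hz))
    have hwc : w ∈ {w | inner ℝ n w = c} :=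
      (convex_hyperplane (innerₗ E3 n).isLinear c).segment_subset hzc hn.2.1 hw
    exact ⟨n, c, (hball w hwb).2 hwc⟩
  rwa [connectedComponentIn_eq hz]

/-! ### Semilinear sets near a point -/

theorem eventually_sign_eq {A : Set (E3 × ℝ)} (hA : A.Finite) (x : E3) :
    ∀ᶠ v in 𝓝 (0 : E3), ∀ a ∈ A, inner ℝ a.1 x ≠ a.2 →
      SignType.sign (inner ℝ a.1 (x + v) - a.2) = SignType.sign (inner ℝ a.1 x - a.2) := by
  rw [eventually_all_finite hA]
  intro a _
  by_cases ha : inner ℝ a.1 x = a.2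
  · exact Eventually.of_forall fun _ h => absurd ha h
  have hc : Tendsto (fun v : E3 => inner ℝ a.1 (x + v) - a.2) (𝓝 0) (𝓝 (inner ℝ a.1 x - a.2)) := by
    have : Continuous fun v : E3 => inner ℝ a.1 (x + v) - a.2 := by fun_prop
    simpa using this.tendsto 0
  rcases lt_or_gt_of_ne ha with h | h
  · filter_upwards [hc.eventually_lt_const (sub_neg.mpr h)] with v hv _
    rw [sign_neg hv, sign_neg (sub_neg.mpr h)]
  · filter_upwards [hc.eventually_const_lt (sub_pos.mpr h)] with v hv _
    rw [sign_pos hv, sign_pos (sub_pos.mpr h)]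

/-- Near points with equal signs a semilinear set looks the same up to translation: the functions
that vanish at one of them vanish at the other, and the rest keep their sign. -/
theorem SignInvariant.eventually_add_mem_iff {A : Set (E3 × ℝ)} {P : Set E3}
    (h : SignInvariant A P) (hA : A.Finite) {x y : E3}
    (hxy : ∀ a ∈ A, SignType.sign (inner ℝ a.1 x - a.2) = SignType.sign (inner ℝ a.1 y - a.2)) :
    ∀ᶠ v in 𝓝 (0 : E3), (x + v ∈ P ↔ y + v ∈ P) := by
  filter_upwards [eventually_sign_eq hA x, eventually_sign_eq hA y] with v hv hv'
  refine h _ _ fun a ha => ?_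
  by_cases hx : inner ℝ a.1 x = a.2
  · have hy : inner ℝ a.1 y = a.2 := by
      have := hxy a ha
      rw [hx, sub_self, sign_zero, eq_comm, sign_eq_zero_iff] at this
      linarith
    rw [inner_add_right, inner_add_right, hx, hy]
  · have hy : inner ℝ a.1 y ≠ a.2 := by
      intro hy
      have := hxy a ha
      rw [hy, sub_self, sign_zero, sign_eq_zero_iff] at this
      exact hx (by linarith)
    rw [hv a ha hx, hv' a ha hy, hxy a ha]

/-- Whether a point is flat depends only on the signs of the describing affine functions there. -/
theorem SignInvariant.isHalfspaceAt {A : Set (E3 × ℝ)} {P : Set E3}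
    (h : SignInvariant A P) (hA : A.Finite) {x y n : E3} {c : ℝ} (hx : IsHalfspaceAt P x n c)
    (hxy : ∀ a ∈ A, SignType.sign (inner ℝ a.1 x - a.2) = SignType.sign (inner ℝ a.1 y - a.2)) :
    y ∈ flatPoints P := by
  refine ⟨n, inner ℝ n y, hx.1, rfl, ?_⟩
  have h1 : Tendsto (fun z : E3 => z - y) (𝓝 y) (𝓝 0) := by
    have : Continuous fun z : E3 => z - y := by fun_prop
    simpa using this.tendsto y
  filter_upwards [h1.eventually (hx.eventually_add.and (h.eventually_add_mem_iff hA hxy))] with z hz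
  rw [hz.1, add_sub_cancel, inner_sub_right] at hz
  rw [← hz.2]
  constructor <;> intro _ <;> linarith

theorem sign_inner_eq_of_mem_segment {g x y z : E3} {β : ℝ} (hz : z ∈ segment ℝ x y)
    (hxy : SignType.sign (inner ℝ g x - β) = SignType.sign (inner ℝ g y - β)) :
    SignType.sign (inner ℝ g x - β) = SignType.sign (inner ℝ g z - β) := by
  obtain ⟨s, t, hs, ht, hst, rfl⟩ := hz
  have hval : inner ℝ g (s • x + t • y) - β = s * (inner ℝ g x - β) + t * (inner ℝ g y - β) := by
    rw [inner_add_right, inner_smul_right, inner_smul_right]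
    linear_combination β * hst
  rw [hval]
  set p := inner ℝ g x - β
  set q := inner ℝ g y - β
  rcases lt_trichotomy p 0 with hp | hp | hp
  · have hq : q < 0 := by rwa [sign_neg hp, eq_comm, sign_eq_neg_one_iff] at hxy
    rw [sign_neg hp, sign_neg]
    rcases hs.eq_or_lt with rfl | hs'
    · have : t = 1 := by linarith
      subst this; linarith
    · nlinarith
  · have hq : q = 0 := by rwa [hp, sign_zero, eq_comm, sign_eq_zero_iff] at hxy
    simp [hp, hq]
  · have hq : 0 < q := by rwa [sign_pos hp, eq_comm, sign_eq_one_iff] at hxy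
    rw [sign_pos hp, sign_pos]
    rcases hs.eq_or_lt with rfl | hs'
    · have : t = 1 := by linarith
      subst this; linarith
    · nlinarith

theorem finite_range_of_factors {α β γ : Type*} [Finite γ] (f : α → β) (σ : α → γ)
    (h : ∀ x y, σ x = σ y → f x = f y) : (range f).Finite := by
  have : Finite (range fun x => (σ x, f x)) := by
    refine Finite.of_injective (fun p : range fun x => (σ x, f x) => p.1.1) ?_
    rintro ⟨_, x, rfl⟩ ⟨_, y, rfl⟩ hxy
    exact Subtype.ext (Prod.ext hxy (h x y hxy))
  have h2 := (Set.toFinite (range fun x => (σ x, f x))).image Prod.snd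
  rwa [← range_comp] at h2

/-- All points with the same signs of the describing affine functions as a flat point are flat, and
they form a convex set. So each face determines a sign vector that no other face has. -/
theorem IsSemilinear.finite_faces {P : Set E3} (hP : IsSemilinear P) : (faces P).Finite := by
  obtain ⟨A, hA, -, h⟩ := hP
  have := hA.to_subtype
  have heq : faces P = range fun x : flatPoints P =>
      closure (connectedComponentIn (flatPoints P) (x : E3)) := by
    ext F
    simp only [faces, mem_ofPred_eq, mem_range, Subtype.exists, exists_prop]
    exact exists_congr fun x => and_congr_right fun _ => eq_comm
  rw [heq]
  refine finite_range_of_factors _ (fun (x : flatPoints P) (a : A) =>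
    SignType.sign (inner ℝ a.1.1 (x : E3) - a.1.2)) ?_
  rintro ⟨x, hx⟩ ⟨y, hy⟩ hxy
  have hxy' : ∀ a ∈ A, SignType.sign (inner ℝ a.1 x - a.2) =
      SignType.sign (inner ℝ a.1 y - a.2) := fun a ha => congrFun hxy ⟨a, ha⟩
  have : y ∈ connectedComponentIn (flatPoints P) x := by
    refine mem_connectedComponentIn_of_segment_subset fun z hz => ?_
    obtain ⟨n, c, hn⟩ := hx
    exact h.isHalfspaceAt hA hn fun a ha => sign_inner_eq_of_mem_segment hz (hxy' a ha)
  simp only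
  rw [connectedComponentIn_eq this]

/-- A point of the skeleton lies on two of the describing planes that are not parallel: if all
describing planes through a boundary point are parallel, then near it the set can only be one of
the two sides, and the point is flat. -/
theorem SignInvariant.exists_linearIndependent {A : Set (E3 × ℝ)} {P : Set E3}
    (h : SignInvariant A P) (hA : A.Finite) (hA0 : ∀ a ∈ A, a.1 ≠ 0)
    (hP : closure (interior P) = P) {x : E3} (hx : x ∈ skeleton P) :
    ∃ a ∈ A, ∃ b ∈ A, inner ℝ a.1 x = a.2 ∧ inner ℝ b.1 x = b.2 ∧
      LinearIndependent ℝ ![a.1, b.1] := by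
  by_contra! hcon
  have hPc : IsClosed P := hP ▸ isClosed_closure
  obtain ⟨hxf, hxn⟩ := hx
  have hxP : x ∈ P := hPc.frontier_subset hxf
  obtain ⟨ρ, hρ, hball⟩ := Metric.eventually_nhds_iff_ball.mp (eventually_sign_eq hA x)
  -- If all active normals are multiples of `e`, then near `x` membership depends only on the sign of
  -- `⟪e, · - x⟫`.
  have hcase : ∃ e : E3, ‖e‖ = 1 ∧ ∀ a ∈ A, inner ℝ a.1 x = a.2 → ∃ l : ℝ, a.1 = l • e := by
    by_cases hact : ∃ a ∈ A, inner ℝ a.1 x = a.2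
    · obtain ⟨a, ha, hax⟩ := hact
      have ha0 := hA0 a ha
      refine ⟨(‖a.1‖)⁻¹ • a.1, by
        rw [norm_smul, norm_inv, norm_norm, inv_mul_cancel₀ (norm_ne_zero_iff.mpr ha0)],
        fun b hb hbx => ?_⟩
      have := hcon a ha b hb hax hbx
      rw [LinearIndependent.pair_iff' ha0] at this
      push Not at this
      obtain ⟨l, hl⟩ := this
      refine ⟨l * ‖a.1‖, ?_⟩
      rw [smul_smul, mul_assoc, mul_inv_cancel₀ (norm_ne_zero_iff.mpr ha0), mul_one, hl]
    · push Not at hact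
      exact ⟨EuclideanSpace.single 0 1, by simp, fun a ha hax => absurd hax (hact a ha)⟩
  obtain ⟨e, he, hpar⟩ := hcase
  have hee : inner ℝ e e = (1 : ℝ) := by rw [real_inner_self_eq_norm_sq, he, one_pow]
  have hiff : ∀ v w : E3, ‖v‖ < ρ → ‖w‖ < ρ →
      SignType.sign (inner ℝ e v) = SignType.sign (inner ℝ e w) → (x + v ∈ P ↔ x + w ∈ P) := by
    intro v w hv hw hvw
    refine h _ _ fun a ha => ?_
    by_cases hax : inner ℝ a.1 x = a.2
    · obtain ⟨l, hl⟩ := hpar a ha hax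
      rw [inner_add_right, inner_add_right, hax, add_sub_cancel_left, add_sub_cancel_left, hl,
        inner_smul_left, inner_smul_left, sign_mul, sign_mul, hvw]
    · rw [hball v (by simpa using hv) a ha hax, hball w (by simpa using hw) a ha hax]
  have hhalf : ‖(ρ / 2) • e‖ < ρ := by
    rw [norm_smul, he, mul_one, Real.norm_eq_abs, abs_of_pos (by linarith)]; linarith
  have hhalf' : ‖-((ρ / 2) • e)‖ < ρ := by rwa [norm_neg]
  have hpos : ∀ v, ‖v‖ < ρ → 0 < inner ℝ e v → (x + v ∈ P ↔ x + (ρ / 2) • e ∈ P) := by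
    intro v hv hev
    refine hiff v _ hv hhalf ?_
    rw [sign_pos hev, sign_pos]
    rw [inner_smul_right, hee]; linarith
  have hneg : ∀ v, ‖v‖ < ρ → inner ℝ e v < 0 → (x + v ∈ P ↔ x + -((ρ / 2) • e) ∈ P) := by
    intro v hv hev
    refine hiff v _ hv hhalf' ?_
    rw [sign_neg hev, sign_neg]
    rw [inner_neg_right, inner_smul_right, hee]; linarith
  have hzero : ∀ v, ‖v‖ < ρ → inner ℝ e v = 0 → x + v ∈ P := by
    intro v hv hev
    refine (hiff v 0 hv (by simpa using hρ) (by rw [hev, inner_zero_right])).mpr ?_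
    rwa [add_zero]
  have hnear : ∀ᶠ y in 𝓝 x, ‖y - x‖ < ρ := by
    filter_upwards [Metric.ball_mem_nhds x hρ] with y hy
    rwa [← dist_eq_norm]
  -- `P` contains both sides of the plane through `x` (an interior point), one side (a flat point) or
  -- none (impossible, as `P` is the closure of its interior).
  by_cases h1 : x + (ρ / 2) • e ∈ P <;> by_cases h2 : x + -((ρ / 2) • e) ∈ P
  · refine hxf.2 (mem_interior_iff_mem_nhds.mpr ?_)
    filter_upwards [hnear] with y hy
    rw [← add_sub_cancel x y]
    rcases lt_trichotomy (inner ℝ e (y - x)) 0 with h3 | h3 | h3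
    · exact (hneg _ hy h3).mpr h2
    · exact hzero _ hy h3
    · exact (hpos _ hy h3).mpr h1
  · refine hxn ⟨-e, inner ℝ (-e) x, by rw [norm_neg, he], rfl, ?_⟩
    filter_upwards [hnear] with y hy
    have h4 : inner ℝ (-e) y ≤ inner ℝ (-e) x ↔ 0 ≤ inner ℝ e (y - x) := by
      rw [inner_neg_left, inner_neg_left, inner_sub_right, neg_le_neg_iff, sub_nonneg]
    rw [h4]
    conv_lhs => rw [← add_sub_cancel x y]
    rcases lt_trichotomy (inner ℝ e (y - x)) 0 with h3 | h3 | h3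
    · exact iff_of_false (fun hP => h2 ((hneg _ hy h3).mp hP)) (not_le.mpr h3)
    · exact iff_of_true (hzero _ hy h3) h3.ge
    · exact iff_of_true ((hpos _ hy h3).mpr h1) h3.le
  · refine hxn ⟨e, inner ℝ e x, he, rfl, ?_⟩
    filter_upwards [hnear] with y hy
    have h4 : inner ℝ e y ≤ inner ℝ e x ↔ inner ℝ e (y - x) ≤ 0 := by
      rw [inner_sub_right, sub_nonpos]
    rw [h4]
    conv_lhs => rw [← add_sub_cancel x y]
    rcases lt_trichotomy (inner ℝ e (y - x)) 0 with h3 | h3 | h3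
    · exact iff_of_true ((hneg _ hy h3).mpr h2) h3.le
    · exact iff_of_true (hzero _ hy h3) h3.le
    · exact iff_of_false (fun hP => h1 ((hpos _ hy h3).mp hP)) (not_le.mpr h3)
  · -- a set with empty interior near `x` does not contain `x`
    rw [← hP] at hxP
    obtain ⟨y, hy, hyx⟩ := Metric.mem_closure_iff.mp hxP ρ hρ
    have hyint : ∀ᶠ z in 𝓝 y, z ∈ P ∧ ‖z - x‖ < ρ := by
      have hyP : ∀ᶠ z in 𝓝 y, z ∈ P := mem_interior_iff_mem_nhds.mp hy
      refine hyP.and ?_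
      have : Metric.ball x ρ ∈ 𝓝 y := Metric.isOpen_ball.mem_nhds (by rwa [Metric.mem_ball, dist_comm])
      filter_upwards [this] with z hz
      rwa [← dist_eq_norm]
    have hz0 : ∀ᶠ z in 𝓝 y, inner ℝ e (z - x) = 0 := by
      filter_upwards [hyint] with z hz
      have hzP : x + (z - x) ∈ P := by rw [add_sub_cancel]; exact hz.1
      rcases lt_trichotomy (inner ℝ e (z - x)) 0 with h3 | h3 | h3
      · exact absurd ((hneg _ hz.2 h3).mp hzP) h2
      · exact h3
      · exact absurd ((hpos _ hz.2 h3).mp hzP) h1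
    have h3 : Tendsto (fun t : ℝ => y + t • e) (𝓝[>] 0) (𝓝 y) := by
      have : Tendsto (fun t : ℝ => y + t • e) (𝓝 0) (𝓝 (y + (0 : ℝ) • e)) :=
        (Continuous.tendsto (by fun_prop) _)
      rw [zero_smul, add_zero] at this
      exact this.mono_left nhdsWithin_le_nhds
    obtain ⟨t, ht, ht0⟩ := ((h3.eventually hz0).and self_mem_nhdsWithin).exists
    have hy0 := hz0.self_of_nhds
    rw [inner_sub_right, inner_add_right, inner_smul_right, hee] at ht
    rw [inner_sub_right] at hy0
    have ht0 : 0 < t := ht0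
    linarith

/-- The skeleton is a bounded subset of finitely many lines, the intersections of two of the
describing planes. -/
theorem IsPolyhedron.hausdorffMeasure_skeleton_ne_top {P : Set E3} (hP : IsPolyhedron P) :
    Measure.hausdorffMeasure 1 (skeleton P) ≠ ⊤ := by
  obtain ⟨A, hA, hA0, h⟩ := hP.isSemilinear
  obtain ⟨R, hR⟩ := hP.isCompact.isBounded.exists_norm_le
  have hsub : skeleton P ⊆ ⋃ p ∈ {p ∈ A ×ˢ A | LinearIndependent ℝ ![p.1.1, p.2.1]},
      {x ∈ P | inner ℝ p.1.1 x = p.1.2 ∧ inner ℝ p.2.1 x = p.2.2} := by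
    intro x hx
    obtain ⟨a, ha, b, hb, hax, hbx, hab⟩ := h.exists_linearIndependent hA hA0
      hP.closure_interior hx
    exact mem_biUnion (x := (a, b)) ⟨⟨ha, hb⟩, hab⟩
      ⟨hP.isCompact.isClosed.frontier_subset hx.1, hax, hbx⟩
  refine ne_top_of_le_ne_top ?_ (measure_mono hsub)
  refine (measure_biUnion_lt_top ((hA.prod hA).subset fun p hp => hp.1) ?_).ne
  rintro ⟨a, b⟩ ⟨-, hab⟩
  obtain ⟨τ, hτ, haτ, hbτ, hspan⟩ := exists_unit_spanning_orthogonal hab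
  rcases eq_empty_or_nonempty {x ∈ P | inner ℝ a.1 x = a.2 ∧ inner ℝ b.1 x = b.2} with h0 | ⟨o, ho⟩
  · simp only [h0, measure_empty, ENNReal.zero_lt_top]
  · have hR0 : 0 ≤ R := (norm_nonneg o).trans (hR o ho.1)
    calc _ ≤ Measure.hausdorffMeasure 1
          ((fun s : ℝ => o + s • τ) '' Icc (-(2 * R)) (2 * R)) := by
          refine measure_mono fun x hx => ⟨inner ℝ τ (x - o), ?_, ?_⟩
          · rw [mem_Icc, ← abs_le]
            calc |inner ℝ τ (x - o)| ≤ ‖τ‖ * ‖x - o‖ := abs_real_inner_le_norm _ _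
              _ ≤ 1 * (‖x‖ + ‖o‖) := by rw [hτ]; gcongr; exact norm_sub_le _ _
              _ ≤ 2 * R := by linarith [hR x hx.1, hR o ho.1]
          · simp only
            rw [← hspan (x - o) (by rw [inner_sub_right, hx.2.1, ho.2.1, sub_self])
              (by rw [inner_sub_right, hx.2.2, ho.2.2, sub_self]), add_sub_cancel]
      _ < ⊤ := by
          rw [hausdorffMeasure_line_Icc _ _ (by linarith)]
          exact ENNReal.ofReal_lt_top

/-! ### Compact semilinear sets are finite unions of polytopes -/
/-- The closed cell of a sign vector `σ`: the points at which the affine functions satisfy the weak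
inequalities given by `σ`. -/
def closedCell (A : Set (E3 × ℝ)) (σ : A → SignType) : Set E3 :=
  {y | ∀ a : A, (σ a = 0 → inner ℝ a.1.1 y = a.1.2) ∧ (σ a = 1 → a.1.2 ≤ inner ℝ a.1.1 y) ∧
    (σ a = -1 → inner ℝ a.1.1 y ≤ a.1.2)}

theorem isClosed_closedCell (A : Set (E3 × ℝ)) (σ : A → SignType) :
    IsClosed (closedCell A σ) := by
  have : closedCell A σ = ⋂ a : A, {y | (σ a = 0 → inner ℝ a.1.1 y = a.1.2) ∧
      (σ a = 1 → a.1.2 ≤ inner ℝ a.1.1 y) ∧ (σ a = -1 → inner ℝ a.1.1 y ≤ a.1.2)} := by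
    ext y; simp [closedCell]
  rw [this]
  refine isClosed_iInter fun a => ?_
  rcases SignType.trichotomy (σ a) with h | h | h
  · simpa [h] using isClosed_le (by fun_prop : Continuous fun y : E3 => inner ℝ a.1.1 y)
      continuous_const
  · simpa [h] using isClosed_eq (by fun_prop : Continuous fun y : E3 => inner ℝ a.1.1 y)
      continuous_const
  · simpa [h] using isClosed_le continuous_const
      (by fun_prop : Continuous fun y : E3 => inner ℝ a.1.1 y)

theorem convex_closedCell (A : Set (E3 × ℝ)) (σ : A → SignType) : Convex ℝ (closedCell A σ) := by
  intro x hx y hy s t hs ht hst a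
  have hval : inner ℝ a.1.1 (s • x + t • y) = s * inner ℝ a.1.1 x + t * inner ℝ a.1.1 y := by
    rw [inner_add_right, inner_smul_right, inner_smul_right]
  have hβ : a.1.2 = s * a.1.2 + t * a.1.2 := by rw [← add_mul, hst, one_mul]
  rw [hval]
  refine ⟨fun h => ?_, fun h => ?_, fun h => ?_⟩
  · rw [(hx a).1 h, (hy a).1 h, ← hβ]
  · nlinarith [mul_le_mul_of_nonneg_left ((hx a).2.1 h) hs,
      mul_le_mul_of_nonneg_left ((hy a).2.1 h) ht]
  · nlinarith [mul_le_mul_of_nonneg_left ((hx a).2.2 h) hs,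
      mul_le_mul_of_nonneg_left ((hy a).2.2 h) ht]

/-- An extreme point is determined by the signs of the affine functions at this point: otherwise the
segment between two such points could be prolonged. -/
theorem finite_extremePoints_closedCell {A : Set (E3 × ℝ)} (hA : A.Finite) (σ : A → SignType) :
    ((closedCell A σ).extremePoints ℝ).Finite := by
  have := hA.to_subtype
  refine Set.Finite.of_finite_image (f := fun x (a : A) => SignType.sign (inner ℝ a.1.1 x - a.1.2))
    (Set.toFinite _) ?_
  intro x hx y hy hxy
  by_contra hne
  have hxy' : ∀ a : A, SignType.sign (inner ℝ a.1.1 x - a.1.2) =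
      SignType.sign (inner ℝ a.1.1 y - a.1.2) := fun a => congrFun hxy a
  have h1 : Tendsto (fun t : ℝ => t • (x - y)) (𝓝[>] 0) (𝓝 0) := by
    have : Tendsto (fun t : ℝ => t • (x - y)) (𝓝 0) (𝓝 ((0 : ℝ) • (x - y))) :=
      (Continuous.tendsto (by fun_prop) _)
    rw [zero_smul] at this
    exact this.mono_left nhdsWithin_le_nhds
  obtain ⟨t, ht, ht0⟩ := ((h1.eventually (eventually_sign_eq hA x)).and self_mem_nhdsWithin).exists
  have ht0 : 0 < t := ht0
  have hxK := extremePoints_subset hx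
  have hyK := extremePoints_subset hy
  have hz : x + t • (x - y) ∈ closedCell A σ := by
    intro a
    by_cases hxa : inner ℝ a.1.1 x = a.1.2
    · have hya : inner ℝ a.1.1 y = a.1.2 := by
        have := hxy' a
        rw [hxa, sub_self, sign_zero, eq_comm, sign_eq_zero_iff] at this
        linarith
      have : inner ℝ a.1.1 (x + t • (x - y)) = a.1.2 := by
        rw [inner_add_right, inner_smul_right, inner_sub_right, hxa, hya]; ring
      exact ⟨fun _ => this, fun _ => this.ge, fun _ => this.le⟩
    · have hs := ht a.1 a.2 hxa
      refine ⟨fun h => absurd ((hxK a).1 h) hxa, fun h => ?_, fun h => ?_⟩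
      · have h2 : 0 < inner ℝ a.1.1 x - a.1.2 :=
          sub_pos.mpr (lt_of_le_of_ne ((hxK a).2.1 h) (Ne.symm hxa))
        rw [sign_pos h2, sign_eq_one_iff] at hs
        linarith
      · have h2 : inner ℝ a.1.1 x - a.1.2 < 0 :=
          sub_neg.mpr (lt_of_le_of_ne ((hxK a).2.2 h) hxa)
        rw [sign_neg h2, sign_eq_neg_one_iff] at hs
        linarith
  have hmem : x ∈ openSegment ℝ y (x + t • (x - y)) := by
    refine ⟨t / (1 + t), 1 / (1 + t), by positivity, by positivity, by field_simp; ring, ?_⟩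
    have h3 : (1 + t) ≠ 0 := by positivity
    have h4 : (1 + t) • ((t / (1 + t)) • y + (1 / (1 + t)) • (x + t • (x - y))) = (1 + t) • x := by
      rw [smul_add, smul_smul, smul_smul, mul_div_cancel₀ _ h3, mul_div_cancel₀ _ h3]
      module
    exact smul_right_injective _ h3 h4
  exact hne ((mem_extremePoints.mp hx).2 y hyK _ hz hmem).1.symm

/-- A compact Boolean combination of half-spaces is a finite union of polytopes, namely of the
closures of the cells that it contains. -/
theorem IsSemilinear.exists_finite_union {P : Set E3} (h : IsSemilinear P) (hP : IsCompact P) :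
    ∃ S : Set (Set E3), S.Finite ∧ (∀ C ∈ S, ∃ s : Set E3, s.Finite ∧ C = convexHull ℝ s) ∧
      P = ⋃₀ S := by
  obtain ⟨A, hA, -, h⟩ := h
  have := hA.to_subtype
  set σ : E3 → A → SignType := fun x a => SignType.sign (inner ℝ a.1.1 x - a.1.2) with hσ
  have hself : ∀ x, x ∈ closedCell A (σ x) := by
    intro x a
    refine ⟨fun h => ?_, fun h => ?_, fun h => ?_⟩
    · rw [hσ, sign_eq_zero_iff] at h; linarith
    · rw [hσ, sign_eq_one_iff] at h; linarith
    · rw [hσ, sign_eq_neg_one_iff] at h; linarith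
  -- On the half-open segment from `x` to a point `y` of its closed cell the signs are those at `x`;
  -- as `P` is closed, `y` belongs to `P`.
  have hsub : ∀ x ∈ P, closedCell A (σ x) ⊆ P := by
    intro x hx y hy
    have hmem : ∀ t : ℝ, t ∈ Ico (0 : ℝ) 1 → x + t • (y - x) ∈ P := by
      intro t ht
      refine (h x _ fun a ha => ?_).mp hx
      have hval : inner ℝ a.1 (x + t • (y - x)) - a.2 =
          (1 - t) * (inner ℝ a.1 x - a.2) + t * (inner ℝ a.1 y - a.2) := by
        rw [inner_add_right, inner_smul_right, inner_sub_right]; ring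
      have hya := hy ⟨a, ha⟩
      simp only [hσ] at hya
      rw [hval]
      rcases lt_trichotomy (inner ℝ a.1 x - a.2) 0 with h1 | h1 | h1
      · rw [sign_neg h1, sign_neg]
        nlinarith [hya.2.2 (sign_neg h1), ht.1, ht.2]
      · rw [h1, hya.1 (by rw [h1, sign_zero])]; simp
      · rw [sign_pos h1, sign_pos]
        nlinarith [hya.2.1 (sign_pos h1), ht.1, ht.2]
    have hlim : Tendsto (fun t : ℝ => x + t • (y - x)) (𝓝[<] 1) (𝓝 y) := by
      have : Tendsto (fun t : ℝ => x + t • (y - x)) (𝓝 1) (𝓝 (x + (1 : ℝ) • (y - x))) :=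
        (Continuous.tendsto (by fun_prop) _)
      rw [one_smul, add_sub_cancel] at this
      exact this.mono_left nhdsWithin_le_nhds
    refine hP.isClosed.mem_of_tendsto hlim ?_
    filter_upwards [Ico_mem_nhdsLT (show (0 : ℝ) < 1 by norm_num)] with t ht
    exact hmem t ht
  refine ⟨(fun x => closedCell A (σ x)) '' P, ?_, ?_, ?_⟩
  · refine (Set.finite_range fun s : A → SignType => closedCell A s).subset ?_
    rintro _ ⟨x, -, rfl⟩
    exact ⟨σ x, rfl⟩
  · rintro _ ⟨x, hx, rfl⟩
    refine ⟨_, finite_extremePoints_closedCell hA (σ x), ?_⟩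
    have hc : IsCompact (closedCell A (σ x)) :=
      hP.of_isClosed_subset (isClosed_closedCell A _) (hsub x hx)
    have := closure_convexHull_extremePoints hc (convex_closedCell A (σ x))
    rwa [((finite_extremePoints_closedCell hA (σ x)).isCompact_convexHull ℝ).isClosed.closure_eq,
      eq_comm] at this
  · apply Subset.antisymm
    · exact fun x hx => mem_sUnion.mpr ⟨_, ⟨x, hx, rfl⟩, hself x⟩
    · rintro y ⟨_, ⟨x, hx, rfl⟩, hy⟩
      exact hsub x hx hy

/-! ### The polyhedron near an exposed face -/

/-- A face has only one half-space, and it is the half-space of all flat points of the face. -/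
theorem exists_isFaceHalfspace {P G : Set E3} (hG : G ∈ faces P) :
    ∃ n c, IsFaceHalfspace P G n c ∧ (∀ y ∈ G, y ∈ flatPoints P → IsHalfspaceAt P y n c) ∧
      ∀ m d, IsFaceHalfspace P G m d → m = n ∧ d = c := by
  obtain ⟨x, hx, rfl⟩ := hG
  have hx' := hx
  obtain ⟨n, c, hn⟩ := hx'
  have hall : ∀ y ∈ connectedComponentIn (flatPoints P) x, IsHalfspaceAt P y n c := fun y hy =>
    hn.of_isPreconnected isPreconnected_connectedComponentIn (connectedComponentIn_subset _ _)
      (mem_connectedComponentIn hx) hy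
  have hall' : ∀ y ∈ closure (connectedComponentIn (flatPoints P) x), y ∈ flatPoints P →
      IsHalfspaceAt P y n c := fun y hy hyf =>
    hall y (mem_connectedComponentIn_of_mem_closure hyf hy)
  refine ⟨n, c, ⟨?_, x, subset_closure (mem_connectedComponentIn hx), hn⟩, hall', ?_⟩
  · refine closure_minimal (fun y hy => (hall y hy).2.1) ?_
    exact isClosed_eq (by fun_prop) continuous_const
  · rintro m d ⟨-, y, hy, hym⟩
    exact (hall' y hy ⟨m, d, hym⟩).unique hym

theorem faces_eq_of_flat_mem {P G : Set E3} (hG : G ∈ faces P) {y : E3} (hy : y ∈ G)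
    (hyf : y ∈ flatPoints P) : G = closure (connectedComponentIn (flatPoints P) y) := by
  obtain ⟨x, hx, rfl⟩ := hG
  rw [connectedComponentIn_eq (mem_connectedComponentIn_of_mem_closure hyf hy)]

theorem subset_of_mem_faces {P G : Set E3} (hP : IsClosed P) (hG : G ∈ faces P) : G ⊆ P := by
  obtain ⟨x, -, rfl⟩ := hG
  exact closure_minimal ((connectedComponentIn_subset _ _).trans
    ((flatPoints_subset_frontier P).trans hP.frontier_subset)) hP

theorem exists_flat_mem_of_isOpen {P G V : Set E3} (hG : G ∈ faces P) (hV : IsOpen V)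
    (h : (G ∩ V).Nonempty) : ∃ y ∈ G ∩ V, y ∈ flatPoints P := by
  obtain ⟨x, -, rfl⟩ := hG
  obtain ⟨p, hp, hpV⟩ := h
  obtain ⟨y, hyV, hy⟩ := mem_closure_iff.mp hp V hV hpV
  exact ⟨y, ⟨subset_closure hy, hyV⟩, connectedComponentIn_subset _ _ hy⟩

theorem tendsto_add_smul_nhdsGT_zero (x v : E3) :
    Tendsto (fun t : ℝ => x + t • v) (𝓝[>] 0) (𝓝 x) := by
  have : Tendsto (fun t : ℝ => x + t • v) (𝓝 0) (𝓝 (x + (0 : ℝ) • v)) :=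
    (Continuous.tendsto (by fun_prop) _)
  rw [zero_smul, add_zero] at this
  exact this.mono_left nhdsWithin_le_nhds

theorem inner_add_smul_sub (g x y : E3) (t : ℝ) :
    inner ℝ g (x + t • (y - x)) = inner ℝ g x + t * (inner ℝ g y - inner ℝ g x) := by
  rw [inner_add_right, inner_smul_right, inner_sub_right]

/-- Where `P` is convex, the half-space of a flat point supports it. -/
theorem IsHalfspaceAt.inner_le {P U : Set E3} (hconv : Convex ℝ (U ∩ P)) {x n : E3} {c : ℝ}
    (h : IsHalfspaceAt P x n c) (hxU : x ∈ U) {y : E3} (hy : y ∈ U ∩ P) : inner ℝ n y ≤ c := by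
  by_contra! hlt
  obtain ⟨t, ht, ht0, ht1⟩ := (((tendsto_add_smul_nhdsGT_zero x (y - x)).eventually h.2.2).and
    (Ioo_mem_nhdsGT (show (0 : ℝ) < 1 by norm_num))).exists
  have hmem := (hconv.add_smul_sub_mem ⟨hxU, h.mem⟩ hy ⟨ht0.le, ht1.le⟩).2
  have := ht.mp hmem
  rw [inner_add_smul_sub, h.2.1] at this
  nlinarith

/-- The segment from a flat point to a point of its supporting plane consists of flat points, with
the possible exception of the end point. -/
theorem IsHalfspaceAt.add_smul_sub {P U : Set E3} (hU : IsOpen U) (hconv : Convex ℝ (U ∩ P))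
    {x n : E3} {c : ℝ} (h : IsHalfspaceAt P x n c) (hxU : x ∈ U) {y : E3} (hy : y ∈ U ∩ P)
    (hyn : inner ℝ n y = c) {t : ℝ} (ht : t ∈ Ico (0 : ℝ) 1) :
    IsHalfspaceAt P (x + t • (y - x)) n c := by
  set z := x + t • (y - x) with hz
  have hzC : z ∈ U ∩ P := hconv.add_smul_sub_mem ⟨hxU, h.mem⟩ hy ⟨ht.1, ht.2.le⟩
  have h1t : (0 : ℝ) < 1 - t := by linarith [ht.2]
  refine ⟨h.1, by rw [hz, inner_add_smul_sub, h.2.1, hyn]; ring, ?_⟩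
  have hlim : Tendsto (fun w : E3 => x + (1 - t)⁻¹ • (w - z)) (𝓝 z) (𝓝 x) := by
    have : Continuous fun w : E3 => x + (1 - t)⁻¹ • (w - z) := by fun_prop
    simpa using this.tendsto z
  filter_upwards [hlim.eventually (h.2.2.and (hU.mem_nhds hxU)), hU.mem_nhds hzC.1] with w hw hwU
  refine ⟨fun hwP => h.inner_le hconv hxU ⟨hwU, hwP⟩, fun hwn => ?_⟩
  have hzn : inner ℝ n z = c := by rw [hz, inner_add_smul_sub, h.2.1, hyn]; ring
  have hxP : x + (1 - t)⁻¹ • (w - z) ∈ P := by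
    refine hw.1.mpr ?_
    rw [inner_add_right, inner_smul_right, inner_sub_right, h.2.1, hzn]
    have : (1 - t)⁻¹ * (inner ℝ n w - c) ≤ 0 :=
      mul_nonpos_of_nonneg_of_nonpos (by positivity) (by linarith)
    linarith
  have := hconv ⟨hw.2, hxP⟩ hy h1t.le ht.1 (by ring)
  have heq : (1 - t) • (x + (1 - t)⁻¹ • (w - z)) + t • y = w := by
    rw [smul_add, smul_smul, mul_inv_cancel₀ h1t.ne', one_smul, hz]
    module
  rw [heq] at this
  exact this.2

theorem IsHalfspaceAt.mem_connectedComponentIn {P U : Set E3} (hU : IsOpen U)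
    (hconv : Convex ℝ (U ∩ P)) {x n : E3} {c : ℝ} (h : IsHalfspaceAt P x n c) (hxU : x ∈ U)
    {y : E3} (hy : y ∈ U ∩ P) (hyn : inner ℝ n y = c) {t : ℝ} (ht : t ∈ Ico (0 : ℝ) 1) :
    x + t • (y - x) ∈ connectedComponentIn (flatPoints P) x := by
  refine mem_connectedComponentIn_of_segment_subset ?_
  rintro z hz
  rw [segment_eq_image'] at hz
  obtain ⟨s, hs, rfl⟩ := hz
  refine ⟨n, c, ?_⟩
  simp only [add_sub_cancel_left, smul_smul]
  exact h.add_smul_sub hU hconv hxU hy hyn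
    ⟨mul_nonneg hs.1 ht.1, by nlinarith [hs.1, hs.2, ht.1, ht.2]⟩

/-- Where `P` is convex, all its points in the plane of a flat point belong to the face of that
point. -/
theorem IsHalfspaceAt.mem_closure_connectedComponentIn {P U : Set E3} (hU : IsOpen U)
    (hconv : Convex ℝ (U ∩ P)) {x n : E3} {c : ℝ} (h : IsHalfspaceAt P x n c) (hxU : x ∈ U)
    {y : E3} (hy : y ∈ U ∩ P) (hyn : inner ℝ n y = c) :
    y ∈ closure (connectedComponentIn (flatPoints P) x) := by
  have hlim : Tendsto (fun t : ℝ => x + t • (y - x)) (𝓝[<] 1) (𝓝 y) := by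
    have : Tendsto (fun t : ℝ => x + t • (y - x)) (𝓝 1) (𝓝 (x + (1 : ℝ) • (y - x))) :=
      (Continuous.tendsto (by fun_prop) _)
    rw [one_smul, add_sub_cancel] at this
    exact this.mono_left nhdsWithin_le_nhds
  refine mem_closure_of_tendsto hlim ?_
  filter_upwards [Ico_mem_nhdsLT (show (0 : ℝ) < 1 by norm_num)] with t ht
  exact h.mem_connectedComponentIn hU hconv hxU hy hyn ht

/-- A nonempty open set is not covered by finitely many planes. -/
theorem exists_mem_forall_inner_ne {T : Set (E3 × ℝ)} (hT : T.Finite) (hT0 : ∀ a ∈ T, a.1 ≠ 0)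
    {O : Set E3} (hO : IsOpen O) (hO' : O.Nonempty) : ∃ z ∈ O, ∀ a ∈ T, inner ℝ a.1 z ≠ a.2 := by
  induction T, hT using Set.Finite.induction_on generalizing O with
  | empty => exact ⟨hO'.some, hO'.some_mem, by simp⟩
  | @insert a T _ _ ih =>
    have ha : a.1 ≠ 0 := hT0 a (mem_insert _ _)
    have hopen : IsOpen (O ∩ {z | inner ℝ a.1 z ≠ a.2}) :=
      hO.inter (isOpen_ne_fun (by fun_prop) continuous_const)
    obtain ⟨z, hz⟩ := hO'
    have hne : (O ∩ {z | inner ℝ a.1 z ≠ a.2}).Nonempty := by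
      by_cases hza : inner ℝ a.1 z = a.2
      · obtain ⟨t, ht, ht0⟩ := (((tendsto_add_smul_nhdsGT_zero z a.1).eventually
          (hO.mem_nhds hz)).and self_mem_nhdsWithin).exists
        refine ⟨_, ht, ?_⟩
        have ht0 : 0 < t := ht0
        have : 0 < inner ℝ a.1 a.1 := real_inner_self_pos.mpr ha
        rw [mem_ofPred_eq, inner_add_right, inner_smul_right, hza]
        have : 0 < t * inner ℝ a.1 a.1 := by positivity
        linarith
      · exact ⟨z, hz, hza⟩
    obtain ⟨w, ⟨hwO, hwa⟩, hw⟩ := ih (fun b hb => hT0 b (mem_insert_of_mem _ hb)) hopen hne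
    refine ⟨w, hwO, fun b hb => ?_⟩
    rcases hb with rfl | hb
    · exact hwa
    · exact hw b hb

/-- From an interior point in general position, the segment to a point outside of `P` leaves `P` at
a flat point, since the other boundary points lie on finitely many lines. -/
theorem IsPolyhedron.exists_flat_mem_segment {P O : Set E3} (hP : IsPolyhedron P) (hO : IsOpen O)
    (hO' : O.Nonempty) (hOP : O ⊆ P) {y : E3} (hy : y ∉ P) :
    ∃ z ∈ O, ∃ t ∈ Ico (0 : ℝ) 1, z + t • (y - z) ∈ flatPoints P := by
  obtain ⟨A, hA, hA0, h⟩ := hP.isSemilinear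
  have hPc := hP.isCompact.isClosed
  set f : (E3 × ℝ) → E3 → ℝ := fun a x => inner ℝ a.1 x - a.2 with hf
  -- For nonparallel planes `p`, the plane `g p` contains `y` and the common line of the planes `p`;
  -- if `y` is on that line, any plane through it will do. For `z` outside of all these planes, the
  -- segment from `z` to `y` meets none of the lines before `y`.
  set g : (E3 × ℝ) × (E3 × ℝ) → E3 × ℝ := fun p =>
    if f p.1 y = 0 ∧ f p.2 y = 0 then p.1 else f p.1 y • p.2 - f p.2 y • p.1 with hg
  set I : Set ((E3 × ℝ) × (E3 × ℝ)) := {p ∈ A ×ˢ A | LinearIndependent ℝ ![p.1.1, p.2.1]} with hI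
  have hIfin : I.Finite := (hA.prod hA).subset fun p hp => hp.1
  obtain ⟨z, hzO, hz⟩ := exists_mem_forall_inner_ne (hIfin.image g) (by
    rintro _ ⟨p, ⟨hpA, hp⟩, rfl⟩
    simp only [hg]
    split_ifs with h0
    · exact hA0 _ hpA.1
    · intro h1
      have := LinearIndependent.pair_iff.mp hp (-f p.2 y) (f p.1 y) (by
        rw [neg_smul, add_comm, ← sub_eq_add_neg]; simpa using h1)
      exact h0 ⟨this.2, by simpa using this.1⟩) hO hO'
  set T : Set ℝ := Icc 0 1 ∩ (fun t : ℝ => z + t • (y - z)) ⁻¹' P with hT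
  have hTc : IsCompact T := isCompact_Icc.inter_right (hPc.preimage (by fun_prop))
  have hT0 : (0 : ℝ) ∈ T := ⟨by simp, by simpa using hOP hzO⟩
  -- `t` is the last parameter at which the segment is in `P`.
  obtain ⟨t, ht, hmax⟩ := hTc.exists_isMaxOn ⟨0, hT0⟩ continuousOn_id
  have ht1 : t < 1 := by
    refine lt_of_le_of_ne ht.1.2 fun h1 => hy ?_
    have := ht.2
    rw [h1] at this
    simpa using this
  refine ⟨z, hzO, t, ⟨ht.1.1, ht1⟩, ?_⟩
  by_contra hnf
  have hskel : z + t • (y - z) ∈ skeleton P := by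
    refine ⟨⟨subset_closure ht.2, fun hint => ?_⟩, hnf⟩
    have hcont : Tendsto (fun s : ℝ => z + s • (y - z)) (𝓝[>] t) (𝓝 (z + t • (y - z))) :=
      (Continuous.tendsto (by fun_prop) _).mono_left nhdsWithin_le_nhds
    obtain ⟨s, hs, hs'⟩ := ((hcont.eventually (mem_interior_iff_mem_nhds.mp hint)).and
      (Ioo_mem_nhdsGT ht1)).exists
    have : s ≤ t := hmax ⟨⟨ht.1.1.trans hs'.1.le, hs'.2.le⟩, hs⟩
    linarith [hs'.1]
  obtain ⟨a, ha, b, hb, hax, hbx, hab⟩ := h.exists_linearIndependent hA hA0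
    hP.closure_interior hskel
  refine hz _ ⟨(a, b), ⟨⟨ha, hb⟩, hab⟩, rfl⟩ ?_
  have h1t : (1 - t) ≠ 0 := by linarith
  have hav : (1 - t) * f a z + t * f a y = 0 := by
    rw [inner_add_smul_sub] at hax
    simp only [hf]; linarith
  have hbv : (1 - t) * f b z + t * f b y = 0 := by
    rw [inner_add_smul_sub] at hbx
    simp only [hf]; linarith
  simp only [hg]
  split_ifs with h0
  · rw [h0.1, mul_zero, add_zero] at hav
    have := (mul_eq_zero.mp hav).resolve_left h1t
    simp only [hf] at this
    linarith
  · have : (1 - t) * (f a y * f b z - f b y * f a z) = 0 := by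
      linear_combination f a y * hbv - f b y * hav
    have := (mul_eq_zero.mp this).resolve_left h1t
    simp only [Prod.fst_sub, Prod.smul_fst, Prod.snd_sub, Prod.smul_snd, inner_sub_left,
      inner_smul_left, conj_trivial, smul_eq_mul]
    simp only [hf] at this ⊢
    linarith

/-- The faces other than `F` that meet `F`. -/
abbrev NeighborFace (P F : Set E3) : Type :=
  {G : Set E3 // G ∈ faces P ∧ G ≠ F ∧ (G ∩ F).Nonempty}

theorem nonempty_of_mem_faces {P F : Set E3} (hF : F ∈ faces P) :
    ∃ x ∈ F, x ∈ flatPoints P := by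
  obtain ⟨x, hx, rfl⟩ := hF
  exact ⟨x, subset_closure (mem_connectedComponentIn hx), hx⟩

/-- A set that is convex and meets the open set `W` in a closed set `F` is contained in `F`. -/
theorem subset_of_inter_isOpen_subset {S W F : Set E3} (hS : Convex ℝ S) (hW : IsOpen W)
    (hF : IsClosed F) (hFS : F ⊆ S) (hFW : F ⊆ W) (hne : F.Nonempty) (h : S ∩ W ⊆ F) : S ⊆ F := by
  by_contra hcon
  obtain ⟨y, hyS, hyF⟩ := not_subset.mp hcon
  obtain ⟨x, hx⟩ := hne
  obtain ⟨z, hzS, hzW, hzF⟩ := hS.isPreconnected W Fᶜ hW hF.isOpen_compl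
    (fun z _ => by
      by_cases hz : z ∈ F
      · exact Or.inl (hFW hz)
      · exact Or.inr hz)
    ⟨x, hFS hx, hFW hx⟩ ⟨y, hyS, hyF⟩
  exact hzF (h ⟨hzS, hzW⟩)

/-- If a bounded open set contains the section of a closed convex set by a plane, then it contains
the part of the convex set in a thin slab around the plane. -/
theorem exists_slab_subset {K W : Set E3} (hK : Convex ℝ K) (hKc : IsClosed K) (hW : IsOpen W)
    (hWb : Bornology.IsBounded W) {n x : E3} {c : ℝ} (hx : x ∈ K) (hxn : inner ℝ n x = c)
    (h : ∀ y ∈ K, inner ℝ n y = c → y ∈ W) :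
    ∃ η > 0, ∀ y ∈ K, |inner ℝ n y - c| ≤ η → y ∈ W := by
  have hcomp : IsCompact (K ∩ frontier W) :=
    (Metric.isCompact_of_isClosed_isBounded isClosed_frontier
      ((Metric.isBounded_closure_iff.mpr hWb).subset frontier_subset_closure)).inter_left hKc
  have hη : ∃ η > 0, ∀ z ∈ K ∩ frontier W, η < |inner ℝ n z - c| := by
    rcases (K ∩ frontier W).eq_empty_or_nonempty with h0 | h0
    · exact ⟨1, one_pos, by simp [h0]⟩
    · obtain ⟨z, hz, hmin⟩ := hcomp.exists_isMinOn h0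
        (by fun_prop : ContinuousOn (fun z : E3 => |inner ℝ n z - c|) _)
      have hpos : 0 < |inner ℝ n z - c| := by
        rw [abs_pos, sub_ne_zero]
        intro hzn
        have := hz.2
        rw [hW.frontier_eq] at this
        exact this.2 (h z hz.1 hzn)
      exact ⟨|inner ℝ n z - c| / 2, by linarith, fun w hw => by
        have : |inner ℝ n z - c| ≤ |inner ℝ n w - c| := hmin hw
        linarith⟩
  obtain ⟨η, hη0, hη⟩ := hη
  refine ⟨η, hη0, fun y hy hyn => ?_⟩
  by_contra hyW
  have hseg : (segment ℝ x y ∩ frontier W).Nonempty := by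
    by_contra hemp
    rw [not_nonempty_iff_eq_empty] at hemp
    obtain ⟨z, hz, hzW, hzW'⟩ := (convex_segment x y).isPreconnected W (closure W)ᶜ hW
      isClosed_closure.isOpen_compl
      (fun z hz => by
        by_cases hzW : z ∈ W
        · exact Or.inl hzW
        · refine Or.inr fun hzc => ?_
          have : z ∈ segment ℝ x y ∩ frontier W := ⟨hz, by rw [hW.frontier_eq]; exact ⟨hzc, hzW⟩⟩
          rw [hemp] at this
          exact this)
      ⟨x, left_mem_segment ℝ x y, h x hx hxn⟩
      ⟨y, right_mem_segment ℝ x y, fun hyc => by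
        have : y ∈ segment ℝ x y ∩ frontier W :=
          ⟨right_mem_segment ℝ x y, by rw [hW.frontier_eq]; exact ⟨hyc, hyW⟩⟩
        rw [hemp] at this
        exact this⟩
    exact hzW' (subset_closure hzW)
  obtain ⟨z, hz, hzf⟩ := hseg
  have hzK := hK.segment_subset hx hy hz
  rw [segment_eq_image'] at hz
  obtain ⟨t, ht, rfl⟩ := hz
  have h1 := hη _ ⟨hzK, hzf⟩
  simp only at h1
  rw [inner_add_smul_sub, hxn, add_sub_cancel_left, abs_mul, abs_of_nonneg ht.1] at h1
  nlinarith [abs_nonneg (inner ℝ n y - c), ht.2]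

/-- The structure of a polyhedron near an exposed face: in a neighbourhood `W` of the face it is
the intersection of the half-spaces of the face and of its neighbours. -/
theorem exists_isFaceSystem {P F : Set E3} (hP : IsPolyhedron P) (hF : F ∈ faces P)
    (hexp : IsExposed P F) :
    ∃ (n : E3) (c : ℝ) (N : NeighborFace P F → E3) (b : NeighborFace P F → ℝ) (W : Set E3) (η : ℝ),
      IsFaceHalfspace P F n c ∧ (∀ i, ‖N i‖ = 1) ∧ neighborCone P F = cone N b ∧
      IsFaceSystem n c N b ∧ F = slice n c N b 0 ∧ IsOpen W ∧ F ⊆ W ∧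
      W ∩ P = W ∩ (cone N b ∩ {y | inner ℝ n y ≤ c}) ∧ 0 < η ∧
      ∀ y ∈ cone N b, |inner ℝ n y - c| ≤ η → y ∈ W := by
  obtain ⟨U, hU, hFU, hconv⟩ := hexp
  have hPc := hP.isCompact.isClosed
  have hFP := subset_of_mem_faces hPc hF
  have hFc : IsClosed F := by
    obtain ⟨x, -, rfl⟩ := hF
    exact isClosed_closure
  have hfin : (faces P).Finite := hP.isSemilinear.finite_faces
  obtain ⟨n, c, hFn, hFall, -⟩ := exists_isFaceHalfspace hF
  obtain ⟨x, hxF, hxf⟩ := nonempty_of_mem_faces hF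
  have hx := hFall x hxF hxf
  choose N b hNb hall huniq using fun G : NeighborFace P F => exists_isFaceHalfspace G.2.1
  have hNn : ∀ G, ‖N G‖ = 1 := fun G => by
    obtain ⟨-, y, -, hy⟩ := hNb G
    exact hy.1
  have hn1 : ‖n‖ = 1 := hx.1
  have hcone : neighborCone P F = cone N b := by
    ext y
    refine ⟨fun hy G => hy G.1 G.2.1 G.2.2.1 G.2.2.2 _ _ (hNb G), fun hy G hG hGF hne m d hm => ?_⟩
    obtain ⟨rfl, rfl⟩ := huniq ⟨G, hG, hGF, hne⟩ m d hm
    exact hy _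
  -- flat points of the neighbouring faces close to `F`
  have hy : ∀ G : NeighborFace P F, ∃ y ∈ U, y ∈ G.1 ∧ IsHalfspaceAt P y (N G) (b G) := by
    intro G
    obtain ⟨p, hpG, hpF⟩ := G.2.2.2
    obtain ⟨y, ⟨hyG, hyU⟩, hyf⟩ := exists_flat_mem_of_isOpen G.2.1 hU ⟨p, hpG, hFU hpF⟩
    exact ⟨y, hyU, hyG, hall G y hyG hyf⟩
  choose y hyU hyG hyN using hy
  have hsup : ∀ G, ∀ z ∈ U ∩ P, inner ℝ (N G) z ≤ b G := fun G z hz =>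
    (hyN G).inner_le hconv (hyU G) hz
  have hsupF : ∀ z ∈ U ∩ P, inner ℝ n z ≤ c := fun z hz => hx.inner_le hconv (hFU hxF) hz
  -- different faces have different half-spaces
  have hsame : ∀ {G H : Set E3} {p q m : E3} {d : ℝ}, G ∈ faces P → H ∈ faces P → p ∈ G → q ∈ H →
      p ∈ U → q ∈ U → IsHalfspaceAt P p m d → IsHalfspaceAt P q m d → G = H := by
    intro G H p q m d hG hH hpG hqH hpU hqU hp hq
    have h1 := hp.mem_closure_connectedComponentIn hU hconv hpU ⟨hqU, hq.mem⟩ hq.2.1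
    have h2 := mem_connectedComponentIn_of_mem_closure ⟨m, d, hq⟩ h1
    rw [faces_eq_of_flat_mem hG hpG ⟨m, d, hp⟩, faces_eq_of_flat_mem hH hqH ⟨m, d, hq⟩,
      connectedComponentIn_eq h2]
  have hUP : ∀ {p m q : E3} {d d' : ℝ}, p ∈ U → IsHalfspaceAt P p m d → ‖q‖ = 1 →
      (∀ z ∈ U ∩ P, inner ℝ q z ≤ d') → inner ℝ q p = d' → q = m ∧ d' = d := by
    intro p m q d d' hpU hp hq hle hpq
    refine hp.eq_of_eventually_imp hq hpq ?_
    filter_upwards [hU.mem_nhds hpU] with z hzU hzP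
    exact hle z ⟨hzU, hzP⟩
  have hxlt : ∀ G, inner ℝ (N G) x < b G := by
    intro G
    refine lt_of_le_of_ne (hsup G x ⟨hFU hxF, hFP hxF⟩) fun heq => ?_
    obtain ⟨h1, h2⟩ := hUP (hFU hxF) hx (hNn G) (hsup G) heq
    have h3 := hyN G
    rw [h1, h2] at h3
    exact G.2.2.1 (hsame G.2.1 hF (hyG G) hxF (hyU G) (hFU hxF) h3 hx)
  have hylt : ∀ G, inner ℝ n (y G) < c := by
    intro G
    refine lt_of_le_of_ne (hsupF _ ⟨hyU G, (hyN G).mem⟩) fun heq => ?_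
    obtain ⟨h1, h2⟩ := hUP (hyU G) (hyN G) hn1 hsupF heq
    have h3 := hyN G
    rw [← h1, ← h2] at h3
    exact G.2.2.1 (hsame G.2.1 hF (hyG G) hxF (hyU G) (hFU hxF) h3 hx)
  have hykt : ∀ G H, H ≠ G → inner ℝ (N H) (y G) < b H := by
    intro G H hHG
    refine lt_of_le_of_ne (hsup H _ ⟨hyU G, (hyN G).mem⟩) fun heq => hHG ?_
    obtain ⟨h1, h2⟩ := hUP (hyU G) (hyN G) (hNn H) (hsup H) heq
    have h3 := hyN G
    rw [← h1, ← h2] at h3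
    exact Subtype.ext (hsame H.2.1 G.2.1 (hyG H) (hyG G) (hyU H) (hyU G) (hyN H) h3)
  have hFplane : ∀ z ∈ U ∩ P, inner ℝ n z = c → z ∈ F := by
    intro z hz hzn
    rw [faces_eq_of_flat_mem hF hxF hxf]
    exact hx.mem_closure_connectedComponentIn hU hconv (hFU hxF) hz hzn
  -- near `F` no other half-spaces are needed
  set W₀ := U \ ⋃₀ {G ∈ faces P | G ∩ F = ∅} with hW₀
  have hW₀o : IsOpen W₀ := by
    refine hU.sdiff ?_
    rw [sUnion_eq_biUnion]
    refine (hfin.subset (sep_subset _ _)).isClosed_biUnion ?_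
    rintro _ ⟨⟨p, -, rfl⟩, -⟩
    exact isClosed_closure
  have hFW₀ : F ⊆ W₀ := by
    rintro p hp
    refine ⟨hFU hp, ?_⟩
    rintro ⟨G, ⟨-, hGF⟩, hpG⟩
    exact (hGF ▸ (⟨hpG, hp⟩ : p ∈ G ∩ F) : p ∈ (∅ : Set E3))
  have hρ : ∀ p : F, ∃ ρ > 0, ρ ≤ 1 ∧ Metric.ball (p : E3) ρ ⊆ W₀ := by
    intro p
    obtain ⟨ρ, hρ, hsub⟩ := Metric.isOpen_iff.mp hW₀o p (hFW₀ p.2)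
    exact ⟨min ρ 1, by positivity, min_le_right _ _,
      (Metric.ball_subset_ball (min_le_left _ _)).trans hsub⟩
  choose ρ hρ0 hρ1 hρsub using hρ
  set W := ⋃ p : F, Metric.ball (p : E3) (ρ p) with hW
  have hWo : IsOpen W := isOpen_iUnion fun p => Metric.isOpen_ball
  have hFW : F ⊆ W := fun p hp => mem_iUnion.mpr ⟨⟨p, hp⟩, Metric.mem_ball_self (hρ0 _)⟩
  have hWU : W ⊆ U := iUnion_subset fun p => (hρsub p).trans sdiff_subset
  have hWb : Bornology.IsBounded W := by
    obtain ⟨R, hR⟩ := hP.isCompact.isBounded.exists_norm_le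
    refine (Metric.isBounded_ball (x := (0 : E3)) (r := R + 1)).subset (iUnion_subset fun p => ?_)
    intro q hq
    rw [Metric.mem_ball, dist_eq_norm] at hq
    rw [mem_ball_zero_iff]
    calc ‖q‖ = ‖(q - p) + p‖ := by rw [sub_add_cancel]
      _ ≤ ‖q - p‖ + ‖(p : E3)‖ := norm_add_le _ _
      _ < R + 1 := by linarith [hρ1 p, hR p (hFP p.2)]
  -- A point `q` of `W` outside of `P` can be joined to an interior point `z` of `P` inside a ball
  -- of `W`. The segment leaves `P` at a flat point, whose half-space is that of `F` or of a neighbour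
  -- and contains `q`, contrary to the position of `z` in its interior.
  have hWP : W ∩ P = W ∩ (cone N b ∩ {y | inner ℝ n y ≤ c}) := by
    apply Subset.antisymm
    · rintro q ⟨hqW, hqP⟩
      exact ⟨hqW, fun G => hsup G q ⟨hWU hqW, hqP⟩, hsupF q ⟨hWU hqW, hqP⟩⟩
    · rintro q ⟨hqW, hqK, hqn⟩
      refine ⟨hqW, ?_⟩
      by_contra hqP
      obtain ⟨p, hqp⟩ := mem_iUnion.mp hqW
      have hne : (interior P ∩ Metric.ball (p : E3) (ρ p)).Nonempty := by
        have : (p : E3) ∈ closure (interior P) := by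
          rw [hP.closure_interior]; exact hFP p.2
        rw [inter_comm]
        exact mem_closure_iff.mp this _ Metric.isOpen_ball (Metric.mem_ball_self (hρ0 p))
      obtain ⟨z, ⟨hzP, hzp⟩, t, ht, hflat⟩ := hP.exists_flat_mem_segment
        (isOpen_interior.inter Metric.isOpen_ball) hne
        (inter_subset_left.trans interior_subset) hqP
      set w := z + t • (q - z) with hw
      have hwB : w ∈ Metric.ball (p : E3) (ρ p) :=
        (convex_ball _ _).add_smul_sub_mem hzp hqp ⟨ht.1, ht.2.le⟩
      have hwU : w ∈ U := (hρsub p hwB).1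
      have hflat' := hflat
      obtain ⟨m, d, hwm⟩ := hflat'
      have hm : inner ℝ m q ≤ d := by
        set G := closure (connectedComponentIn (flatPoints P) w) with hG
        have hGf : G ∈ faces P := ⟨w, hflat, rfl⟩
        have hwG : w ∈ G := subset_closure (mem_connectedComponentIn hflat)
        by_cases hGF : G = F
        · have := hFall w (hGF ▸ hwG) hflat
          obtain ⟨rfl, rfl⟩ := this.unique hwm
          exact hqn
        · have hmeet : (G ∩ F).Nonempty := by
            by_contra hemp
            exact (hρsub p hwB).2 ⟨G, ⟨hGf, not_nonempty_iff_eq_empty.mp hemp⟩, hwG⟩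
          have := hall ⟨G, hGf, hGF, hmeet⟩ w hwG hflat
          obtain ⟨rfl, rfl⟩ := this.unique hwm
          exact hqK _
      have hmz : inner ℝ m z < d := by
        have hev : U ∩ P ∈ 𝓝 z :=
          inter_mem (hU.mem_nhds (hρsub p hzp).1) (mem_interior_iff_mem_nhds.mp hzP)
        obtain ⟨s, hs, hs0⟩ := (((tendsto_add_smul_nhdsGT_zero z m).eventually hev).and
          self_mem_nhdsWithin).exists
        have hs0 : 0 < s := hs0
        have := hwm.inner_le hconv hwU hs
        rw [inner_add_right, inner_smul_right, real_inner_self_eq_norm_sq, hwm.1] at this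
        linarith
      have := hwm.2.1
      rw [hw, inner_add_smul_sub] at this
      nlinarith [ht.1, ht.2]
  have hxs : x ∈ slice n c N b 0 := ⟨fun G => (hxlt G).le, by rw [hx.2.1, add_zero]⟩
  have hFs : F = slice n c N b 0 := by
    apply Subset.antisymm
    · intro p hp
      exact ⟨fun G => hsup G p ⟨hFU hp, hFP hp⟩, by rw [add_zero]; exact hFn.1 hp⟩
    · refine subset_of_inter_isOpen_subset (convex_slice n c N b 0) hWo hFc ?_ hFW ⟨x, hxF⟩ ?_
      · intro p hp
        exact ⟨fun G => hsup G p ⟨hFU hp, hFP hp⟩, by rw [add_zero]; exact hFn.1 hp⟩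
      · rintro p ⟨⟨hpK, hpn⟩, hpW⟩
        rw [add_zero] at hpn
        have : p ∈ W ∩ P := by rw [hWP]; exact ⟨hpW, hpK, hpn.le⟩
        exact hFplane p ⟨hWU hpW, this.2⟩ hpn
  obtain ⟨η, hη, hslab⟩ := exists_slab_subset (convex_cone N b) (isClosed_cone N b) hWo hWb
    (n := n) (c := c) hxs.1 hx.2.1 fun q hq hqn => hFW (hFs ▸ ⟨hq, by rw [hqn, add_zero]⟩)
  refine ⟨n, c, N, b, W, η, hFn, hNn, hcone, ⟨hn1, ⟨x, hx.2.1, hxlt⟩,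
    fun G => ⟨y G, hylt G, (hyN G).2.1, hykt G⟩, fun G => ?_, η, hη,
    hWb.subset fun q hq => hslab q hq.1 hq.2⟩, hFs, hWo, hFW, hWP, hη, hslab⟩
  obtain ⟨p, hpG, hpF⟩ := G.2.2.2
  exact ⟨p, hFn.1 hpF, (hNb G).1 hpG, fun H => hsup H p ⟨hFU hpF, hFP hpF⟩⟩

/-! ### Volumes of slabs of a convex set -/

/-- Splitting a vector into its component along the unit vector `n` and its component orthogonal
to `n`. -/
noncomputable def heightEquiv {n : E3} (hn : ‖n‖ = 1) : E3 ≃L[ℝ] ℝ × (ℝ ∙ n)ᗮ :=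
  LinearEquiv.toContinuousLinearEquiv
    { toFun := fun y => (inner ℝ n y, (ℝ ∙ n)ᗮ.orthogonalProjectionOnto y)
      map_add' := fun x y => by simp [inner_add_right]
      map_smul' := fun r y => by simp [inner_smul_right]
      invFun := fun p => p.1 • n + (p.2 : E3)
      left_inv := fun y => by
        have h := (ℝ ∙ n).starProjection_add_starProjection_orthogonal y
        rw [Submodule.starProjection_unit_singleton ℝ hn] at h
        exact h
      right_inv := fun p => by
        have h₁ : inner ℝ n (p.2 : E3) = 0 := Submodule.mem_orthogonal_singleton_iff_inner_right.mp p.2.2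
        have h₂ : (ℝ ∙ n)ᗮ.orthogonalProjectionOnto n = 0 := by
          apply Submodule.orthogonalProjectionOnto_apply_of_mem_orthogonal
          simp
        ext1
        · simp [inner_add_right, inner_smul_right, h₁, hn]
        · simp [h₂] }

theorem heightEquiv_apply_fst {n : E3} (hn : ‖n‖ = 1) (y : E3) :
    (heightEquiv hn y).1 = inner ℝ n y := rfl

theorem heightEquiv_symm_apply {n : E3} (hn : ‖n‖ = 1) (r : ℝ) (v : (ℝ ∙ n)ᗮ) :
    (heightEquiv hn).symm (r, v) = r • n + (v : E3) := rfl

theorem inner_heightEquiv_symm {n : E3} (hn : ‖n‖ = 1) (p : ℝ × (ℝ ∙ n)ᗮ) :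
    inner ℝ n ((heightEquiv hn).symm p) = p.1 := by
  rw [← heightEquiv_apply_fst hn, ContinuousLinearEquiv.apply_symm_apply]

/-- Cavalieri's principle for planes orthogonal to `n`, up to a positive factor. -/
theorem exists_volume_eq_lintegral {n : E3} (hn : ‖n‖ = 1) :
    ∃ κ : NNReal, ∀ T : Set E3, MeasurableSet T →
      volume T = κ * ∫⁻ r : ℝ, volume {v : (ℝ ∙ n)ᗮ | r • n + (v : E3) ∈ T} := by
  set e := heightEquiv hn
  have hH : (volume.map e).IsAddHaarMeasure := e.isAddHaarMeasure_map volume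
  refine ⟨Measure.addHaarScalarFactor (volume.map e) (volume.prod volume), fun T hT => ?_⟩
  have h1 : volume.map e = Measure.addHaarScalarFactor (volume.map e) (volume.prod volume) •
      (volume.prod volume : Measure (ℝ × (ℝ ∙ n)ᗮ)) := Measure.isAddLeftInvariant_eq_smul _ _
  have hT' : MeasurableSet (e.symm ⁻¹' T) := e.symm.continuous.measurable hT
  have h2 : volume T = volume.map e (e.symm ⁻¹' T) := by
    rw [Measure.map_apply e.continuous.measurable hT', ← preimage_comp]
    simp
  have h3 := congrArg (fun m : Measure (ℝ × (ℝ ∙ n)ᗮ) => m (e.symm ⁻¹' T)) h1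
  simp only [Measure.smul_apply, Measure.prod_apply hT', ENNReal.smul_def, smul_eq_mul] at h3
  rw [h2, h3]
  rfl

/-- The area of the sections of a closed convex set is locally bounded, and continuous at a level that
contains an interior point: on that level the indicator functions of the sections converge away
from the relative boundary of the section, which has measure zero. -/
theorem tendsto_volume_section {S : Set E3} (hS : Convex ℝ S) (hSc : IsClosed S) {n : E3}
    (hn : ‖n‖ = 1) {c η : ℝ} (hη : 0 < η) (hb : Bornology.IsBounded (S ∩ {y | |inner ℝ n y - c| ≤ η}))
    {x : E3} (hx : x ∈ interior S) (hxc : inner ℝ n x = c) :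
    ∃ R : ENNReal, R ≠ ⊤ ∧ (∀ r, |r - c| ≤ η → volume {v : (ℝ ∙ n)ᗮ | r • n + (v : E3) ∈ S} ≤ R) ∧
      Tendsto (fun r : ℝ => volume {v : (ℝ ∙ n)ᗮ | r • n + (v : E3) ∈ S}) (𝓝 c)
        (𝓝 (volume {v : (ℝ ∙ n)ᗮ | c • n + (v : E3) ∈ S})) := by
  set e := heightEquiv hn
  have hcont : ∀ r : ℝ, Continuous fun v : (ℝ ∙ n)ᗮ => r • n + (v : E3) := fun r => by fun_prop
  have hclosed : ∀ r : ℝ, IsClosed {v : (ℝ ∙ n)ᗮ | r • n + (v : E3) ∈ S} := fun r =>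
    hSc.preimage (hcont r)
  obtain ⟨M, hM⟩ := hb.subset_closedBall (0 : E3)
  have hsub : ∀ r, |r - c| ≤ η → {v : (ℝ ∙ n)ᗮ | r • n + (v : E3) ∈ S} ⊆
      Metric.closedBall 0 (M + (|c| + η)) := by
    intro r hr v hv
    have h1 : r • n + (v : E3) ∈ Metric.closedBall (0 : E3) M := by
      refine hM ⟨hv, ?_⟩
      have := inner_heightEquiv_symm hn (r, v)
      rw [heightEquiv_symm_apply] at this
      simpa [this] using hr
    rw [mem_closedBall_zero_iff] at h1 ⊢
    have h2 : ‖(v : E3)‖ ≤ ‖r • n + (v : E3)‖ + ‖r • n‖ := by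
      have := norm_sub_le (r • n + (v : E3)) (r • n)
      simpa using this
    have h3 : ‖r • n‖ ≤ |c| + η := by
      rw [norm_smul, hn, mul_one, Real.norm_eq_abs]
      have := abs_sub_abs_le_abs_sub r c
      linarith
    rw [Submodule.coe_norm]
    linarith
  refine ⟨volume (Metric.closedBall (0 : (ℝ ∙ n)ᗮ) (M + (|c| + η))),
    measure_closedBall_lt_top.ne, fun r hr => measure_mono (hsub r hr), ?_⟩
  have hnear : ∀ᶠ r in 𝓝 c, |r - c| ≤ η := by
    filter_upwards [Metric.closedBall_mem_nhds c hη] with r hr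
    simpa [Real.dist_eq] using hr
  refine tendsto_measure_of_ae_tendsto_indicator (𝓝 c) (hclosed c).measurableSet
    (fun r => (hclosed r).measurableSet) (B := Metric.closedBall (0 : (ℝ ∙ n)ᗮ) (M + (|c| + η)))
    Metric.isClosed_closedBall.measurableSet measure_closedBall_lt_top.ne
    (hnear.mono hsub) ?_
  have hconv : Convex ℝ {v : (ℝ ∙ n)ᗮ | c • n + (v : E3) ∈ S} := by
    have : {v : (ℝ ∙ n)ᗮ | c • n + (v : E3) ∈ S} =
        ((ℝ ∙ n)ᗮ.subtype) ⁻¹' ((fun y => c • n + y) ⁻¹' S) := rfl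
    rw [this]
    exact (hS.translate_preimage_right _).linear_preimage _
  have hfr : ∀ᵐ v : (ℝ ∙ n)ᗮ, v ∉ frontier {v : (ℝ ∙ n)ᗮ | c • n + (v : E3) ∈ S} :=
    measure_eq_zero_iff_ae_notMem.mp (hconv.addHaar_frontier volume)
  filter_upwards [hfr] with v hv
  have hcr : Tendsto (fun r : ℝ => r • n + (v : E3)) (𝓝 c) (𝓝 (c • n + (v : E3))) := by
    have : Continuous fun r : ℝ => r • n + (v : E3) := by fun_prop
    exact this.tendsto c
  by_cases hvS : c • n + (v : E3) ∈ S
  · have hvi : v ∈ interior {v : (ℝ ∙ n)ᗮ | c • n + (v : E3) ∈ S} := by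
      by_contra hvi
      exact hv ⟨subset_closure hvS, hvi⟩
    obtain ⟨w, hw⟩ : ∃ w : (ℝ ∙ n)ᗮ, x = c • n + (w : E3) := by
      refine ⟨(e x).2, ?_⟩
      have : e.symm (e x) = x := e.symm_apply_apply x
      have h1 : e.symm (e x) = (e x).1 • n + ((e x).2 : E3) := heightEquiv_symm_apply hn _ _
      rw [← hxc, ← heightEquiv_apply_fst hn, ← h1, this]
    -- extend the segment from `x` beyond `v` inside the section
    have hlim : Tendsto (fun s : ℝ => v + s • (v - w)) (𝓝[>] 0) (𝓝 v) := by
      have : Continuous fun s : ℝ => v + s • (v - w) := by fun_prop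
      have h0 := this.tendsto 0
      simp only [zero_smul, add_zero] at h0
      exact h0.mono_left nhdsWithin_le_nhds
    obtain ⟨s, hs, hs0⟩ := ((hlim.eventually (mem_interior_iff_mem_nhds.mp hvi)).and
      self_mem_nhdsWithin).exists
    have hs0 : (0 : ℝ) < s := hs0
    have hint : c • n + (v : E3) ∈ interior S := by
      have h1 := hS.combo_interior_self_mem_interior hx (show _ ∈ S from hs)
        (a := s / (1 + s)) (b := 1 / (1 + s)) (by positivity) (by positivity)
        (by field_simp; ring)
      convert h1 using 1
      rw [hw]
      have h1s : (1 + s) ≠ 0 := by positivity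
      have hv1 : c • n + (v : E3) = (1 / (1 + s)) • ((1 + s) • (c • n + (v : E3))) := by
        rw [smul_smul]; field_simp; simp
      rw [hv1]
      simp only [Submodule.coe_add, Submodule.coe_smul, Submodule.coe_sub]
      rw [show s / (1 + s) = 1 / (1 + s) * s by ring, mul_smul, ← smul_add]
      congr 1
      module
    filter_upwards [hcr.eventually (mem_interior_iff_mem_nhds.mp hint)] with r hr
    exact ⟨fun _ => hvS, fun _ => hr⟩
  · filter_upwards [hcr.eventually (hSc.isOpen_compl.mem_nhds hvS)] with r hr
    exact ⟨fun h => (hr h).elim, fun h => (hvS h).elim⟩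

/-- The volume of the part of a closed convex set between two parallel planes is a differentiable
function of the position of the upper plane, when that plane meets the interior: the derivative is
proportional to the area of the section. -/
theorem exists_hasDerivAt_volume_slab {S : Set E3} (hS : Convex ℝ S) (hSc : IsClosed S) {n : E3}
    (hn : ‖n‖ = 1) {c η δ : ℝ} (hη : 0 < η) (hδ : 0 < δ) (hδη : δ ≤ η)
    (hb : Bornology.IsBounded (S ∩ {y | |inner ℝ n y - c| ≤ η}))
    {x : E3} (hx : x ∈ interior S) (hxc : inner ℝ n x = c) :
    ∃ A : ℝ, HasDerivAt
      (fun t => (volume (S ∩ {y | c - δ < inner ℝ n y ∧ inner ℝ n y ≤ c + t})).toReal) A 0 := by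
  obtain ⟨κ, hκ⟩ := exists_volume_eq_lintegral hn
  obtain ⟨R, hR, hle, htend⟩ := tendsto_volume_section hS hSc hn hη hb hx hxc
  set a : ℝ → ENNReal := fun r => volume {v : (ℝ ∙ n)ᗮ | r • n + (v : E3) ∈ S} with ha
  have hmeas : Measurable a := by
    have : MeasurableSet ((heightEquiv hn).symm ⁻¹' S) :=
      (heightEquiv hn).symm.continuous.measurable hSc.measurableSet
    exact measurable_measure_prodMk_left this
  have hfin : ∀ r, |r - c| ≤ η → a r ≠ ⊤ := fun r hr => ((hle r hr).trans_lt hR.lt_top).ne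
  have hac : ContinuousAt (fun r => (a r).toReal) c :=
    (ENNReal.tendsto_toReal (hfin c (by simpa using hη.le))).comp htend
  have hii : ∀ t, |t| ≤ η → IntervalIntegrable (fun r => (a r).toReal) volume (c - δ) (c + t) := by
    intro t ht
    refine IntervalIntegrable.mono_fun' (g := fun _ => R.toReal) intervalIntegrable_const
      hmeas.ennreal_toReal.aestronglyMeasurable ?_
    refine (ae_restrict_mem measurableSet_uIoc).mono fun r hr => ?_
    simp only [Real.norm_of_nonneg ENNReal.toReal_nonneg]
    refine ENNReal.toReal_mono hR (hle r ?_)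
    rw [abs_le] at ht ⊢
    rcases mem_uIoc.mp hr with h | h <;> constructor <;> linarith [h.1, h.2]
  have hderiv := intervalIntegral.integral_hasDerivAt_right (hii 0 (by simpa using hη.le))
    (hmeas.ennreal_toReal.stronglyMeasurable.stronglyMeasurableAtFilter)
    (by simpa using hac)
  have hderiv' : HasDerivAt (fun t => κ * ∫ r in (c - δ)..(c + t), (a r).toReal)
      (κ * (a (c + 0)).toReal) 0 := (hderiv.comp_const_add c 0).const_mul _
  refine ⟨_, hderiv'.congr_of_eventuallyEq ?_⟩
  have hnear : ∀ᶠ t : ℝ in 𝓝 0, |t| ≤ δ := by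
    filter_upwards [Metric.closedBall_mem_nhds (0 : ℝ) hδ] with r hr
    simpa [Real.dist_eq] using hr
  filter_upwards [hnear] with t ht
  have hmT : MeasurableSet (S ∩ {y | c - δ < inner ℝ n y ∧ inner ℝ n y ≤ c + t}) := by
    refine hSc.measurableSet.inter ?_
    have hm : Measurable fun y : E3 => inner ℝ n y := by fun_prop
    exact (measurableSet_lt measurable_const hm).inter (measurableSet_le hm measurable_const)
  have hsec : ∀ r, volume {v : (ℝ ∙ n)ᗮ | r • n + (v : E3) ∈
      S ∩ {y | c - δ < inner ℝ n y ∧ inner ℝ n y ≤ c + t}} = (Ioc (c - δ) (c + t)).indicator a r := by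
    intro r
    have h0 : ∀ v : (ℝ ∙ n)ᗮ, inner ℝ n (r • n + (v : E3)) = r := fun v => by
      simpa [heightEquiv_symm_apply] using inner_heightEquiv_symm hn (r, v)
    by_cases hr : r ∈ Ioc (c - δ) (c + t)
    · rw [indicator_of_mem hr]
      congr 1
      ext v
      exact ⟨fun h => h.1, fun h => ⟨h, by simp only [mem_ofPred_eq, h0]; exact hr⟩⟩
    · rw [indicator_of_notMem hr]
      convert measure_empty (μ := volume)
      ext v
      simp only [mem_ofPred_eq, mem_inter_iff, h0, mem_empty_iff_false, iff_false]
      exact fun h => hr h.2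
  rw [hκ _ hmT, ENNReal.toReal_mul, ENNReal.coe_toReal]
  congr 1
  simp_rw [hsec]
  have hct : c - δ ≤ c + t := by have := (abs_le.mp ht).1; linarith
  rw [lintegral_indicator measurableSet_Ioc, intervalIntegral.integral_of_le hct,
    integral_toReal hmeas.aemeasurable]
  refine (ae_restrict_mem measurableSet_Ioc).mono fun r hr => (hfin r ?_).lt_top
  rw [abs_le] at ht ⊢
  constructor <;> linarith [hr.1, hr.2]

/-! ### Local nature of flat points and of the skeleton -/

theorem mem_interior_congr {P Q : Set E3} {x : E3} (h : ∀ᶠ y in 𝓝 x, (y ∈ P ↔ y ∈ Q)) :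
    x ∈ interior P ↔ x ∈ interior Q := by
  simp only [mem_interior_iff_mem_nhds]
  exact Filter.congr_sets h

theorem mem_closure_congr {P Q : Set E3} {x : E3} (h : ∀ᶠ y in 𝓝 x, (y ∈ P ↔ y ∈ Q)) :
    x ∈ closure P ↔ x ∈ closure Q := by
  simp only [mem_closure_iff_frequently]
  exact frequently_congr h

theorem mem_frontier_congr {P Q : Set E3} {x : E3} (h : ∀ᶠ y in 𝓝 x, (y ∈ P ↔ y ∈ Q)) :
    x ∈ frontier P ↔ x ∈ frontier Q := by
  simp only [frontier, Set.mem_sdiff, mem_closure_congr h, mem_interior_congr h]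

theorem mem_flatPoints_congr {P Q : Set E3} {x : E3} (h : ∀ᶠ y in 𝓝 x, (y ∈ P ↔ y ∈ Q)) :
    x ∈ flatPoints P ↔ x ∈ flatPoints Q := by
  constructor
  · rintro ⟨n, c, hn⟩
    exact ⟨n, c, hn.congr h⟩
  · rintro ⟨n, c, hn⟩
    exact ⟨n, c, hn.congr (h.mono fun y hy => hy.symm)⟩

theorem mem_skeleton_congr {P Q : Set E3} {x : E3} (h : ∀ᶠ y in 𝓝 x, (y ∈ P ↔ y ∈ Q)) :
    x ∈ skeleton P ↔ x ∈ skeleton Q := by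
  simp only [skeleton, Set.mem_sdiff, mem_frontier_congr h, mem_flatPoints_congr h]

/-- A subset of `S` that is relatively open and relatively closed contains every connected subset
of `S` that it meets. -/
theorem _root_.IsPreconnected.subset_of_eventually_iff {S A D : Set E3} (hD : IsPreconnected D)
    (hDS : D ⊆ S) (h : ∀ x ∈ S, ∀ᶠ y in 𝓝 x, y ∈ S → (y ∈ A ↔ x ∈ A)) {x : E3} (hx : x ∈ D)
    (hxA : x ∈ A) : D ⊆ A := by
  intro y hy
  have := hD.induction₂ (fun u v => u ∈ A ↔ v ∈ A) (fun u hu => ?_) (fun u v w _ _ _ => Iff.trans)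
    (fun u v _ _ => Iff.symm) hx hy
  · exact this.mp hxA
  · rw [eventually_nhdsWithin_iff]
    exact (h u (hDS hu)).mono fun y hy hyD => (hy (hDS hyD)).symm

/-- The components of the set of flat points are relatively open and closed in it. -/
theorem eventually_mem_connectedComponentIn_iff {P : Set E3} (x₀ : E3) {x : E3}
    (hx : x ∈ flatPoints P) : ∀ᶠ y in 𝓝 x, y ∈ flatPoints P →
      (y ∈ connectedComponentIn (flatPoints P) x₀ ↔ x ∈ connectedComponentIn (flatPoints P) x₀) := by
  obtain ⟨n, c, hn⟩ := hx
  have h1 := hn.eventually_of_eq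
  have h2 := hn.eventually_flat
  rw [Metric.eventually_nhds_iff_ball] at h1
  obtain ⟨r, hr, h1⟩ := h1
  filter_upwards [h2, Metric.ball_mem_nhds x hr] with y hy hyr hyf
  have hyn := hy hyf
  have hseg : segment ℝ x y ⊆ flatPoints P := by
    intro z hz
    have hz1 : z ∈ Metric.ball x r :=
      (convex_ball x r).segment_subset (Metric.mem_ball_self hr) hyr hz
    have hconv : Convex ℝ {z : E3 | inner ℝ n z = c} := convex_hyperplane (innerₗ E3 n).isLinear c
    exact ⟨n, c, h1 z hz1 (hconv.segment_subset hn.2.1 hyn.2.1 hz)⟩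
  constructor
  · intro h
    rw [connectedComponentIn_eq h]
    exact mem_connectedComponentIn_of_segment_subset (segment_symm ℝ x y ▸ hseg)
  · intro h
    rw [connectedComponentIn_eq h]
    exact mem_connectedComponentIn_of_segment_subset hseg

/-! ### The boundary of an intersection of half-spaces -/

section cone
variable {κ : Type*} {M : κ → E3} {d : κ → ℝ}

theorem eventually_inner_lt_of [Finite κ] {x : E3} {s : Set κ} (h : ∀ k ∈ s, inner ℝ (M k) x < d k) :
    ∀ᶠ y in 𝓝 x, ∀ k ∈ s, inner ℝ (M k) y < d k := by
  have : ∀ k, ∀ᶠ y in 𝓝 x, k ∈ s → inner ℝ (M k) y < d k := by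
    intro k
    by_cases hk : k ∈ s
    · have hc : Continuous fun y : E3 => inner ℝ (M k) y := by fun_prop
      exact (hc.continuousAt.eventually_lt_const (h k hk)).mono fun y hy _ => hy
    · exact Eventually.of_forall fun y hks => (hk hks).elim
  exact eventually_all.mpr this

/-- A point of the intersection of half-spaces with a single active constraint is flat. -/
theorem isHalfspaceAt_cone [Finite κ] (hM : ∀ k, ‖M k‖ = 1) {x : E3} {k : κ} (hk : inner ℝ (M k) x = d k)
    (h : ∀ j, j ≠ k → inner ℝ (M j) x < d j) : IsHalfspaceAt (cone M d) x (M k) (d k) := by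
  refine ⟨hM k, hk, ?_⟩
  filter_upwards [eventually_inner_lt_of (s := {j | j ≠ k}) h] with y hy
  refine ⟨fun hyc => hyc k, fun hyk j => ?_⟩
  by_cases hj : j = k
  · exact hj ▸ hyk
  · exact (hy j hj).le

/-- At a flat point of the intersection of half-spaces, every active constraint is the half-space of
the flat point. -/
theorem eq_of_isHalfspaceAt_cone (hM : ∀ k, ‖M k‖ = 1) {x m : E3} {e : ℝ}
    (h : IsHalfspaceAt (cone M d) x m e) {k : κ} (hk : inner ℝ (M k) x = d k) :
    M k = m ∧ d k = e :=
  h.eq_of_eventually_imp (hM k) hk (Eventually.of_forall fun _ hy => hy k)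

theorem mem_interior_cone [Finite κ] {x : E3} (h : ∀ k, inner ℝ (M k) x < d k) : x ∈ interior (cone M d) := by
  rw [mem_interior_iff_mem_nhds]
  filter_upwards [eventually_inner_lt_of (s := univ) fun k _ => h k] with y hy k
  exact (hy k trivial).le

theorem inner_lt_of_mem_interior_cone (hM : ∀ k, ‖M k‖ = 1) {x : E3} (h : x ∈ interior (cone M d))
    (k : κ) : inner ℝ (M k) x < d k := by
  obtain ⟨t, ht, ht0⟩ := (((tendsto_add_smul_nhdsGT_zero x (M k)).eventually
    (mem_interior_iff_mem_nhds.mp h)).and self_mem_nhdsWithin).exists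
  have h1 : inner ℝ (M k) (x + t • M k) ≤ d k := ht k
  have ht0 : (0 : ℝ) < t := ht0
  rw [inner_add_right, inner_smul_right, real_inner_self_eq_norm_sq, hM k] at h1
  linarith

theorem mem_frontier_cone_iff [Finite κ] (hM : ∀ k, ‖M k‖ = 1) {x : E3} :
    x ∈ frontier (cone M d) ↔ x ∈ cone M d ∧ ∃ k, inner ℝ (M k) x = d k := by
  rw [(isClosed_cone M d).frontier_eq, Set.mem_sdiff]
  refine and_congr_right fun hx => ⟨fun h => ?_, ?_⟩
  · by_contra! hne
    exact h (mem_interior_cone fun k => lt_of_le_of_ne (hx k) (hne k))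
  · rintro ⟨k, hk⟩ h
    exact (inner_lt_of_mem_interior_cone hM h k).ne hk

/-- When the half-spaces are distinct, the flat points are those with one active constraint. -/
theorem mem_flatPoints_cone_iff [Finite κ] (hM : ∀ k, ‖M k‖ = 1)
    (hinj : ∀ j k, M j = M k → d j = d k → j = k) {x : E3} :
    x ∈ flatPoints (cone M d) ↔
      ∃ k, inner ℝ (M k) x = d k ∧ ∀ j, j ≠ k → inner ℝ (M j) x < d j := by
  constructor
  · intro hx
    obtain ⟨hxc, k, hk⟩ := (mem_frontier_cone_iff hM).mp (flatPoints_subset_frontier _ hx)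
    obtain ⟨m, e, hme⟩ := hx
    refine ⟨k, hk, fun j hj => lt_of_le_of_ne (hxc j) fun hje => hj ?_⟩
    obtain ⟨h1, h2⟩ := eq_of_isHalfspaceAt_cone hM hme hk
    obtain ⟨h3, h4⟩ := eq_of_isHalfspaceAt_cone hM hme hje
    exact hinj j k (h3.trans h1.symm) (h4.trans h2.symm)
  · rintro ⟨k, hk, h⟩
    exact ⟨_, _, isHalfspaceAt_cone hM hk h⟩

/-- When the half-spaces are distinct, the skeleton of their intersection consists of the points with
two active constraints. -/
theorem skeleton_cone [Finite κ] (hM : ∀ k, ‖M k‖ = 1) (hinj : ∀ j k, M j = M k → d j = d k → j = k) :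
    skeleton (cone M d) = creases M d := by
  ext x
  rw [skeleton, Set.mem_sdiff, mem_frontier_cone_iff hM, mem_flatPoints_cone_iff hM hinj]
  constructor
  · rintro ⟨⟨hx, k, hk⟩, h⟩
    push Not at h
    obtain ⟨j, hj, hjx⟩ := h k hk
    exact ⟨hx, j, k, hj, le_antisymm (hx j) hjx, hk⟩
  · rintro ⟨hx, j, k, hjk, hj, hk⟩
    refine ⟨⟨hx, k, hk⟩, ?_⟩
    rintro ⟨i, hi, h⟩
    by_cases hji : j = i
    · exact (h k fun hki => hjk (hji.trans hki.symm)).ne hk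
    · exact (h j hji).ne hj

end cone

/-! ### Sliding a face -/

/-- In the open set `U` the set `P` is cut out of the half-spaces `⟪N i, y⟫ ≤ b i` by the
half-space `⟪n, y⟫ ≤ c`, and `U` contains the part of their intersection with height between `-δ`
and `ε` over the plane `⟪n, y⟫ = c`, where `δ` is so small that the section of that intersection
by each of these planes has interior points, and that each half-space contributes to its boundary
already at heights between `-δ` and `-δ / 2`. -/
structure IsCollar {ι : Type*} (P U : Set E3) (n : E3) (c : ℝ) (N : ι → E3) (b : ι → ℝ)
    (δ ε : ℝ) : Prop where
  system : IsFaceSystem n c N b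
  norm_eq : ∀ i, ‖N i‖ = 1
  pos : 0 < ε
  lt : 2 * ε < δ
  isOpen : IsOpen U
  mem_iff : ∀ y ∈ U, (y ∈ P ↔ y ∈ cone N b ∧ inner ℝ n y ≤ c)
  low : ∀ y ∈ U, c - δ < inner ℝ n y
  slab_subset : ∀ y ∈ cone N b, c - δ < inner ℝ n y → inner ℝ n y ≤ c + ε → y ∈ U
  bounded : Bornology.IsBounded (cone N b ∩ {y | |inner ℝ n y - c| ≤ δ})
  exists_mem : ∀ s, |s| ≤ δ / 2 → ∃ y, inner ℝ n y = c + s ∧ ∀ i, inner ℝ (N i) y < b i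
  exists_facet : ∀ i, ∃ y, c - δ < inner ℝ n y ∧ inner ℝ n y < c - δ / 2 ∧ inner ℝ (N i) y = b i ∧
    ∀ k, k ≠ i → inner ℝ (N k) y < b k

/-- The set obtained from `P` by moving the plane `⟪n, y⟫ = c` by `t` inside `U`. -/
def slid {ι : Type*} (P U : Set E3) (n : E3) (c : ℝ) (N : ι → E3) (b : ι → ℝ) (δ t : ℝ) : Set E3 :=
  (P \ U) ∪ (cone N b ∩ {y | c - δ < inner ℝ n y ∧ inner ℝ n y ≤ c + t})

/-- The region in which sliding the face by at most `ε` changes nothing. -/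
def outer {ι : Type*} (n : E3) (c : ℝ) (N : ι → E3) (b : ι → ℝ) (δ ε : ℝ) : Set E3 :=
  (cone N b ∩ {y | c - δ / 2 ≤ inner ℝ n y ∧ inner ℝ n y ≤ c + ε})ᶜ

theorem isClosed_slab {ι : Type*} (n : E3) (N : ι → E3) (b : ι → ℝ) (u v : ℝ) :
    IsClosed (cone N b ∩ {y | u ≤ inner ℝ n y ∧ inner ℝ n y ≤ v}) :=
  have hc : Continuous fun y : E3 => inner ℝ n y := by fun_prop
  (isClosed_cone N b).inter ((isClosed_le continuous_const hc).inter
    (isClosed_le hc continuous_const))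

theorem isOpen_outer {ι : Type*} (n : E3) (c : ℝ) (N : ι → E3) (b : ι → ℝ) (δ ε : ℝ) :
    IsOpen (outer n c N b δ ε) := (isClosed_slab n N b _ _).isOpen_compl

/-- The half-spaces `⟪N i, y⟫ ≤ b i` together with the half-space `⟪n, y⟫ ≤ c`. -/
theorem mem_cone_option {ι : Type*} {n : E3} {c : ℝ} {N : ι → E3} {b : ι → ℝ} {y : E3} :
    y ∈ cone (fun o : Option ι => o.elim n N) (fun o => o.elim c b) ↔
      y ∈ cone N b ∧ inner ℝ n y ≤ c := by
  constructor
  · intro h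
    exact ⟨fun i => h (some i), h none⟩
  · rintro ⟨h, h'⟩ (_ | i)
    · exact h'
    · exact h i

theorem isSemilinear_cone {ι : Type*} [Finite ι] (N : ι → E3) (b : ι → ℝ) :
    IsSemilinear (cone N b) := by
  have : cone N b = ⋂ i, {y | inner ℝ (N i) y ≤ b i} := by
    ext y
    simp only [cone, mem_iInter, mem_ofPred_eq]
  rw [this]
  exact IsSemilinear.iInter fun i => IsSemilinear.halfspace_le _ _

namespace IsCollar

variable {ι : Type*} {P U : Set E3} {n : E3} {c : ℝ} {N : ι → E3} {b : ι → ℝ} {δ ε t : ℝ}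

theorem mem_slid_iff (h : IsCollar P U n c N b δ ε) {y : E3} (hy : y ∈ U) :
    y ∈ slid P U n c N b δ t ↔ y ∈ cone N b ∧ inner ℝ n y ≤ c + t := by
  simp only [slid, mem_union, Set.mem_sdiff, hy, not_true, and_false, false_or, mem_inter_iff,
    mem_ofPred_eq, h.low y hy, true_and]

theorem mem_slid_iff_of_notMem (h : IsCollar P U n c N b δ ε) (ht : t ≤ ε) {y : E3} (hy : y ∉ U) :
    y ∈ slid P U n c N b δ t ↔ y ∈ P := by
  simp only [slid, mem_union, Set.mem_sdiff, hy, not_false_iff, and_true, mem_inter_iff,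
    mem_ofPred_eq, or_iff_left_iff_imp]
  rintro ⟨h1, h2, h3⟩
  exact (hy (h.slab_subset y h1 h2 (by linarith))).elim

theorem mem_of_notMem_outer (h : IsCollar P U n c N b δ ε) {y : E3}
    (hy : y ∉ outer n c N b δ ε) : y ∈ U := by
  simp only [outer, mem_compl_iff, not_not] at hy
  exact h.slab_subset y hy.1 (by linarith [hy.2.1, h.pos, h.lt]) hy.2.2

theorem mem_slid_iff_of_mem_outer (h : IsCollar P U n c N b δ ε) (ht : |t| ≤ ε) {y : E3}
    (hy : y ∈ outer n c N b δ ε) : y ∈ slid P U n c N b δ t ↔ y ∈ P := by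
  have ht' := abs_le.mp ht
  by_cases hyU : y ∈ U
  · rw [h.mem_slid_iff hyU, h.mem_iff y hyU]
    refine and_congr_right fun hyc => ?_
    have hlow : inner ℝ n y ≤ c + ε → inner ℝ n y < c - δ / 2 := fun h1 => by
      by_contra! h2
      exact hy ⟨hyc, h2, h1⟩
    have := h.pos
    have := h.lt
    constructor
    · intro h1
      linarith [hlow (by linarith)]
    · intro h1
      linarith [hlow (by linarith)]
  · exact h.mem_slid_iff_of_notMem ht'.2 hyU

theorem slid_zero (h : IsCollar P U n c N b δ ε) : slid P U n c N b δ 0 = P := by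
  ext y
  by_cases hyU : y ∈ U
  · rw [h.mem_slid_iff hyU, h.mem_iff y hyU, add_zero]
  · exact h.mem_slid_iff_of_notMem h.pos.le hyU

theorem eventually_mem_slid_iff_of_mem_outer (h : IsCollar P U n c N b δ ε) (ht : |t| ≤ ε) {x : E3}
    (hx : x ∈ outer n c N b δ ε) : ∀ᶠ y in 𝓝 x, (y ∈ slid P U n c N b δ t ↔ y ∈ P) := by
  filter_upwards [(isOpen_outer n c N b δ ε).mem_nhds hx] with y hy
  exact h.mem_slid_iff_of_mem_outer ht hy

theorem eventually_mem_slid_iff (h : IsCollar P U n c N b δ ε) {x : E3}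
    (hx : x ∈ U) : ∀ᶠ y in 𝓝 x, (y ∈ slid P U n c N b δ t ↔
      y ∈ cone (fun o : Option ι => o.elim n N) (fun o => o.elim (c + t) b)) := by
  filter_upwards [h.isOpen.mem_nhds hx] with y hy
  rw [h.mem_slid_iff hy, mem_cone_option]

/-- A description of the slid set by closed conditions and the fixed region only, from which it is
seen to be semilinear. -/
theorem slid_eq (h : IsCollar P U n c N b δ ε) (ht : |t| ≤ ε) :
    slid P U n c N b δ t = (P ∩ outer n c N b δ ε) ∪
      (cone N b ∩ {y | c - δ / 2 ≤ inner ℝ n y ∧ inner ℝ n y ≤ c + t}) := by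
  have ht' := abs_le.mp ht
  ext y
  by_cases hy : y ∈ outer n c N b δ ε
  · rw [h.mem_slid_iff_of_mem_outer ht hy]
    simp only [mem_union, mem_inter_iff, hy, and_true, mem_ofPred_eq]
    refine (or_iff_left ?_).symm
    rintro ⟨h1, h2, h3⟩
    exact hy ⟨h1, h2, by linarith⟩
  · rw [h.mem_slid_iff (h.mem_of_notMem_outer hy)]
    simp only [mem_union, mem_inter_iff, hy, and_false, false_or, mem_ofPred_eq]
    simp only [outer, mem_compl_iff, not_not] at hy
    exact and_congr_right fun _ => (and_iff_right hy.2.1).symm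

theorem isSemilinear_slid [Finite ι] (h : IsCollar P U n c N b δ ε) (hP : IsSemilinear P)
    (ht : |t| ≤ ε) : IsSemilinear (slid P U n c N b δ t) := by
  rw [h.slid_eq ht, outer]
  refine (hP.inter (IsSemilinear.compl ?_)).union ?_
  all_goals
    exact (isSemilinear_cone N b).inter
      ((IsSemilinear.halfspace_ge _ _).inter (IsSemilinear.halfspace_le _ _))

theorem isClosed_slid (h : IsCollar P U n c N b δ ε) (hP : IsClosed P) (ht : |t| ≤ ε) :
    IsClosed (slid P U n c N b δ t) := by
  refine isClosed_of_closure_subset fun x hx => ?_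
  by_cases hxU : x ∈ U
  · have h1 := h.eventually_mem_slid_iff (t := t) hxU
    rw [h1.self_of_nhds]
    exact (isClosed_cone _ _).closure_subset ((mem_closure_congr h1).mp hx)
  · have hxo : x ∈ outer n c N b δ ε := not_not.mp fun hc => hxU (h.mem_of_notMem_outer hc)
    have h1 := h.eventually_mem_slid_iff_of_mem_outer ht hxo
    rw [h1.self_of_nhds]
    exact hP.closure_subset ((mem_closure_congr h1).mp hx)

theorem isCompact_slid (h : IsCollar P U n c N b δ ε) (hP : IsCompact P) (ht : |t| ≤ ε) :
    IsCompact (slid P U n c N b δ t) := by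
  refine Metric.isCompact_of_isClosed_isBounded (h.isClosed_slid hP.isClosed ht)
    ((hP.isBounded.union h.bounded).subset ?_)
  rintro y (hy | hy)
  · exact Or.inl hy.1
  · refine Or.inr ⟨hy.1, ?_⟩
    have h1 : inner ℝ n y ≤ c + t := hy.2.2
    have h2 : c - δ < inner ℝ n y := hy.2.1
    simp only [mem_ofPred_eq, abs_le]
    have := (abs_le.mp ht).2
    have := h.lt
    have := h.pos
    constructor <;> linarith

theorem slid_inter (h : IsCollar P U n c N b δ ε) (ht : t ≤ ε) :
    slid P U n c N b δ t ∩ U =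
      cone N b ∩ {y | c - δ < inner ℝ n y ∧ inner ℝ n y ≤ c + t} := by
  ext y
  constructor
  · rintro ⟨h1, h2⟩
    have := (h.mem_slid_iff h2).mp h1
    exact ⟨this.1, h.low y h2, this.2⟩
  · intro hy
    exact ⟨Or.inr hy, h.slab_subset y hy.1 hy.2.1 (by have := hy.2.2; linarith)⟩

/-- A point strictly inside the collar. -/
theorem exists_mem_interior [Finite ι] (h : IsCollar P U n c N b δ ε) (ht : |t| ≤ ε) :
    ∃ x ∈ U, x ∈ interior (cone (fun o : Option ι => o.elim n N) (fun o => o.elim (c + t) b)) := by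
  have h0 := h.pos
  have h1 := h.lt
  obtain ⟨x, hx, hxN⟩ := h.exists_mem (-(δ / 2)) (by rw [abs_neg, abs_of_pos]; linarith)
  have := abs_le.mp ht
  refine ⟨x, h.slab_subset x (fun i => (hxN i).le) (by linarith) (by linarith),
    mem_interior_cone ?_⟩
  rintro (_ | i)
  · simp only [Option.elim]
    linarith
  · exact hxN i

/-- The interior of the slid set stays connected: its part in the collar is convex, and outside of
the collar it agrees with the interior of `P`. -/
theorem isConnected_interior_slid [Finite ι] (h : IsCollar P U n c N b δ ε)
    (hP : IsConnected (interior P)) (ht : |t| ≤ ε) :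
    IsConnected (interior (slid P U n c N b δ t)) := by
  set Q := slid P U n c N b δ t with hQ
  set V := outer n c N b δ ε with hV
  have hUV : ∀ y, y ∉ V → y ∈ U := fun y hy => h.mem_of_notMem_outer hy
  have hQV : ∀ y ∈ V, (y ∈ interior Q ↔ y ∈ interior P) := fun y hy =>
    mem_interior_congr (h.eventually_mem_slid_iff_of_mem_outer ht hy)
  obtain ⟨x, hxU, hx⟩ := h.exists_mem_interior ht
  have hxQ : x ∈ interior Q :=
    (mem_interior_congr (h.eventually_mem_slid_iff hxU)).mpr hx
  refine ⟨⟨x, hxQ⟩, ?_⟩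
  have hB : IsPreconnected (interior Q ∩ U) := by
    have h1 : interior Q ∩ U = interior (Q ∩ U) := by rw [interior_inter, h.isOpen.interior_eq]
    rw [h1, h.slid_inter (abs_le.mp ht).2]
    refine Convex.isPreconnected (Convex.interior ((convex_cone N b).inter ?_))
    exact ((convex_halfSpace_gt (innerₗ E3 n).isLinear (c - δ)).inter
      (convex_halfSpace_le (innerₗ E3 n).isLinear (c + t)))
  -- a part of the interior that is clopen and avoids `U` would be clopen in the interior of `P`
  have key : ∀ u v : Set E3, IsOpen u → IsOpen v → interior Q ⊆ u ∪ v →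
      interior Q ∩ (u ∩ v) = ∅ → interior Q ∩ U ⊆ u → interior Q ∩ v = ∅ := by
    intro u v hu hv hcov hdisj hBu
    by_contra hne
    obtain ⟨y, hyQ, hyv⟩ := nonempty_iff_ne_empty.mpr hne
    have hvU : ∀ z, z ∈ interior Q → z ∈ v → z ∉ U := fun z hz hzv hzU =>
      notMem_empty z (hdisj ▸ ⟨hz, hBu ⟨hz, hzU⟩, hzv⟩)
    have hvV : ∀ z, z ∈ interior Q → z ∈ v → z ∈ V := fun z hz hzv =>
      not_not.mp fun hzV => hvU z hz hzv (hUV z hzV)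
    have hsub := hP.isPreconnected.subset_of_closure_inter_subset
      (u := interior Q ∩ v) (isOpen_interior.inter hv)
      ⟨y, (hQV y (hvV y hyQ hyv)).mp hyQ, hyQ, hyv⟩ (by
        rintro z ⟨hzc, hzP⟩
        by_cases hzV : z ∈ V
        · have hzQ := (hQV z hzV).mpr hzP
          rcases hcov hzQ with hzu | hzv
          · obtain ⟨w, ⟨hwQ, hwu⟩, -, hwv⟩ := mem_closure_iff.mp hzc (interior Q ∩ u)
              (isOpen_interior.inter hu) ⟨hzQ, hzu⟩
            exact (notMem_empty w (hdisj ▸ ⟨hwQ, hwu, hwv⟩)).elim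
          · exact ⟨hzQ, hzv⟩
        · obtain ⟨w, hwU, hwQ, hwv⟩ := mem_closure_iff.mp hzc U h.isOpen (hUV z hzV)
          exact (hvU w hwQ hwv hwU).elim)
    -- `U` meets the interior of `P`
    have hxP : (interior P ∩ U).Nonempty := by
      obtain ⟨x', hx'U, hx'⟩ := h.exists_mem_interior (t := 0) (by simpa using h.pos.le)
      refine ⟨x', ?_, hx'U⟩
      have h1 := (mem_interior_congr (h.eventually_mem_slid_iff hx'U)).mpr hx'
      rwa [h.slid_zero] at h1
    obtain ⟨w, hwP, hwU⟩ := hxP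
    exact hvU w (hsub hwP).1 (hsub hwP).2 hwU
  intro u v hu hv hcov hune hvne
  by_contra hne
  rw [not_nonempty_iff_eq_empty] at hne
  have hsplit : interior Q ∩ U ⊆ u ∨ interior Q ∩ U ⊆ v := by
    by_contra! hcon
    obtain ⟨y, hy, hyu⟩ := not_subset.mp hcon.1
    obtain ⟨z, hz, hzv⟩ := not_subset.mp hcon.2
    obtain ⟨w, hw, hwuv⟩ := hB u v hu hv (inter_subset_left.trans hcov)
      ⟨z, hz, (hcov hz.1).resolve_right hzv⟩ ⟨y, hy, (hcov hy.1).resolve_left hyu⟩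
    exact notMem_empty w (hne ▸ ⟨hw.1, hwuv⟩)
  rcases hsplit with hs | hs
  · exact hvne.ne_empty (key u v hu hv hcov hne hs)
  · exact hune.ne_empty (key v u hv hu (union_comm u v ▸ hcov) (inter_comm u v ▸ hne) hs)

/-- The slid set is compact and semilinear, hence a finite union of polytopes; near each point it
agrees with `P` or with a convex set with interior points, so that it is the closure of its
interior. -/
theorem isPolyhedron_slid [Finite ι] (h : IsCollar P U n c N b δ ε) (hP : IsPolyhedron P)
    (ht : |t| ≤ ε) : IsPolyhedron (slid P U n c N b δ t) := by
  have hcomp := h.isCompact_slid hP.isCompact ht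
  refine ⟨(h.isSemilinear_slid hP.isSemilinear ht).exists_finite_union hcomp, ?_,
    h.isConnected_interior_slid hP.isConnected_interior ht⟩
  refine subset_antisymm (closure_minimal interior_subset hcomp.isClosed) fun x hx => ?_
  by_cases hxU : x ∈ U
  · have h1 := h.eventually_mem_slid_iff (t := t) hxU
    have h2 : ∀ᶠ y in 𝓝 x, (y ∈ interior (slid P U n c N b δ t) ↔
        y ∈ interior (cone (fun o : Option ι => o.elim n N) (fun o => o.elim (c + t) b))) :=
      h1.eventually_nhds.mono fun y hy => mem_interior_congr hy
    rw [mem_closure_congr h2]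
    obtain ⟨z, -, hz⟩ := h.exists_mem_interior ht
    rw [(convex_cone _ _).closure_interior_eq_closure_of_nonempty_interior ⟨z, hz⟩]
    exact subset_closure (h1.self_of_nhds.mp hx)
  · have hxo : x ∈ outer n c N b δ ε := not_not.mp fun hc => hxU (h.mem_of_notMem_outer hc)
    have h1 := h.eventually_mem_slid_iff_of_mem_outer ht hxo
    have h2 : ∀ᶠ y in 𝓝 x, (y ∈ interior (slid P U n c N b δ t) ↔ y ∈ interior P) :=
      h1.eventually_nhds.mono fun y hy => mem_interior_congr hy
    rw [mem_closure_congr h2, hP.closure_interior]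
    exact h1.self_of_nhds.mp hx

end IsCollar

/-! ### The faces after sliding -/

/-- The points of the collar at which `⟪N i, y⟫ ≤ b i` is the only active constraint. -/
def sidePart {ι : Type*} (n : E3) (c : ℝ) (N : ι → E3) (b : ι → ℝ) (δ t : ℝ) (i : ι) : Set E3 :=
  {y | c - δ < inner ℝ n y ∧ inner ℝ n y < c + t ∧ inner ℝ (N i) y = b i ∧
    ∀ k, k ≠ i → inner ℝ (N k) y < b k}

/-- The points of the collar at which `⟪n, y⟫ ≤ c + t` is the only active constraint. -/
def topPart {ι : Type*} (n : E3) (c : ℝ) (N : ι → E3) (b : ι → ℝ) (t : ℝ) : Set E3 :=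
  {y | inner ℝ n y = c + t ∧ ∀ k, inner ℝ (N k) y < b k}

theorem convex_sidePart {ι : Type*} (n : E3) (c : ℝ) (N : ι → E3) (b : ι → ℝ) (δ t : ℝ) (i : ι) :
    Convex ℝ (sidePart n c N b δ t i) := by
  have : sidePart n c N b δ t i = {y | c - δ < innerₗ E3 n y} ∩ ({y | innerₗ E3 n y < c + t} ∩
      ({y | innerₗ E3 (N i) y = b i} ∩ ⋂ k, ⋂ _ : k ≠ i, {y | innerₗ E3 (N k) y < b k})) := by
    ext y
    simp only [sidePart, mem_inter_iff, mem_iInter, mem_ofPred_eq, innerₗ_apply_apply]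
  rw [this]
  exact (convex_halfSpace_gt (innerₗ E3 n).isLinear _).inter
    ((convex_halfSpace_lt (innerₗ E3 n).isLinear _).inter
    ((convex_hyperplane (innerₗ E3 (N i)).isLinear _).inter
    (convex_iInter fun k => convex_iInter fun _ => convex_halfSpace_lt (innerₗ E3 (N k)).isLinear _)))

theorem convex_topPart {ι : Type*} (n : E3) (c : ℝ) (N : ι → E3) (b : ι → ℝ) (t : ℝ) :
    Convex ℝ (topPart n c N b t) := by
  have : topPart n c N b t =
      {y | innerₗ E3 n y = c + t} ∩ ⋂ k, {y | innerₗ E3 (N k) y < b k} := by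
    ext y
    simp only [topPart, mem_inter_iff, mem_iInter, mem_ofPred_eq, innerₗ_apply_apply]
  rw [this]
  exact (convex_hyperplane (innerₗ E3 n).isLinear _).inter
    (convex_iInter fun k => convex_halfSpace_lt (innerₗ E3 (N k)).isLinear _)

theorem eq_of_mem_sidePart {ι : Type*} {n : E3} {c : ℝ} {N : ι → E3} {b : ι → ℝ} {δ t t' : ℝ}
    {i j : ι} {y : E3} (hi : y ∈ sidePart n c N b δ t i) (hj : y ∈ sidePart n c N b δ t' j) :
    i = j := by
  by_contra hij
  exact (hj.2.2.2 i hij).ne hi.2.2.1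

/-- When equality of the values of two functions means the same, so do the sizes of their images. -/
theorem ncard_image_congr {α β : Type*} {f g : α → β} {Z : Set α}
    (h : ∀ x ∈ Z, ∀ y ∈ Z, f x = f y ↔ g x = g y) : (f '' Z).ncard = (g '' Z).ncard := by
  choose φ hφZ hφ using fun a (ha : a ∈ f '' Z) => ha
  refine Set.ncard_congr (fun a ha => g (φ a ha)) (fun a ha => mem_image_of_mem g (hφZ a ha)) ?_ ?_
  · intro a a' ha ha' haa
    rw [← hφ a ha, ← hφ a' ha']
    exact (h _ (hφZ a ha) _ (hφZ a' ha')).mpr haa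
  · rintro _ ⟨x, hx, rfl⟩
    have hx' := mem_image_of_mem f hx
    exact ⟨f x, hx', (h _ (hφZ _ hx') _ hx).mp (hφ _ hx')⟩

/-- The closures of two components agree exactly if the components do. -/
theorem closure_connectedComponentIn_eq_iff {P : Set E3} {x y : E3}
    (hy : y ∈ flatPoints P) :
    closure (connectedComponentIn (flatPoints P) x) =
      closure (connectedComponentIn (flatPoints P) y) ↔
      y ∈ connectedComponentIn (flatPoints P) x := by
  constructor
  · intro h
    refine mem_connectedComponentIn_of_mem_closure hy ?_
    rw [h]
    exact subset_closure (mem_connectedComponentIn hy)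
  · intro h
    rw [connectedComponentIn_eq h]

namespace IsCollar

variable {ι : Type*} {P U : Set E3} {n : E3} {c : ℝ} {N : ι → E3} {b : ι → ℝ} {δ ε t t' : ℝ}

theorem norm_option (h : IsCollar P U n c N b δ ε) (o : Option ι) : ‖o.elim n N‖ = 1 := by
  cases o
  · exact h.system.norm_eq
  · exact h.norm_eq _

/-- The half-spaces of the moved face and of its neighbours are distinct. -/
theorem injective_option (h : IsCollar P U n c N b δ ε) (t : ℝ) (o o' : Option ι)
    (h₁ : o.elim n N = o'.elim n N) (h₂ : o.elim (c + t) b = o'.elim (c + t) b) : o = o' := by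
  have hne : ∀ i, n ≠ N i := fun i hi => by
    have := (h.system.linearIndependent_pair i).injective.ne (show (0 : Fin 2) ≠ 1 by decide)
    simp only [Matrix.cons_val_zero, Matrix.cons_val_one] at this
    exact this hi
  rcases o with _ | i <;> rcases o' with _ | j
  · rfl
  · exact (hne j h₁).elim
  · exact (hne i h₁.symm).elim
  · simp only [Option.elim] at h₁ h₂
    by_contra hij
    obtain ⟨y, -, -, hy, hyk⟩ := h.exists_facet i
    have := hyk j fun hji => hij (congrArg some hji.symm)
    rw [← h₁, ← h₂, hy] at this
    exact this.false

/-- The flat points in the collar lie on one of the sides or on the moved face. -/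
theorem mem_flatPoints_slid_iff [Finite ι] (h : IsCollar P U n c N b δ ε) {x : E3} (hx : x ∈ U) :
    x ∈ flatPoints (slid P U n c N b δ t) ↔
      (∃ i, x ∈ sidePart n c N b δ t i) ∨ x ∈ topPart n c N b t := by
  rw [mem_flatPoints_congr (h.eventually_mem_slid_iff hx),
    mem_flatPoints_cone_iff h.norm_option (h.injective_option t)]
  have hlow := h.low x hx
  constructor
  · rintro ⟨_ | i, hi, hj⟩
    · exact Or.inr ⟨hi, fun k => hj (some k) (by simp)⟩
    · exact Or.inl ⟨i, hlow, hj none (by simp), hi, fun k hk => hj (some k) (by simpa using hk)⟩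
  · rintro (⟨i, -, h1, h2, h3⟩ | ⟨h1, h2⟩)
    · refine ⟨some i, h2, ?_⟩
      rintro (_ | j) hj
      · exact h1
      · exact h3 j fun hji => hj (congrArg some hji)
    · refine ⟨none, h1, ?_⟩
      rintro (_ | j) hj
      · exact (hj rfl).elim
      · exact h2 j

theorem sidePart_subset (h : IsCollar P U n c N b δ ε) (ht : |t| ≤ ε) (i : ι) :
    sidePart n c N b δ t i ⊆ U := by
  rintro y ⟨h1, h2, h3, h4⟩
  refine h.slab_subset y (fun k => ?_) h1 (by linarith [(abs_le.mp ht).2])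
  by_cases hk : k = i
  · exact hk ▸ h3.le
  · exact (h4 k hk).le

theorem topPart_subset (h : IsCollar P U n c N b δ ε) (ht : |t| ≤ ε) :
    topPart n c N b t ⊆ U := by
  rintro y ⟨h1, h2⟩
  have := abs_le.mp ht
  have := h.pos
  have := h.lt
  exact h.slab_subset y (fun k => (h2 k).le) (by linarith) (by linarith)

theorem sidePart_subset_flatPoints [Finite ι] (h : IsCollar P U n c N b δ ε) (ht : |t| ≤ ε)
    (i : ι) : sidePart n c N b δ t i ⊆ flatPoints (slid P U n c N b δ t) := fun _ hy =>
  (h.mem_flatPoints_slid_iff (h.sidePart_subset ht i hy)).mpr (Or.inl ⟨i, hy⟩)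

theorem topPart_subset_flatPoints [Finite ι] (h : IsCollar P U n c N b δ ε) (ht : |t| ≤ ε) :
    topPart n c N b t ⊆ flatPoints (slid P U n c N b δ t) := fun _ hy =>
  (h.mem_flatPoints_slid_iff (h.topPart_subset ht hy)).mpr (Or.inr hy)

theorem eventually_mem_sidePart [Finite ι] (h : IsCollar P U n c N b δ ε) (ht : |t| ≤ ε) {i : ι}
    {x : E3} (hx : x ∈ sidePart n c N b δ t i) :
    ∀ᶠ y in 𝓝 x, y ∈ flatPoints (slid P U n c N b δ t) → y ∈ sidePart n c N b δ t i := by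
  have hc : Continuous fun y : E3 => inner ℝ n y := by fun_prop
  filter_upwards [h.isOpen.mem_nhds (h.sidePart_subset ht i hx),
    hc.continuousAt.eventually_lt_const hx.2.1,
    eventually_inner_lt_of (s := {k | k ≠ i}) hx.2.2.2] with y hyU hyn hyk hy
  rcases (h.mem_flatPoints_slid_iff hyU).mp hy with ⟨j, hj⟩ | hy
  · by_cases hji : j = i
    · exact hji ▸ hj
    · exact ((hyk j hji).ne hj.2.2.1).elim
  · exact (hyn.ne hy.1).elim

theorem eventually_mem_topPart [Finite ι] (h : IsCollar P U n c N b δ ε) (ht : |t| ≤ ε)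
    {x : E3} (hx : x ∈ topPart n c N b t) :
    ∀ᶠ y in 𝓝 x, y ∈ flatPoints (slid P U n c N b δ t) → y ∈ topPart n c N b t := by
  filter_upwards [h.isOpen.mem_nhds (h.topPart_subset ht hx),
    eventually_inner_lt_of (s := univ) fun k _ => hx.2 k] with y hyU hyk hy
  rcases (h.mem_flatPoints_slid_iff hyU).mp hy with ⟨j, hj⟩ | hy
  · exact ((hyk j trivial).ne hj.2.2.1).elim
  · exact hy

theorem notMem_outer_of_mem_topPart (h : IsCollar P U n c N b δ ε) (ht : |t| ≤ ε) {x : E3}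
    (hx : x ∈ topPart n c N b t) : x ∉ outer n c N b δ ε := by
  have := abs_le.mp ht
  have := h.pos
  have := h.lt
  simp only [outer, mem_compl_iff, not_not]
  exact ⟨fun k => (hx.2 k).le, by linarith [hx.1], by linarith [hx.1]⟩

/-- In the region where nothing changes, the sides before and after sliding are the same. -/
theorem mem_sidePart_of_mem_outer (h : IsCollar P U n c N b δ ε) (ht : |t| ≤ ε) (ht' : |t'| ≤ ε)
    {i : ι} {x : E3} (hx : x ∈ sidePart n c N b δ t i) (hxo : x ∈ outer n c N b δ ε) :
    x ∈ sidePart n c N b δ t' i := by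
  refine ⟨hx.1, ?_, hx.2.2⟩
  have h1 := abs_le.mp ht
  have h2 := abs_le.mp ht'
  have := h.lt
  have h3 : inner ℝ n x < c - δ / 2 := by
    by_contra! h3
    refine hxo ⟨fun k => ?_, h3, by linarith [hx.2.1]⟩
    by_cases hk : k = i
    · exact hk ▸ hx.2.2.1.le
    · exact (hx.2.2.2 k hk).le
  linarith

theorem mem_flatPoints_slid_iff_of_mem_outer (h : IsCollar P U n c N b δ ε) (ht : |t| ≤ ε) {x : E3}
    (hx : x ∈ outer n c N b δ ε) : x ∈ flatPoints (slid P U n c N b δ t) ↔ x ∈ flatPoints P :=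
  mem_flatPoints_congr (h.eventually_mem_slid_iff_of_mem_outer ht hx)

/-- Two flat points that the sliding does not affect are in the same component of the flat points
before and after sliding: every side of the collar is connected and reaches out of the part of
space that changes, so that a relatively clopen set of flat points before sliding corresponds to
one after it. -/
theorem mem_connectedComponentIn_slid [Finite ι] (h : IsCollar P U n c N b δ ε) (ht : |t| ≤ ε)
    (ht' : |t'| ≤ ε) {x y : E3} (hxo : x ∈ outer n c N b δ ε) (hyo : y ∈ outer n c N b δ ε)
    (hx : x ∈ flatPoints P)
    (hxy : y ∈ connectedComponentIn (flatPoints (slid P U n c N b δ t)) x) :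
    y ∈ connectedComponentIn (flatPoints (slid P U n c N b δ t')) x := by
  set V := outer n c N b δ ε with hV
  set D := connectedComponentIn (flatPoints (slid P U n c N b δ t')) x with hD
  have hR : ∀ i z, z ∈ sidePart n c N b δ t' i → z ∈ D → sidePart n c N b δ t' i ⊆ D := by
    intro i z hz hzD
    rw [hD, connectedComponentIn_eq hzD]
    exact (convex_sidePart n c N b δ t' i).isPreconnected.subset_connectedComponentIn hz
      (h.sidePart_subset_flatPoints ht' i)
  -- `A` consists of the flat points of the set slid by `t` that correspond to points of `D`: a point of
  -- `V` corresponds to itself, and each side to the side with the same index.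
  set A : Set E3 := {z | z ∈ V ∧ z ∈ D ∨ ∃ i, z ∈ sidePart n c N b δ t i ∧
    sidePart n c N b δ t' i ⊆ D} with hA
  have hAV : ∀ z ∈ V, (z ∈ A ↔ z ∈ D) := by
    intro z hz
    constructor
    · rintro (h1 | ⟨i, hi, hiD⟩)
      · exact h1.2
      · exact hiD (h.mem_sidePart_of_mem_outer ht ht' hi hz)
    · exact fun h1 => Or.inl ⟨hz, h1⟩
  have hAR : ∀ i, ∀ z ∈ sidePart n c N b δ t i, (z ∈ A ↔ sidePart n c N b δ t' i ⊆ D) := by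
    intro i z hz
    constructor
    · rintro (⟨h1, h2⟩ | ⟨j, hj, hjD⟩)
      · exact hR i z (h.mem_sidePart_of_mem_outer ht ht' hz h1) h2
      · rwa [eq_of_mem_sidePart hz hj]
    · exact fun h1 => Or.inr ⟨i, hz, h1⟩
  have hAT : ∀ z ∈ topPart n c N b t, z ∉ A := by
    rintro z hz (⟨h1, -⟩ | ⟨i, hi, -⟩)
    · exact h.notMem_outer_of_mem_topPart ht hz h1
    · exact hi.2.1.ne hz.1
  have hxf' := (h.mem_flatPoints_slid_iff_of_mem_outer ht' hxo).mpr hx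
  have hsub := isPreconnected_connectedComponentIn.subset_of_eventually_iff (A := A)
    (connectedComponentIn_subset (flatPoints (slid P U n c N b δ t)) x) (fun z hz => ?_)
    (mem_connectedComponentIn ((h.mem_flatPoints_slid_iff_of_mem_outer ht hxo).mpr hx))
    ((hAV x hxo).mpr (mem_connectedComponentIn hxf'))
  · exact (hAV y hyo).mp (hsub hxy)
  · by_cases hzV : z ∈ V
    · have hzf : z ∈ flatPoints (slid P U n c N b δ t') :=
        (h.mem_flatPoints_slid_iff_of_mem_outer ht' hzV).mpr
          ((h.mem_flatPoints_slid_iff_of_mem_outer ht hzV).mp hz)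
      filter_upwards [(isOpen_outer n c N b δ ε).mem_nhds hzV,
        eventually_mem_connectedComponentIn_iff x hzf] with w hwV hw hwf
      rw [hAV z hzV, hAV w hwV]
      exact hw ((h.mem_flatPoints_slid_iff_of_mem_outer ht' hwV).mpr
          ((h.mem_flatPoints_slid_iff_of_mem_outer ht hwV).mp hwf))
    · rcases (h.mem_flatPoints_slid_iff (h.mem_of_notMem_outer hzV)).mp hz with ⟨i, hi⟩ | hzt
      · filter_upwards [h.eventually_mem_sidePart ht hi] with w hw hwf
        rw [hAR i z hi, hAR i w (hw hwf)]
      · filter_upwards [h.eventually_mem_topPart ht hzt] with w hw hwf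
        exact iff_of_false (hAT w (hw hwf)) (hAT z hzt)

/-- Sliding a face does not change the number of faces: apart from the face that moves, the faces
correspond to the components of the flat points that meet the region where nothing changes. -/
theorem ncard_faces_slid [Finite ι] (h : IsCollar P U n c N b δ ε) (hP : IsSemilinear P)
    (ht : |t| ≤ ε) : (faces (slid P U n c N b δ t)).ncard = (faces P).ncard := by
  set Z := flatPoints P ∩ outer n c N b δ ε with hZ
  have hmain : ∀ s, |s| ≤ ε → (faces (slid P U n c N b δ s)).ncard =
      ((fun x => closure (connectedComponentIn (flatPoints (slid P U n c N b δ s)) x)) '' Z).ncard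
        + 1 := by
    intro s hs
    set Q := slid P U n c N b δ s with hQ
    have hZQ : Z ⊆ flatPoints Q := fun z hz =>
      (h.mem_flatPoints_slid_iff_of_mem_outer hs hz.2).mpr hz.1
    obtain ⟨x, hx, hxN⟩ := h.exists_mem s (by linarith [h.lt, hs])
    have hxt : x ∈ topPart n c N b s := ⟨hx, hxN⟩
    have hxf := h.topPart_subset_flatPoints hs hxt
    have hfaces : faces Q = insert (closure (connectedComponentIn (flatPoints Q) x))
        ((fun x => closure (connectedComponentIn (flatPoints Q) x)) '' Z) := by
      ext G
      constructor
      · rintro ⟨z, hz, rfl⟩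
        by_cases hzV : z ∈ outer n c N b δ ε
        · exact Or.inr ⟨z, ⟨(h.mem_flatPoints_slid_iff_of_mem_outer hs hzV).mp hz, hzV⟩, rfl⟩
        · rcases (h.mem_flatPoints_slid_iff (h.mem_of_notMem_outer hzV)).mp hz with ⟨i, hi⟩ | hzt
          · obtain ⟨w, hw1, hw2, hw3, hw4⟩ := h.exists_facet i
            have hwo : w ∈ outer n c N b δ ε := fun hw => by linarith [hw.2.1]
            have hws : w ∈ sidePart n c N b δ s i :=
              ⟨hw1, by linarith [h.lt, h.pos, (abs_le.mp hs).1], hw3, hw4⟩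
            refine Or.inr ⟨w, ⟨(h.mem_flatPoints_slid_iff_of_mem_outer hs hwo).mp
              (h.sidePart_subset_flatPoints hs i hws), hwo⟩, ?_⟩
            refine ((closure_connectedComponentIn_eq_iff
              (h.sidePart_subset_flatPoints hs i hws)).mpr ?_).symm
            exact (convex_sidePart n c N b δ s i).isPreconnected.subset_connectedComponentIn hi
              (h.sidePart_subset_flatPoints hs i) hws
          · refine Or.inl ((closure_connectedComponentIn_eq_iff hxf).mpr ?_)
            exact (convex_topPart n c N b s).isPreconnected.subset_connectedComponentIn hzt
              (h.topPart_subset_flatPoints hs) hxt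
      · rintro (rfl | ⟨z, hz, rfl⟩)
        · exact ⟨x, hxf, rfl⟩
        · exact ⟨z, hZQ hz, rfl⟩
    have hnot : closure (connectedComponentIn (flatPoints Q) x) ∉
        (fun x => closure (connectedComponentIn (flatPoints Q) x)) '' Z := by
      rintro ⟨z, hz, hzx⟩
      have h1 := (closure_connectedComponentIn_eq_iff (hZQ hz)).mp hzx.symm
      have hsub := isPreconnected_connectedComponentIn.subset_of_eventually_iff
        (A := topPart n c N b s) (connectedComponentIn_subset (flatPoints Q) x) (fun w hw => ?_)
        (mem_connectedComponentIn hxf) hxt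
      · exact h.notMem_outer_of_mem_topPart hs (hsub h1) hz.2
      · by_cases hwt : w ∈ topPart n c N b s
        · filter_upwards [h.eventually_mem_topPart hs hwt] with y hy hyf
          exact iff_of_true (hy hyf) hwt
        · by_cases hwV : w ∈ outer n c N b δ ε
          · filter_upwards [(isOpen_outer n c N b δ ε).mem_nhds hwV] with y hy _
            exact iff_of_false (fun hyt => h.notMem_outer_of_mem_topPart hs hyt hy) hwt
          · rcases (h.mem_flatPoints_slid_iff (h.mem_of_notMem_outer hwV)).mp hw with ⟨i, hi⟩ | h2
            · filter_upwards [h.eventually_mem_sidePart hs hi] with y hy hyf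
              exact iff_of_false (fun hyt => (hy hyf).2.1.ne hyt.1) hwt
            · exact (hwt h2).elim
    have hfin : (faces Q).Finite := (h.isSemilinear_slid hP hs).finite_faces
    rw [hfaces] at hfin ⊢
    exact ncard_insert_of_notMem hnot (hfin.subset (subset_insert _ _))
  have h0 : |(0 : ℝ)| ≤ ε := by simpa using h.pos.le
  have hP0 := hmain 0 h0
  rw [hmain t ht]
  conv_rhs => rw [← h.slid_zero, hP0]
  congr 1
  refine ncard_image_congr fun x hx y hy => ?_
  have hQ : ∀ s, |s| ≤ ε → ∀ z ∈ Z, z ∈ flatPoints (slid P U n c N b δ s) := fun s hs z hz =>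
    (h.mem_flatPoints_slid_iff_of_mem_outer hs hz.2).mpr hz.1
  rw [closure_connectedComponentIn_eq_iff (hQ t ht y hy),
    closure_connectedComponentIn_eq_iff (hQ 0 h0 y hy)]
  exact ⟨h.mem_connectedComponentIn_slid ht h0 hx.2 hy.2 hx.1,
    h.mem_connectedComponentIn_slid h0 ht hx.2 hy.2 hx.1⟩

end IsCollar

/-! ### Edge length and volume after sliding -/

namespace IsCollar

variable {ι : Type*} {P U : Set E3} {n : E3} {c : ℝ} {N : ι → E3} {b : ι → ℝ} {δ ε t : ℝ}

theorem skeleton_slid_diff (h : IsCollar P U n c N b δ ε) (ht : |t| ≤ ε) :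
    skeleton (slid P U n c N b δ t) \ U = skeleton P \ U := by
  ext x
  refine and_congr_left fun hx => mem_skeleton_congr
    (h.eventually_mem_slid_iff_of_mem_outer ht (not_not.mp fun hc => hx (h.mem_of_notMem_outer hc)))

/-- In the collar the skeleton consists of the creases of the neighbours below the moved plane and of
the boundary of the moved face. -/
theorem skeleton_slid_inter [Finite ι] (h : IsCollar P U n c N b δ ε) (ht : |t| ≤ ε) :
    skeleton (slid P U n c N b δ t) ∩ U =
      (creases N b ∩ {y | c - δ < inner ℝ n y ∧ inner ℝ n y < c + t}) ∪ rim n c N b t := by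
  have ht' := abs_le.mp ht
  have hε := h.pos
  have hlt := h.lt
  have hiff : ∀ x ∈ U, (x ∈ skeleton (slid P U n c N b δ t) ↔ x ∈ creases
      (fun o : Option ι => o.elim n N) (fun o => o.elim (c + t) b)) := fun x hx => by
    rw [mem_skeleton_congr (h.eventually_mem_slid_iff hx),
      skeleton_cone h.norm_option (h.injective_option t)]
  ext x
  constructor
  · rintro ⟨hxs, hxU⟩
    obtain ⟨hxc, j, k, hjk, hj, hk⟩ := (hiff x hxU).mp hxs
    obtain ⟨hxc, hxn⟩ := mem_cone_option.mp hxc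
    rcases hxn.lt_or_eq with hlt | heq
    · rcases j with _ | j
      · exact (hlt.ne hj).elim
      rcases k with _ | k
      · exact (hlt.ne hk).elim
      exact Or.inl ⟨⟨hxc, j, k, fun hjk' => hjk (congrArg some hjk'), hj, hk⟩, h.low x hxU, hlt⟩
    · rcases j with _ | j
      · rcases k with _ | k
        · exact (hjk rfl).elim
        exact Or.inr ⟨hxc, ⟨k, hk⟩, heq⟩
      exact Or.inr ⟨hxc, ⟨j, hj⟩, heq⟩
  · rintro (⟨⟨hxc, j, k, hjk, hj, hk⟩, h1, h2⟩ | ⟨hxc, ⟨i, hi⟩, hxn⟩)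
    · have hxU : x ∈ U := h.slab_subset x hxc h1 (by linarith)
      exact ⟨(hiff x hxU).mpr ⟨mem_cone_option.mpr ⟨hxc, h2.le⟩, some j, some k,
        fun hjk' => hjk (Option.some_injective _ hjk'), hj, hk⟩, hxU⟩
    · have hxU : x ∈ U := h.slab_subset x hxc (by linarith) (by linarith)
      exact ⟨(hiff x hxU).mpr ⟨mem_cone_option.mpr ⟨hxc, hxn.le⟩, none, some i,
        by simp, hxn, hi⟩, hxU⟩

/-- The edge length after sliding, split into the creases below the moved plane, the perimeter of the
moved face, and the part that does not change. -/
theorem hausdorffMeasure_skeleton_slid [Finite ι] (h : IsCollar P U n c N b δ ε) (ht : |t| ≤ ε) :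
    Measure.hausdorffMeasure 1 (skeleton (slid P U n c N b δ t)) =
      Measure.hausdorffMeasure 1 (creases N b ∩ {y | c - δ < inner ℝ n y ∧ inner ℝ n y < c + t}) +
        Measure.hausdorffMeasure 1 (rim n c N b t) +
        Measure.hausdorffMeasure 1 (skeleton P \ U) := by
  have hm : Measurable fun y : E3 => inner ℝ n y := by fun_prop
  rw [← measure_inter_add_sdiff (skeleton (slid P U n c N b δ t)) h.isOpen.measurableSet,
    h.skeleton_slid_diff ht, h.skeleton_slid_inter ht,
    ← measure_inter_add_sdiff (_ ∪ rim n c N b t)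
      (measurableSet_lt hm (measurable_const (a := c + t)))]
  congr 3
  · ext y
    constructor
    · rintro ⟨hy | hy, hlt⟩
      · exact hy
      · exact (hlt.ne hy.2.2).elim
    · exact fun hy => ⟨Or.inl hy, hy.2.2⟩
  · ext y
    constructor
    · rintro ⟨hy | hy, hlt⟩
      · exact (hlt hy.2.2).elim
      · exact hy
    · exact fun hy => ⟨Or.inr hy, fun hlt => hlt.ne hy.2.2⟩

theorem measure_creases_split (N : ι → E3) (b : ι → ℝ) (n : E3) {u v w : ℝ} (huv : u < v)
    (hvw : v ≤ w) :
    Measure.hausdorffMeasure 1 (creases N b ∩ {y | u < inner ℝ n y ∧ inner ℝ n y < w}) =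
      Measure.hausdorffMeasure 1 (creases N b ∩ {y | u < inner ℝ n y ∧ inner ℝ n y < v}) +
      Measure.hausdorffMeasure 1 (creases N b ∩ {y | v ≤ inner ℝ n y ∧ inner ℝ n y < w}) := by
  have hm : Measurable fun y : E3 => inner ℝ n y := by fun_prop
  rw [← measure_inter_add_sdiff (creases N b ∩ {y | u < inner ℝ n y ∧ inner ℝ n y < w})
    (measurableSet_lt hm (measurable_const (a := v)))]
  congr 2
  · ext y
    constructor
    · rintro ⟨⟨h1, h2, h3⟩, h4⟩
      exact ⟨h1, h2, h4⟩
    · rintro ⟨h1, h2, h3⟩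
      exact ⟨⟨h1, h2, h3.trans_le hvw⟩, h3⟩
  · ext y
    constructor
    · rintro ⟨⟨h1, h2, h3⟩, h4⟩
      exact ⟨h1, not_lt.mp h4, h3⟩
    · rintro ⟨h1, h2, h3⟩
      exact ⟨⟨h1, huv.trans_le h2, h3⟩, not_lt.mpr h2⟩

/-- The change of the edge length under sliding is that of the creases of the neighbouring faces
near `F` together with that of the perimeter of the moving face. -/
theorem edgeLength_slid_le [Finite ι] (h : IsCollar P U n c N b δ ε) (hP : IsPolyhedron P)
    {α₁ α₂ : ℝ} (ht0 : 0 < t) (ht : t ≤ ε)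
    (hest : (Measure.hausdorffMeasure 1 (rim n c N b t) ≠ ⊤ ∧
          Measure.hausdorffMeasure 1 (rim n c N b (-t)) ≠ ⊤ ∧
          Measure.hausdorffMeasure 1 (rim n c N b 0) ≠ ⊤) ∧
        (Measure.hausdorffMeasure 1
            (creases N b ∩ {y | c ≤ inner ℝ n y ∧ inner ℝ n y < c + t})).toReal +
          (Measure.hausdorffMeasure 1 (rim n c N b t)).toReal ≤
          (Measure.hausdorffMeasure 1 (rim n c N b 0)).toReal + α₂ * t ∧
        (Measure.hausdorffMeasure 1
            (creases N b ∩ {y | c - t ≤ inner ℝ n y ∧ inner ℝ n y < c}) ≠ ⊤ →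
          (Measure.hausdorffMeasure 1 (rim n c N b (-t))).toReal + α₁ * t ≤
          (Measure.hausdorffMeasure 1
            (creases N b ∩ {y | c - t ≤ inner ℝ n y ∧ inner ℝ n y < c})).toReal +
          (Measure.hausdorffMeasure 1 (rim n c N b 0)).toReal)) :
    edgeLength (slid P U n c N b δ t) ≤ edgeLength P + α₂ * t ∧
      edgeLength (slid P U n c N b δ (-t)) ≤ edgeLength P - α₁ * t := by
  have hε := h.pos
  have hlt := h.lt
  obtain ⟨-, h2, h3⟩ := hest
  have ht1 : |t| ≤ ε := by rwa [abs_of_pos ht0]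
  have ht2 : |-t| ≤ ε := by rwa [abs_neg]
  have ht3 : |(0 : ℝ)| ≤ ε := by simpa using hε.le
  have e1 := h.hausdorffMeasure_skeleton_slid ht1
  have e2 := h.hausdorffMeasure_skeleton_slid ht2
  have e3 := h.hausdorffMeasure_skeleton_slid ht3
  have f1 := (h.isPolyhedron_slid hP ht1).hausdorffMeasure_skeleton_ne_top
  have f2 := (h.isPolyhedron_slid hP ht2).hausdorffMeasure_skeleton_ne_top
  have f3 := (h.isPolyhedron_slid hP ht3).hausdorffMeasure_skeleton_ne_top
  have s1 := measure_creases_split N b n (u := c - δ) (v := c) (w := c + t) (by linarith)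
    (by linarith)
  have s2 := measure_creases_split N b n (u := c - δ) (v := c - t) (w := c) (by linarith)
    (by linarith)
  rw [← sub_eq_add_neg] at e2
  rw [add_zero] at e3
  have e3' := e3
  rw [s1] at e1
  rw [s2] at e3'
  rw [e1] at f1
  rw [e2] at f2
  have f3' := f3
  rw [e3'] at f3'
  rw [e3] at f3
  simp only [ne_eq, ENNReal.add_eq_top, not_or] at f1 f2 f3 f3'
  have g3 := h3 f3'.1.1.2
  simp only [edgeLength]
  have z : Measure.hausdorffMeasure 1 (skeleton P) =
    Measure.hausdorffMeasure 1 (skeleton (slid P U n c N b δ 0)) := by rw [h.slid_zero]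
  constructor
  · rw [z, e1, e3, ENNReal.toReal_add (ENNReal.add_ne_top.mpr ⟨ENNReal.add_ne_top.mpr f1.1.1, f1.1.2⟩)
      f1.2, ENNReal.toReal_add (ENNReal.add_ne_top.mpr f1.1.1) f1.1.2,
      ENNReal.toReal_add f1.1.1.1 f1.1.1.2,
      ENNReal.toReal_add (ENNReal.add_ne_top.mpr f3.1) f3.2, ENNReal.toReal_add f3.1.1 f3.1.2]
    linarith
  · rw [z, e2, e3', ENNReal.toReal_add (ENNReal.add_ne_top.mpr f2.1) f2.2,
      ENNReal.toReal_add f2.1.1 f2.1.2,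
      ENNReal.toReal_add (ENNReal.add_ne_top.mpr ⟨ENNReal.add_ne_top.mpr f3'.1.1, f3'.1.2⟩)
      f3'.2, ENNReal.toReal_add (ENNReal.add_ne_top.mpr f3'.1.1) f3'.1.2,
      ENNReal.toReal_add f3'.1.1.1 f3'.1.1.2]
    linarith

theorem volume_slid (h : IsCollar P U n c N b δ ε) (hP : IsCompact P) (ht : |t| ≤ ε) :
    (volume (slid P U n c N b δ t)).toReal = (volume (P \ U)).toReal +
      (volume (cone N b ∩ {y | c - δ < inner ℝ n y ∧ inner ℝ n y ≤ c + t})).toReal := by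
  have hfin := (h.isCompact_slid hP ht).measure_lt_top (μ := volume)
  have h1 := measure_inter_add_sdiff (μ := volume) (slid P U n c N b δ t) h.isOpen.measurableSet
  have h2 : slid P U n c N b δ t \ U = P \ U := by
    ext y
    exact and_congr_left fun hy => h.mem_slid_iff_of_notMem (abs_le.mp ht).2 hy
  rw [h.slid_inter (abs_le.mp ht).2, h2] at h1
  have hne := hfin.ne
  rw [← h1, ENNReal.add_ne_top] at hne
  rw [← h1, ENNReal.toReal_add hne.1 hne.2, add_comm]

end IsCollar

/-! ### Vertices of degree greater than three -/

/-- If near the vertex `H` the skeleton consists of rays that start at `H` and whose other points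
are edge points, then the degree of `H` is at most the number of rays. -/
theorem degree_le_card {κ : Type*} [Fintype κ] {P : Set E3} {H : E3} (hH : H ∉ edgePoints P)
    {d : κ → E3} {ρ : ℝ} (hρ : 0 < ρ)
    (hedge : ∀ k, ∀ r : ℝ, 0 < r → H + r • d k ∈ Metric.ball H ρ → H + r • d k ∈ edgePoints P)
    (hray : ∀ y ∈ Metric.ball H ρ, y ∈ skeleton P → y = H ∨ ∃ k, ∃ r : ℝ, 0 < r ∧ y = H + r • d k) :
    degree P H ≤ Fintype.card κ := by
  have hp : ∀ k, ∃ r : ℝ, 0 < r ∧ H + r • d k ∈ Metric.ball H ρ := fun k =>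
    ((tendsto_add_smul_nhdsGT_zero H (d k)).eventually (Metric.ball_mem_nhds H hρ)).and
      self_mem_nhdsWithin |>.exists.imp fun r hr => ⟨hr.2, hr.1⟩
  choose p hp0 hpb using hp
  have hsub : {e | e ∈ edges P ∧ H ∈ e} ⊆
      range fun k => closure (connectedComponentIn (edgePoints P) (H + p k • d k)) := by
    rintro _ ⟨⟨x, hx, rfl⟩, hHe⟩
    obtain ⟨z, hzx, hzb⟩ := Metric.mem_closure_iff.mp hHe ρ hρ
    have hzb : z ∈ Metric.ball H ρ := by rwa [Metric.mem_ball, dist_comm]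
    have hze := connectedComponentIn_subset _ _ hzx
    rcases hray z hzb hze.1 with rfl | ⟨k, r, hr, rfl⟩
    · exact (hH hze).elim
    · refine ⟨k, ?_⟩
      simp only
      rw [connectedComponentIn_eq hzx]
      congr 1
      refine (connectedComponentIn_eq ?_).symm
      have hpre : IsPreconnected ((fun r : ℝ => H + r • d k) ''
          (Ioi 0 ∩ (fun r : ℝ => H + r • d k) ⁻¹' Metric.ball H ρ)) := by
        refine IsPreconnected.image (Convex.isPreconnected ((convex_Ioi 0).inter ?_)) _
          (by fun_prop)
        have : (fun r : ℝ => H + r • d k) ⁻¹' Metric.ball H ρ =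
            (LinearMap.toSpanSingleton ℝ E3 (d k)) ⁻¹' Metric.ball 0 ρ := by
          ext s
          simp
        rw [this]
        exact (convex_ball 0 ρ).linear_preimage _
      refine hpre.subset_connectedComponentIn ⟨r, ⟨hr, hzb⟩, rfl⟩ ?_ ⟨p k, ⟨hp0 k, hpb k⟩, rfl⟩
      rintro _ ⟨s, ⟨hs, hsb⟩, rfl⟩
      exact hedge k s hs hsb
  have := Set.ncard_le_ncard hsub (finite_range _)
  refine this.trans ?_
  rw [← image_univ]
  exact (Set.ncard_image_le finite_univ).trans (by rw [Set.ncard_univ, Nat.card_eq_fintype_card])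

/-- The directions of the three rays that bound the cone `⟪g k, y⟫ ≤ 0`: the negative of the dual
basis. -/
theorem exists_dual {g : Fin 3 → E3} (hg : LinearIndependent ℝ g) :
    ∃ d : Fin 3 → E3, (∀ k, inner ℝ (g k) (d k) = -1) ∧ ∀ j k, j ≠ k → inner ℝ (g j) (d k) = 0 := by
  set T : E3 →ₗ[ℝ] (Fin 3 → ℝ) := LinearMap.pi fun j => innerₗ E3 (g j) with hT
  have hTa : ∀ y j, T y j = inner ℝ (g j) y := fun y j => rfl
  have hinj : Function.Injective T := by
    intro y z hyz
    have h3 : g = ![g 0, g 1, g 2] := by ext i; fin_cases i <;> rfl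
    rw [h3] at hg
    exact eq_of_inner_eq_of_linearIndependent hg (by rw [← hTa, ← hTa, hyz])
      (by rw [← hTa, ← hTa, hyz]) (by rw [← hTa, ← hTa, hyz])
  have hsurj : Function.Surjective T :=
    (LinearMap.injective_iff_surjective_of_finrank_eq_finrank (by simp)).mp hinj
  choose d hd using fun k : Fin 3 => hsurj (Pi.single k (-1))
  refine ⟨d, fun k => ?_, fun j k hjk => ?_⟩
  · rw [← hTa, hd, Pi.single_eq_same]
  · rw [← hTa, hd, Pi.single_eq_of_ne hjk]

/-- A vertex near which `P` is the intersection of three half-spaces has degree at most three. -/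
theorem degree_le_three {P : Set E3} {H : E3} (hH : H ∉ edgePoints P) {g : Fin 3 → E3}
    {β : Fin 3 → ℝ} (hg : LinearIndependent ℝ g) (hg1 : ∀ k, ‖g k‖ = 1)
    (hgH : ∀ k, inner ℝ (g k) H = β k) (hP : ∀ᶠ y in 𝓝 H, (y ∈ P ↔ y ∈ cone g β)) :
    degree P H ≤ 3 := by
  have hsk : ∀ᶠ y in 𝓝 H, (y ∈ skeleton P ↔ y ∈ creases g β) := by
    filter_upwards [hP.eventually_nhds] with y hy
    rw [mem_skeleton_congr hy, skeleton_cone hg1 fun j k hjk _ => hg.injective hjk]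
  obtain ⟨ρ, hρ, hsk⟩ := Metric.eventually_nhds_iff_ball.mp hsk
  obtain ⟨d, hd1, hd0⟩ := exists_dual hg
  have hray : ∀ k y, (∀ l, l ≠ k → inner ℝ (g l) y = β l) →
      y = H + (β k - inner ℝ (g k) y) • d k := by
    intro k y hy
    have h3 : g = ![g 0, g 1, g 2] := by ext i; fin_cases i <;> rfl
    have key : ∀ l, inner ℝ (g l) y = inner ℝ (g l) (H + (β k - inner ℝ (g k) y) • d k) := by
      intro l
      rw [inner_add_right, inner_smul_right, hgH]
      by_cases hl : l = k
      · rw [hl, hd1]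
        ring
      · rw [hd0 l k hl, hy l hl]
        ring
    rw [h3] at hg
    exact eq_of_inner_eq_of_linearIndependent hg (key 0) (key 1) (key 2)
  have hfin : ∀ k : Fin 3, ∃ j l : Fin 3, j ≠ l ∧ j ≠ k ∧ l ≠ k := by decide
  have hfin' : ∀ j l k m : Fin 3, j ≠ l → j ≠ k → l ≠ k → m ≠ k → m = j ∨ m = l := by decide
  have h := degree_le_card (κ := Fin 3) hH hρ (d := d) ?_ ?_
  · simpa using h
  · intro k r hr hb
    obtain ⟨j, l, hjl, hjk, hlk⟩ := hfin k
    have hin : ∀ s : ℝ, ∀ m, m ≠ k → inner ℝ (g m) (H + s • d k) = β m := fun s m hm => by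
      rw [inner_add_right, inner_smul_right, hd0 m k hm, hgH, mul_zero, add_zero]
    have hink : ∀ s : ℝ, inner ℝ (g k) (H + s • d k) = β k - s := fun s => by
      rw [inner_add_right, inner_smul_right, hd1, hgH]
      ring
    have hcr : ∀ s : ℝ, 0 ≤ s → H + s • d k ∈ creases g β := fun s hs =>
      ⟨fun m => by
        by_cases hm : m = k
        · rw [hm, hink]
          linarith
        · exact (hin s m hm).le, j, l, hjl, hin s j hjk, hin s l hlk⟩
    refine ⟨(hsk _ hb).mpr (hcr r hr.le), d k, fun h0 => ?_, ?_⟩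
    · have := hd1 k
      rw [h0, inner_zero_right] at this
      norm_num at this
    · have hlt : ∀ᶠ y in 𝓝 (H + r • d k), inner ℝ (g k) y < β k := by
        have hc : Continuous fun y : E3 => inner ℝ (g k) y := by fun_prop
        exact hc.continuousAt.eventually_lt_const (by simp only [hink]; linarith)
      filter_upwards [Metric.isOpen_ball.mem_nhds hb, hlt] with y hyb hyk
      rw [hsk y hyb]
      constructor
      · rintro ⟨-, j', l', hjl', hj', hl'⟩
        have hjk' : j' ≠ k := fun hh => hyk.ne (hh ▸ hj')
        have hlk' : l' ≠ k := fun hh => hyk.ne (hh ▸ hl')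
        refine ⟨β k - inner ℝ (g k) y - r, ?_⟩
        have hy := hray k y fun m hm => by
          rcases hfin' j' l' k m hjl' hjk' hlk' hm with rfl | rfl
          · exact hj'
          · exact hl'
        rw [sub_smul, add_add_sub_cancel]
        exact hy
      · rintro ⟨s, rfl⟩
        rw [add_assoc, ← add_smul] at hyk ⊢
        rw [hink] at hyk
        exact hcr _ (by linarith)
  · intro y hyb hys
    obtain ⟨hyc, j, l, hjl, hj, hl⟩ := (hsk y hyb).mp hys
    obtain ⟨k, hjk, hlk⟩ : ∃ k : Fin 3, j ≠ k ∧ l ≠ k :=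
      (by decide : ∀ j l : Fin 3, ∃ k : Fin 3, j ≠ k ∧ l ≠ k) j l
    have hy := hray k y fun m hm => by
      rcases hfin' j l k m hjl hjk hlk hm with rfl | rfl
      · exact hj
      · exact hl
    rcases (hyc k).lt_or_eq with hlt | heq
    · exact Or.inr ⟨k, _, sub_pos.mpr hlt, hy⟩
    · rw [heq, sub_self, zero_smul, add_zero] at hy
      exact Or.inl hy

/-- A point near which `P` is the intersection of two half-spaces is an edge point. -/
theorem mem_edgePoints_of_two {P : Set E3} {H u v : E3} {β γ : ℝ}
    (hg : LinearIndependent ℝ ![u, v]) (hu1 : ‖u‖ = 1) (hv1 : ‖v‖ = 1) (hu : inner ℝ u H = β)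
    (hv : inner ℝ v H = γ) (hP : ∀ᶠ y in 𝓝 H, (y ∈ P ↔ inner ℝ u y ≤ β ∧ inner ℝ v y ≤ γ)) :
    H ∈ edgePoints P := by
  have hc : ∀ y, y ∈ cone ![u, v] ![β, γ] ↔ inner ℝ u y ≤ β ∧ inner ℝ v y ≤ γ := fun y => by
    simp only [cone, mem_ofPred_eq, Fin.forall_fin_two, Matrix.cons_val_zero, Matrix.cons_val_one]
  have hcr : ∀ y, y ∈ creases ![u, v] ![β, γ] ↔ inner ℝ u y = β ∧ inner ℝ v y = γ := by
    intro y
    simp only [creases, mem_ofPred_eq, hc, Fin.exists_fin_two, Matrix.cons_val_zero,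
      Matrix.cons_val_one]
    constructor
    · rintro ⟨-, (⟨h, -⟩ | ⟨-, h⟩) | (⟨-, h⟩ | ⟨h, -⟩)⟩
      · exact (h rfl).elim
      · exact h
      · exact h.symm
      · exact (h rfl).elim
    · rintro ⟨h1, h2⟩
      exact ⟨⟨h1.le, h2.le⟩, Or.inl (Or.inr ⟨by decide, h1, h2⟩)⟩
  have hn : ∀ k, ‖(![u, v] : Fin 2 → E3) k‖ = 1 := by
    simp only [Fin.forall_fin_two, Matrix.cons_val_zero, Matrix.cons_val_one, hu1, hv1, and_self]
  have hsk : ∀ᶠ y in 𝓝 H, (y ∈ skeleton P ↔ inner ℝ u y = β ∧ inner ℝ v y = γ) := by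
    filter_upwards [hP.eventually_nhds] with y hy
    rw [mem_skeleton_congr (hy.mono fun z hz => hz.trans (hc z).symm),
      skeleton_cone hn fun j k hjk _ => hg.injective hjk, hcr]
  obtain ⟨τ, hτ, huτ, hvτ, hspan⟩ := exists_unit_spanning_orthogonal hg
  refine ⟨hsk.self_of_nhds.mpr ⟨hu, hv⟩, τ, fun h0 => by simp [h0] at hτ, ?_⟩
  filter_upwards [hsk] with y hy
  rw [hy]
  constructor
  · rintro ⟨h1, h2⟩
    have := hspan (y - H) (by rw [inner_sub_right, h1, hu, sub_self])
      (by rw [inner_sub_right, h2, hv, sub_self])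
    exact ⟨_, by rw [← this]; abel⟩
  · rintro ⟨r, rfl⟩
    simp only [inner_add_right, inner_smul_right, huτ, hvτ, hu, hv, mul_zero, add_zero, and_self]

/-- If a vertex on `F` has degree greater than three, then some face adjacent to `F` meets the plane
of `F` in a single point. -/
theorem IsCollar.exists_facetSlice_subsingleton {ι : Type*} [Finite ι] {P U : Set E3} {n : E3}
    {c : ℝ} {N : ι → E3} {b : ι → ℝ} {δ ε : ℝ} (h : IsCollar P U n c N b δ ε) {H : E3}
    (hHU : H ∈ U) (hHF : H ∈ slice n c N b 0) (hH : H ∈ vertices P) (hdeg : 3 < degree P H) :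
    ∃ i, (facetSlice n c N b i 0).Subsingleton := by
  by_contra! hall
  have hHn : inner ℝ n H = c := by simpa using hHF.2
  have hP : ∀ᶠ y in 𝓝 H, (y ∈ P ↔ y ∈ cone N b ∧ inner ℝ n y ≤ c) := by
    filter_upwards [h.isOpen.mem_nhds hHU] with y hy using h.mem_iff y hy
  have hstrict := eventually_inner_lt_of (M := N) (d := b) (x := H)
    (s := {i | inner ℝ (N i) H ≠ b i}) fun i hi => lt_of_le_of_ne (hHF.1 i) hi
  have hn := h.system.norm_eq
  -- a vertex lies on two of the neighbouring planes
  have hex : ∃ i, inner ℝ (N i) H = b i := by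
    by_contra! hne
    have hflat : IsHalfspaceAt P H n c := by
      refine ⟨hn, hHn, ?_⟩
      filter_upwards [hP, hstrict] with y hy hyN
      rw [hy]
      exact and_iff_right fun i => (hyN i (hne i)).le
    exact hH.1.2 ⟨n, c, hflat⟩
  obtain ⟨i, hi⟩ := hex
  have hex2 : ∃ j, j ≠ i ∧ inner ℝ (N j) H = b j := by
    by_contra! hne
    refine hH.2 (mem_edgePoints_of_two (h.system.linearIndependent_pair i) hn (h.norm_eq i) hHn hi ?_)
    filter_upwards [hP, hstrict] with y hy hyN
    rw [hy, and_comm]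
    refine and_congr_right fun _ => ⟨fun hc => hc i, fun hc k => ?_⟩
    by_cases hk : k = i
    · exact hk ▸ hc
    · exact (hyN k (hne k hk)).le
  obtain ⟨j, hji, hj⟩ := hex2
  have hLI : LinearIndependent ℝ ![n, N i, N j] := by
    rw [Fintype.linearIndependent_iff]
    intro f hf
    simp only [Fin.sum_univ_three, Matrix.cons_val_zero, Matrix.cons_val_one, Matrix.cons_val] at hf
    have h2 : f 1 * b i + f 2 * b j + f 0 * c = 0 := by
      have := congrArg (fun z => inner ℝ z H) hf
      simp only [inner_add_left, real_inner_smul_left, inner_zero_left, hHn, hi, hj] at this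
      linarith
    obtain ⟨h3, h4, h5⟩ := h.system.coeff_eq_zero (Ne.symm hji) (α := f 1) (β := f 2) (γ := f 0)
      (by rw [← hf]; abel) h2
    intro k
    fin_cases k
    · exact h5
    · exact h3
    · exact h4
  -- A third active neighbour is excluded by `not_three_active`, so that near `H` the set is the
  -- intersection of the three half-spaces.
  refine hdeg.not_ge (degree_le_three hH.2 (g := ![n, N i, N j]) (β := ![c, b i, b j]) hLI ?_ ?_ ?_)
  · intro k
    fin_cases k
    · exact hn
    · exact h.norm_eq i
    · exact h.norm_eq j
  · intro k
    fin_cases k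
    · exact hHn
    · exact hi
    · exact hj
  · filter_upwards [hP, hstrict] with y hy hyN
    rw [hy]
    constructor
    · rintro ⟨h1, h2⟩ k
      fin_cases k
      · exact h2
      · exact h1 i
      · exact h1 j
    · intro hc
      refine ⟨fun k => ?_, hc 0⟩
      by_cases hki : k = i
      · exact hki ▸ hc 1
      by_cases hkj : k = j
      · exact hkj ▸ hc 2
      refine (hyN k fun hk => ?_).le
      exact h.system.not_three_active (fun i => not_subsingleton_iff.mpr (hall i)) hHF (Ne.symm hji)
        (Ne.symm hki) (Ne.symm hkj) hi hj hk

/-! ### The Melzak ratio decreases in one of the two directions -/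

theorem eventually_neg_of_hasDerivAt {φ : ℝ → ℝ} {D : ℝ} (h : HasDerivAt φ D 0) (h0 : φ 0 = 0)
    (hD : D < 0) : ∀ᶠ t in 𝓝[>] (0 : ℝ), φ t < 0 := by
  filter_upwards [h.tendsto_slope_zero_right.eventually_lt_const hD, self_mem_nhdsWithin]
    with t ht ht0
  have ht0 : (0 : ℝ) < t := ht0
  rw [zero_add, h0, sub_zero, smul_eq_mul] at ht
  by_contra! hcon
  exact ht.not_ge (by positivity)

theorem eventually_forall_le_of_eventually {p : ℝ → Prop} (h : ∀ᶠ t in 𝓝[>] (0 : ℝ), p t) :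
    ∀ᶠ ε in 𝓝[>] (0 : ℝ), ∀ t, 0 < t → t ≤ ε → p t := by
  obtain ⟨a, ha, hsub⟩ := mem_nhdsGT_iff_exists_Ioc_subset.mp h
  filter_upwards [Ioc_mem_nhdsGT ha] with ε hε t ht hte
  exact hsub ⟨ht, hte.trans hε.2⟩

/-- If `E t ≤ E 0 + α₂ t` for `t > 0` and `E t ≤ E 0 + α₁ t` for `t < 0`, with `α₂ < α₁`, and `V` is
differentiable at `0`, then `E ^ 3 / V` decreases in one of the two directions: with a common
derivative `α` of `E`, the sign of `3 * α * V - E * A` would decide between them unless it is zero,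
and the gap between `α₂` and `α₁` removes this exception. -/
theorem eventually_ratio_lt_or {E V : ℝ → ℝ} {α₁ α₂ A : ℝ} (hα : α₂ < α₁) (hE : ∀ t, 0 ≤ E t)
    (hest : ∀ᶠ t in 𝓝[>] (0 : ℝ), E t ≤ E 0 + α₂ * t ∧ E (-t) ≤ E 0 - α₁ * t)
    (hV : HasDerivAt V A 0) (hV0 : 0 < V 0) :
    (∀ᶠ t in 𝓝[>] (0 : ℝ), E t ^ 3 / V t < E 0 ^ 3 / V 0) ∨
      ∀ᶠ t in 𝓝[>] (0 : ℝ), E (-t) ^ 3 / V (-t) < E 0 ^ 3 / V 0 := by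
  have hEpos : 0 < E 0 := by
    obtain ⟨t, ⟨h1, h2⟩, ht⟩ := (hest.and self_mem_nhdsWithin).exists
    have ht : (0 : ℝ) < t := ht
    have h3 := hE t
    have h4 := hE (-t)
    refine (hE 0).lt_of_ne fun h0 => ?_
    have := mul_lt_mul_of_pos_right hα ht
    linarith
  have hVc : ∀ᶠ t in 𝓝[>] (0 : ℝ), 0 < V t :=
    nhdsWithin_le_nhds (hV.continuousAt.eventually_const_lt hV0)
  have hVm : HasDerivAt (fun t => V (-t)) (-A) 0 := by
    have := HasDerivAt.comp_const_sub 0 0 (f := V) (f' := A) (by simpa using hV)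
    simpa using this
  have hVmc : ∀ᶠ t in 𝓝[>] (0 : ℝ), 0 < V (-t) :=
    nhdsWithin_le_nhds (hVm.continuousAt.eventually_const_lt (by simpa using hV0))
  -- the derivative at zero of the cleared upper bound for the ratio
  have hφ : ∀ (β B : ℝ) (v : ℝ → ℝ), HasDerivAt v B 0 → HasDerivAt
      (fun t => (E 0 + β * t) ^ 3 * V 0 - E 0 ^ 3 * v t)
      (3 * E 0 ^ 2 * β * V 0 - E 0 ^ 3 * B) 0 := by
    intro β B v hv
    have h1 : HasDerivAt (fun t : ℝ => E 0 + β * t) β 0 := by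
      simpa using ((hasDerivAt_id (0 : ℝ)).const_mul β).const_add (E 0)
    have h2 := ((h1.pow 3).mul_const (V 0)).sub (hv.const_mul (E 0 ^ 3))
    refine h2.congr_deriv ?_
    simp only [mul_zero, add_zero]
    norm_num
  by_cases hcase : 3 * E 0 ^ 2 * α₂ * V 0 - E 0 ^ 3 * A < 0
  · left
    filter_upwards [eventually_neg_of_hasDerivAt (hφ α₂ A V hV) (by ring) hcase, hVc, hest]
      with t h1 h2 h3
    rw [div_lt_div_iff₀ h2 hV0]
    have := mul_le_mul_of_nonneg_right (pow_le_pow_left₀ (hE t) h3.1 3) hV0.le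
    linarith
  · right
    have hD : 3 * E 0 ^ 2 * (-α₁) * V 0 - E 0 ^ 3 * (-A) < 0 := by
      have : 3 * E 0 ^ 2 * V 0 * α₂ < 3 * E 0 ^ 2 * V 0 * α₁ :=
        mul_lt_mul_of_pos_left hα (by positivity)
      linarith
    filter_upwards [eventually_neg_of_hasDerivAt (hφ (-α₁) (-A) _ hVm)
      (by simp only [neg_zero]; ring) hD, hVmc, hest] with t h1 h2 h3
    rw [div_lt_div_iff₀ h2 hV0]
    have := mul_le_mul_of_nonneg_right (pow_le_pow_left₀ (hE (-t)) h3.2 3) hV0.le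
    rw [neg_mul, ← sub_eq_add_neg] at h1
    linarith

/-- Near an exposed face the hypotheses for sliding it hold, for all sufficiently small heights. -/
theorem IsFaceSystem.eventually_isCollar {ι : Type*} [Finite ι] {P W : Set E3} {n : E3} {c η : ℝ}
    {N : ι → E3} {b : ι → ℝ} (h : IsFaceSystem n c N b) (hN : ∀ i, ‖N i‖ = 1) (hW : IsOpen W)
    (hWP : W ∩ P = W ∩ (cone N b ∩ {y | inner ℝ n y ≤ c})) (hη : 0 < η)
    (hηW : ∀ y ∈ cone N b, |inner ℝ n y - c| ≤ η → y ∈ W) :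
    ∀ᶠ δ in 𝓝[>] (0 : ℝ), ∀ ε, 0 < ε → 2 * ε < δ →
      IsCollar P (W ∩ {y | c - δ < inner ℝ n y}) n c N b δ ε := by
  obtain ⟨η', hη', hbd⟩ := h.bounded
  choose y hyn hyi hyk using h.exists_facet
  choose z hzn hzi hzk using h.exists_contact
  have hsmall : ∀ᶠ δ in 𝓝[>] (0 : ℝ), ∀ i, δ ≤ c - inner ℝ n (y i) := by
    refine eventually_all.mpr fun i => ?_
    filter_upwards [Ioc_mem_nhdsGT (sub_pos.mpr (hyn i))] with δ hδ using hδ.2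
  filter_upwards [hsmall, h.eventually_slice_nonempty, Ioc_mem_nhdsGT hη, Ioc_mem_nhdsGT hη']
    with δ hδy hδs hδη hδη' ε hε hεδ
  have hδ := hδη.1
  have hc : Continuous fun y : E3 => inner ℝ n y := by fun_prop
  refine ⟨h, hN, hε, hεδ, hW.inter (isOpen_lt continuous_const hc), ?_, fun y hy => hy.2, ?_, ?_,
    fun s hs => hδs s (by linarith), ?_⟩
  · intro x hx
    have := Set.ext_iff.mp hWP x
    simpa only [mem_inter_iff, hx.1, true_and, mem_ofPred_eq] using this
  · intro x hx h1 h2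
    refine ⟨hηW x hx ?_, h1⟩
    rw [abs_le]
    constructor <;> linarith [hδη.2]
  · exact hbd.subset fun x hx => ⟨hx.1, le_trans hx.2 hδη'.2⟩
  · intro i
    -- the point of the segment from the contact point to the facet point at height `-3δ/4`
    set l := 3 * δ / 4 / (c - inner ℝ n (y i)) with hl
    have hpos := sub_pos.mpr (hyn i)
    have hl0 : 0 < l := by positivity
    have hl1 : l < 1 := by
      rw [hl, div_lt_one hpos]
      linarith [hδy i]
    have hln : l * (inner ℝ n (y i) - inner ℝ n (z i)) = -(3 * δ / 4) := by
      rw [hzn i, hl]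
      field_simp
      ring
    refine ⟨z i + l • (y i - z i), ?_, ?_, ?_, fun k hk => ?_⟩
    · rw [inner_add_smul_sub, hln, hzn]
      linarith
    · rw [inner_add_smul_sub, hln, hzn]
      linarith
    · rw [inner_add_smul_sub, hyi, hzi, sub_self, mul_zero, add_zero]
    · rw [inner_add_smul_sub]
      have h1 := mul_lt_mul_of_pos_left (hyk i k hk) hl0
      have h2 := mul_le_mul_of_nonneg_left (hzk i k) (sub_nonneg.mpr hl1.le)
      linarith

end Melzak

theorem mainTheorem1 (P F : Set Melzak.E3) (hP : Melzak.IsPolyhedron P)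
    (hF : F ∈ Melzak.faces P) (hexp : Melzak.IsExposed P F)
    (hdeg : ∃ H ∈ Melzak.vertices P, H ∈ F ∧ 3 < Melzak.degree P H) :
    ∃ (U : Set Melzak.E3) (n : Melzak.E3) (c δ : ℝ), Melzak.IsCollarNhd P F U n c δ ∧
      ∃ ε : ℝ, 0 < ε ∧ ε < δ ∧
        (∀ t : ℝ, |t| ≤ ε → Melzak.collar P F n c δ t ⊆ U) ∧
        ((∀ t : ℝ, 0 < t → t ≤ ε →
            Melzak.Improves (Melzak.slideFace P F U n c δ t) P) ∨
          (∀ t : ℝ, 0 < t → t ≤ ε →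
            Melzak.Improves (Melzak.slideFace P F U n c δ (-t)) P)) := by
  open Melzak in
  obtain ⟨n, c, N, b, W, η, hFn, hN, hK, hsys, hFs, hW, hFW, hWP, hη, hηW⟩ :=
    exists_isFaceSystem hP hF hexp
  have : Finite (NeighborFace P F) :=
    (hP.isSemilinear.finite_faces.subset fun G hG => hG.1).to_subtype
  obtain ⟨η', hη', hbd⟩ := hsys.bounded
  obtain ⟨δ, hcol, hδ⟩ := ((hsys.eventually_isCollar hN hW hWP hη hηW).and
    (Ioc_mem_nhdsGT hη')).exists
  set U := W ∩ {y : E3 | c - δ < inner ℝ n y} with hU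
  have hcollar : ∀ t, collar P F n c δ t =
      cone N b ∩ {y | c - δ < inner ℝ n y ∧ inner ℝ n y ≤ c + t} := by
    intro t
    rw [← hK]
    rfl
  have hslide : ∀ t, slideFace P F U n c δ t = slid P U n c N b δ t := by
    intro t
    rw [slideFace, hcollar, slid]
  have hδ0 := hδ.1
  -- data at a fixed small `ε`, from which the asymptotic behaviour is read off
  have hcol₀ := hcol (δ / 4) (by linarith) (by linarith)
  have hFU : F ⊆ U := by
    refine fun x hx => ⟨hFW hx, ?_⟩
    have : inner ℝ n x = c := hFn.1 hx
    simp only [mem_ofPred_eq, this]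
    linarith
  obtain ⟨H, hHv, hHF, hHd⟩ := hdeg
  obtain ⟨α₁, α₂, -, hα, hest⟩ := hsys.exists_edge_estimates
  -- the vertex of degree greater than three makes the estimates strict
  have hα := hα (hcol₀.exists_facetSlice_subsingleton (hFU hHF) (hFs ▸ hHF) hHv hHd)
  obtain ⟨x, hx, hxN⟩ := hcol₀.exists_mem 0 (by rw [abs_zero]; linarith)
  obtain ⟨A, hA⟩ := exists_hasDerivAt_volume_slab (convex_cone N b) (isClosed_cone N b)
    hsys.norm_eq hη' hδ0 hδ.2 hbd (mem_interior_cone hxN) (by rw [hx, add_zero])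
  have hslid0 := hcol₀.slid_zero
  have hvol : HasDerivAt (fun t => (volume (slid P U n c N b δ t)).toReal) A 0 := by
    refine (hA.const_add (volume (P \ U)).toReal).congr_of_eventuallyEq ?_
    filter_upwards [Metric.closedBall_mem_nhds (0 : ℝ) (show 0 < δ / 4 by linarith)] with t ht
    exact hcol₀.volume_slid hP.isCompact (by simpa [Real.dist_eq] using ht)
  have hvol0 : 0 < (volume (slid P U n c N b δ 0)).toReal := by
    rw [hslid0]
    refine ENNReal.toReal_pos ?_ hP.isCompact.measure_lt_top.ne
    exact (Measure.measure_pos_of_nonempty_interior volume hP.isConnected_interior.nonempty).ne'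
  have hedge : ∀ᶠ t in 𝓝[>] (0 : ℝ),
      edgeLength (slid P U n c N b δ t) ≤ edgeLength (slid P U n c N b δ 0) + α₂ * t ∧
      edgeLength (slid P U n c N b δ (-t)) ≤ edgeLength (slid P U n c N b δ 0) - α₁ * t := by
    filter_upwards [hest, Ioc_mem_nhdsGT (show 0 < δ / 4 by linarith)] with t ht ht'
    rw [hslid0]
    exact hcol₀.edgeLength_slid_le hP ht'.1 ht'.2 (ht t ht'.1 le_rfl)
  have hratio := eventually_ratio_lt_or (E := fun t => edgeLength (slid P U n c N b δ t)) hα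
    (fun t => ENNReal.toReal_nonneg) hedge hvol hvol0
  have himp : ∀ t, |t| ≤ δ / 4 → melzakRatio (slid P U n c N b δ t) < melzakRatio P →
      Improves (slideFace P F U n c δ t) P := by
    intro t ht hlt
    rw [hslide]
    exact ⟨hcol₀.isPolyhedron_slid hP ht, hcol₀.ncard_faces_slid hP.isSemilinear ht, hlt⟩
  simp only [hslid0] at hratio
  have hsmall := Ioc_mem_nhdsGT (show (0 : ℝ) < δ / 4 by linarith)
  refine ⟨U, n, c, δ, ⟨hFn, hδ0, hcol₀.isOpen, hFU, ?_⟩, ?_⟩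
  · rw [hcollar, ← hcol₀.slid_inter hcol₀.pos.le, hslid0, inter_comm]
  have hsub : ∀ ε, ε ≤ δ / 4 → ∀ t, |t| ≤ ε → collar P F n c δ t ⊆ U := by
    intro ε hε t ht
    rw [hcollar, ← hcol₀.slid_inter ((le_abs_self t).trans (ht.trans hε))]
    exact inter_subset_right
  rcases hratio with hr | hr
  · obtain ⟨ε, h1, h2⟩ := ((eventually_forall_le_of_eventually hr).and hsmall).exists
    refine ⟨ε, h2.1, by linarith [h2.2], hsub ε h2.2, Or.inl fun t ht0 hte => ?_⟩
    exact himp t (by rw [abs_of_pos ht0]; exact hte.trans h2.2) (h1 t ht0 hte)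
  · obtain ⟨ε, h1, h2⟩ := ((eventually_forall_le_of_eventually hr).and hsmall).exists
    refine ⟨ε, h2.1, by linarith [h2.2], hsub ε h2.2, Or.inr fun t ht0 hte => ?_⟩
    exact himp (-t) (by rw [abs_neg, abs_of_pos ht0]; exact hte.trans h2.2) (h1 t ht0 hte)
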